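/- A data $\omega$-word $\sigma$ over a finite alphabet $\Sigma$ is an $\omega$-word $\sigma(0)\sigma(1)\cdots$ over $\Sigma$ together with an equivalence relation $\sim$ on $\mathbb{N}$; $[i]$ denotes the class of position $i$. A safety one-way alternating automaton with one register (safety 1ARA$_1$) is a tuple $\langle \Sigma, Q, q_I, \delta\rangle$ with $\Sigma$ a finite alphabet, $Q$ a finite set of states, $q_I \in Q$, and $\delta$ mapping each element of $Q\times\Sigma\times\{\uparrow,\not\uparrow\}$ to a positive Boolean formula over $Q \uplus {\downarrow}Q$. A pair of sets $Q', Q'_\downarrow \subseteq Q$ satisfies the atom $q$ iff $q\in Q'$, and the atom ${\downarrow}q$ iff $q\in Q'_\downarrow$. A configuration is a pair $\langle q, D\rangle$ with $q\in Q$ and $D\in\mathbb{N}/{\sim}$. There is a step $F \to F'$ at position $i$ between sets of configurations iff for each $c=\langle q,D\rangle\in F$ there are sets $Q^c,Q^c_\downarrow\subseteq Q$ that satisfy $\delta(q,\sigma(i),\uparrow)$ if $D=[i]$, or $\delta(q,\sigma(i),\not\uparrow)$ if $D\ne[i]$, such that $F' = \{\langle q',D\rangle : c = \langle q,D\rangle\in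 F,\ q'\in Q^c\}\cup\{\langle q',[i]\rangle : c\in F,\ q'\in Q^c_\downarrow\}$. The automaton accepts $\sigma$ iff there is an infinite run $F_0\to F_1\to\cdots$, with the step from $F_i$ to $F_{i+1}$ at position $i$ and $F_0=\{\langle q_I,[0]\rangle\}$. Safety 1ARA$_1$ nonemptiness is the problem: given a safety 1ARA$_1$, does it accept some data $\omega$-word over its alphabet? Formulae of safety LTL$^\downarrow_1(\mathtt{X},\mathtt{R})$ over a finite alphabet $\Sigma$ are given by $$\phi ::= a \mid \top \mid \bot \mid \phi\wedge\phi \mid \phi\vee\phi \mid \mathtt{X}\phi \mid \phi\,\mathtt{R}\,\phi \mid {\downarrow}\phi \mid {\uparrow} \mid {\not\uparrow} \qquad (a \in \Sigma).$$ With respect to a data $\omega$-word $\sigma$, a position $i$ and a register value $D\in\mathbb{N}/{\sim}$: $a$ means $\sigma(i)=a$; $\mathtt{X}\phi$ means $\phi$ at $i+1$ with the same $D$; $\phi\,\mathtt{R}\,\psi$ means that, with the same $D$, either $\psi$ holds at all $k\ge i$, or for some $j\ge i$, $\phi$ holds at $j$ and $\psi$ holds at all $k\in\{i,\dots,j\}$;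 ${\downarrow}\phi$ means $\phi$ at $i$ with register value $[i]$; $\uparrow$ means $i\in D$; $\not\uparrow$ means $i\notin D$; the Boolean cases are as usual. A sentence is a formula in which each $\uparrow$ and each $\not\uparrow$ is in the scope of a ${\downarrow}$. Safety LTL$^\downarrow_1(\mathtt{X},\mathtt{R})$ satisfiability is the problem: given a finite alphabet $\Sigma$ and a sentence over $\Sigma$, is there a data $\omega$-word over $\Sigma$ that satisfies it at position $0$? Instances are written as strings over a fixed finite alphabet by listing the alphabet, the states, the transition table and the formulae explicitly. **Theorem.** Safety 1ARA$_1$ nonemptiness and safety LTL$^\downarrow_1(\mathtt{X},\mathtt{R})$ satisfiability are both ExpSpace-hard with respect to logarithmic-space many-one reductions: every language decidable by a deterministic Turing machine in space $2^{p(n)}$, for some polynomial $p$, is reducible to each of the two problems by a function computable in logarithmic space. -/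

import Mathlib

/-! ## Data words -/

/-- A data `ω`-word over `A`: an `ω`-word together with an equivalence relation on positions. -/
structure DataWord (A : Type) where
  letter : ℕ → A
  sim : Setoid ℕ

/-- The data of `σ`: the classes of its equivalence relation. -/
abbrev DataWord.Datum {A : Type} (σ : DataWord A) : Type := Quotient σ.sim

/-- The class of the position `i`. -/
def DataWord.cls {A : Type} (σ : DataWord A) (i : ℕ) : σ.Datum := Quotient.mk σ.sim i

/-! ## Safety one-way alternating automata with one register -/

/-- Positive Boolean formulae over `Q ∪ ↓Q`. -/
inductive PosBool (Q : Type) : Type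
  | keep (q : Q)
  | down (q : Q)
  | top
  | bot
  | and (φ ψ : PosBool Q)
  | or (φ ψ : PosBool Q)

/-- Satisfaction of a positive Boolean formula by a pair of sets of states. -/
def PosBool.Sat {Q : Type} (S T : Set Q) : PosBool Q → Prop
  | .keep q => q ∈ S
  | .down q => q ∈ T
  | .top => True
  | .bot => False
  | .and φ ψ => φ.Sat S T ∧ ψ.Sat S T
  | .or φ ψ => φ.Sat S T ∨ ψ.Sat S T

/-- A safety 1ARA₁ with alphabet `A` and set of states `Q`. The Boolean argument of `trans`
is `true` for `↑` and `false` for its negation. -/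
structure SafetyARA (A Q : Type) where
  start : Q
  trans : Q → A → Bool → PosBool Q

namespace SafetyARA

variable {A Q : Type}

/-- Configurations: a state and a register value. -/
abbrev Config (Q : Type) (σ : DataWord A) : Type := Q × σ.Datum

open Classical in
/-- The formula that governs the configuration `c` at position `i`. -/
noncomputable def rule (M : SafetyARA A Q) (σ : DataWord A) (i : ℕ) (c : Config Q σ) :
    PosBool Q :=
  M.trans c.1 (σ.letter i) (decide (c.2 = σ.cls i))

/-- One step of a run at position `i`: for each configuration `c` of `F`, a pair of sets of states
`S c`, `T c` satisfying the governing formula is chosen, and `F'` consists of the resulting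
configurations. (If `Q` and `F` are finite then so is `F'`.) -/
def Step (M : SafetyARA A Q) (σ : DataWord A) (i : ℕ) (F F' : Set (Config Q σ)) : Prop :=
  ∃ S T : Config Q σ → Set Q,
    (∀ c ∈ F, (M.rule σ i c).Sat (S c) (T c)) ∧
    F' = {d | ∃ c ∈ F, d.1 ∈ S c ∧ d.2 = c.2} ∪ {d | ∃ c ∈ F, d.1 ∈ T c ∧ d.2 = σ.cls i}

/-- Acceptance: existence of an infinite run from the initial configuration. -/
def Accepts (M : SafetyARA A Q) (σ : DataWord A) : Prop :=
  ∃ F : ℕ → Set (Config Q σ),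
    F 0 = {(M.start, σ.cls 0)} ∧ ∀ i, M.Step σ i (F i) (F (i + 1))

/-- The language of the automaton. -/
def lang (M : SafetyARA A Q) : Set (DataWord A) := {σ | M.Accepts σ}

end SafetyARA

/-! ## Safety future-time linear temporal logic with one register -/

/-- Formulae of safety LTL↓₁(X, R) over the alphabet `A`. -/
inductive SafetyLTL (A : Type) : Type
  | letter (a : A)
  | top
  | bot
  | and (φ ψ : SafetyLTL A)
  | or (φ ψ : SafetyLTL A)
  | next (φ : SafetyLTL A)
  | release (φ ψ : SafetyLTL A)
  | freeze (φ : SafetyLTL A)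
  | up
  | notUp

namespace SafetyLTL

variable {A : Type}

/-- `φ.Sat σ i D`: satisfaction of `φ` by `σ` at position `i` with register value `D`. -/
def Sat (σ : DataWord A) : SafetyLTL A → ℕ → σ.Datum → Prop
  | .letter a, i, _ => σ.letter i = a
  | .top, _, _ => True
  | .bot, _, _ => False
  | .and φ ψ, i, D => φ.Sat σ i D ∧ ψ.Sat σ i D
  | .or φ ψ, i, D => φ.Sat σ i D ∨ ψ.Sat σ i D
  | .next φ, i, D => φ.Sat σ (i + 1) D
  | .release φ ψ, i, D =>
      (∀ k, i ≤ k → ψ.Sat σ k D) ∨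
        ∃ j, i ≤ j ∧ φ.Sat σ j D ∧ ∀ k, i ≤ k → k ≤ j → ψ.Sat σ k D
  | .freeze φ, i, _ => φ.Sat σ i (σ.cls i)
  | .up, i, D => σ.cls i = D
  | .notUp, i, D => σ.cls i ≠ D

/-- Sentences: no occurrence of `↑` or of its negation outside the scope of a freeze quantifier. -/
def IsSentence : SafetyLTL A → Prop
  | .letter _ => True
  | .top => True
  | .bot => True
  | .and φ ψ => φ.IsSentence ∧ ψ.IsSentence
  | .or φ ψ => φ.IsSentence ∧ ψ.IsSentence
  | .next φ => φ.IsSentence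
  | .release φ ψ => φ.IsSentence ∧ ψ.IsSentence
  | .freeze _ => True
  | .up => False
  | .notUp => False

/-- The language of a sentence (whose satisfaction does not depend on the register value). -/
def lang (φ : SafetyLTL A) : Set (DataWord A) := {σ | ∀ D : σ.Datum, φ.Sat σ 0 D}

end SafetyLTL

/-! ## Instances as strings

Alphabets and sets of states of instances are `Fin m`; their sizes and elements are written in
unary, formulae in Polish notation, and transition functions as tables. -/

/-- The string alphabet for automata. -/
inductive ARASym : Type
  | tick | sep | keep | down | top | bot | and | or
  deriving DecidableEq

/-- The string alphabet for temporal formulae. -/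
inductive LTLSym : Type
  | tick | sep | letter | top | bot | and | or | next | release | freeze | up | notUp
  deriving DecidableEq

/-- The number `n` in unary, written with `s` and terminated by `t`. -/
def unary {B : Type} (s t : B) (n : ℕ) : List B := List.replicate n s ++ [t]

/-- The string for a positive Boolean formula. -/
def PosBool.encode {k : ℕ} : PosBool (Fin k) → List ARASym
  | .keep q => .keep :: unary .tick .sep q
  | .down q => .down :: unary .tick .sep q
  | .top => [.top]
  | .bot => [.bot]
  | .and φ ψ => .and :: (φ.encode ++ ψ.encode)
  | .or φ ψ => .or :: (φ.encode ++ ψ.encode)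

/-- The string for an automaton: the number of letters, the number of states, the initial state,
and the table of the transition function. -/
def SafetyARA.encode {m k : ℕ} (M : SafetyARA (Fin m) (Fin k)) : List ARASym :=
  unary .tick .sep m ++ unary .tick .sep k ++ unary .tick .sep M.start ++
    (List.finRange k).flatMap fun q => (List.finRange m).flatMap fun a =>
      (M.trans q a true).encode ++ (M.trans q a false).encode

/-- The string for a temporal formula. -/
def SafetyLTL.encodeFormula {m : ℕ} : SafetyLTL (Fin m) → List LTLSym
  | .letter a => .letter :: unary .tick .sep a
  | .top => [.top]
  | .bot => [.bot]
  | .and φ ψ => .and :: (φ.encodeFormula ++ ψ.encodeFormula)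
  | .or φ ψ => .or :: (φ.encodeFormula ++ ψ.encodeFormula)
  | .next φ => .next :: φ.encodeFormula
  | .release φ ψ => .release :: (φ.encodeFormula ++ ψ.encodeFormula)
  | .freeze φ => .freeze :: φ.encodeFormula
  | .up => [.up]
  | .notUp => [.notUp]

/-- The string for a temporal formula together with its alphabet. -/
def SafetyLTL.encode {m : ℕ} (φ : SafetyLTL (Fin m)) : List LTLSym :=
  unary .tick .sep m ++ φ.encodeFormula

theorem unary_append_inj {B : Type} {s t : B} (h : s ≠ t) {m n : ℕ} {u v : List B}
    (e : unary s t m ++ u = unary s t n ++ v) : m = n ∧ u = v := by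
  induction m generalizing n with
  | zero =>
    cases n with
    | zero => simpa [unary] using e
    | succ n => simp [unary, List.replicate_succ, h.symm] at e
  | succ m ih =>
    cases n with
    | zero => simp [unary, List.replicate_succ, h] at e
    | succ n =>
      have := @ih n (by simpa [unary, List.replicate_succ] using e)
      exact ⟨by rw [this.1], this.2⟩

theorem PosBool.encode_append_inj {k : ℕ} {φ ψ : PosBool (Fin k)} {u v : List ARASym}
    (e : φ.encode ++ u = ψ.encode ++ v) : φ = ψ ∧ u = v := by
  induction φ generalizing ψ u v with
  | keep q | down q =>
    cases ψ <;> simp [encode] at e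
    have := unary_append_inj (s := ARASym.tick) (t := .sep) (by decide) e
    exact ⟨by rw [Fin.ext this.1], this.2⟩
  | top | bot => cases ψ <;> simp [encode] at e ⊢; exact e
  | and φ₁ φ₂ ih₁ ih₂ | or φ₁ φ₂ ih₁ ih₂ =>
    cases ψ <;> simp [encode] at e
    obtain ⟨rfl, e₁⟩ := ih₁ e
    obtain ⟨rfl, e₂⟩ := ih₂ e₁
    exact ⟨rfl, e₂⟩

theorem flatMap_append_inj {X B : Type} {f g : X → List B}
    (h : ∀ x u v, f x ++ u = g x ++ v → f x = g x ∧ u = v) (l : List X) {u v : List B}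
    (e : l.flatMap f ++ u = l.flatMap g ++ v) : (∀ x ∈ l, f x = g x) ∧ u = v := by
  induction l with
  | nil => simpa using e
  | cons x l ih =>
    simp only [List.flatMap_cons, List.append_assoc] at e
    obtain ⟨h₁, e⟩ := h _ _ _ e
    obtain ⟨h₂, e⟩ := ih e
    exact ⟨by simpa [h₁] using h₂, e⟩

/-- Distinct automata have distinct strings. -/
theorem SafetyARA.encode_inj {m k m' k' : ℕ} {M : SafetyARA (Fin m) (Fin k)}
    {N : SafetyARA (Fin m') (Fin k')} (e : M.encode = N.encode) :
    m = m' ∧ k = k' ∧ HEq M N := by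
  simp only [encode, List.append_assoc] at e
  obtain ⟨rfl, e⟩ := unary_append_inj (by decide) e
  obtain ⟨rfl, e⟩ := unary_append_inj (by decide) e
  obtain ⟨hs, e⟩ := unary_append_inj (by decide) e
  refine ⟨rfl, rfl, heq_of_eq ?_⟩
  have cell : ∀ q a (u v : List ARASym),
      ((M.trans q a true).encode ++ (M.trans q a false).encode) ++ u =
        ((N.trans q a true).encode ++ (N.trans q a false).encode) ++ v →
      (M.trans q a true = N.trans q a true ∧ M.trans q a false = N.trans q a false) ∧ u = v := by
    intro q a u v e
    simp only [List.append_assoc] at e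
    obtain ⟨h₁, e⟩ := PosBool.encode_append_inj e
    obtain ⟨h₂, e⟩ := PosBool.encode_append_inj e
    exact ⟨⟨h₁, h₂⟩, e⟩
  have row := fun q (u v : List ARASym) => flatMap_append_inj (u := u) (v := v)
    (fun a u v e => by
      obtain ⟨⟨h₁, h₂⟩, e⟩ := cell q a u v e
      exact ⟨by rw [h₁, h₂], e⟩) (List.finRange m)
  have tab := (flatMap_append_inj (u := []) (v := [])
    (fun q u v e => by
      obtain ⟨h, e⟩ := row q u v e
      refine ⟨?_, e⟩
      simp only [List.flatMap]
      exact congrArg List.flatten (List.map_congr_left h)) (List.finRange k) (by simpa using e)).1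
  cases M with | mk sM tM => cases N with | mk sN tN =>
  obtain rfl : sM = sN := Fin.ext hs
  congr 1
  funext q a b
  have h := (row q [] [] (by simpa using tab q (List.mem_finRange q))).1 a (List.mem_finRange a)
  have := (cell q a [] [] (by simpa using h)).1
  cases b
  · exact this.2
  · exact this.1

theorem SafetyLTL.encodeFormula_append_inj {m : ℕ} {φ ψ : SafetyLTL (Fin m)} {u v : List LTLSym}
    (e : φ.encodeFormula ++ u = ψ.encodeFormula ++ v) : φ = ψ ∧ u = v := by
  induction φ generalizing ψ u v with
  | letter q =>
    cases ψ <;> simp [encodeFormula] at e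
    have := unary_append_inj (s := LTLSym.tick) (t := .sep) (by decide) e
    exact ⟨by rw [Fin.ext this.1], this.2⟩
  | top | bot | up | notUp => cases ψ <;> simp [encodeFormula] at e ⊢; exact e
  | next φ ih | freeze φ ih =>
    cases ψ <;> simp [encodeFormula] at e
    obtain ⟨rfl, e₁⟩ := ih e
    exact ⟨rfl, e₁⟩
  | and φ₁ φ₂ ih₁ ih₂ | or φ₁ φ₂ ih₁ ih₂ | release φ₁ φ₂ ih₁ ih₂ =>
    cases ψ <;> simp [encodeFormula] at e
    obtain ⟨rfl, e₁⟩ := ih₁ e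
    obtain ⟨rfl, e₂⟩ := ih₂ e₁
    exact ⟨rfl, e₂⟩

/-- Distinct formulae have distinct strings. -/
theorem SafetyLTL.encode_inj {m m' : ℕ} {φ : SafetyLTL (Fin m)} {ψ : SafetyLTL (Fin m')}
    (e : φ.encode = ψ.encode) : m = m' ∧ HEq φ ψ := by
  simp only [encode] at e
  obtain ⟨rfl, e⟩ := unary_append_inj (by decide) e
  exact ⟨rfl, heq_of_eq (encodeFormula_append_inj (u := []) (v := []) (by simpa using e)).1⟩

/-- Safety 1ARA₁ nonemptiness: given a safety 1ARA₁, is its language nonempty? -/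
def safetyARANonemptiness : Language ARASym :=
  {w | ∃ (m k : ℕ) (M : SafetyARA (Fin m) (Fin k)), w = M.encode ∧ M.lang.Nonempty}

/-- Safety LTL↓₁(X, R) satisfiability: given a sentence, is its language nonempty? -/
def safetyLTLSatisfiability : Language LTLSym :=
  {w | ∃ (m : ℕ) (φ : SafetyLTL (Fin m)), w = φ.encode ∧ φ.IsSentence ∧ φ.lang.Nonempty}

/-! ## The class ExpSpace -/

/-- Deterministic Turing machines with input alphabet `A` and one tape, which is infinite to the
right. The machine halts when `trans` is undefined. -/
structure TuringDecider (A : Type) where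
  Sym : Type
  [symFintype : Fintype Sym]
  State : Type
  [stateFintype : Fintype State]
  inSym : A ↪ Sym
  blank : Sym
  inSym_ne_blank : ∀ a, inSym a ≠ blank
  start : State
  accept : Set State
  trans : State → Sym → Option (State × Sym × Turing.Dir)

namespace TuringDecider

variable {A : Type}

/-- Configurations: the state, the position of the head and the contents of the tape. -/
structure Cfg (M : TuringDecider A) where
  state : M.State
  head : ℕ
  tape : ℕ → M.Sym

/-- Head movement on a tape with cells `0, 1, 2, …`; at cell `0`, a move to the left has
no effect. -/
def moveHead (i : ℕ) : Turing.Dir → ℕ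
  | .left => i - 1
  | .right => i + 1

/-- The initial configuration on the input `x`. -/
def initial (M : TuringDecider A) (x : List A) : M.Cfg where
  state := M.start
  head := 0
  tape i := (x[i]?.map M.inSym).getD M.blank

/-- One computation step. -/
def step (M : TuringDecider A) (c : M.Cfg) : Option M.Cfg :=
  (M.trans c.state (c.tape c.head)).map fun r =>
    { state := r.1
      head := moveHead c.head r.2.2
      tape := Function.update c.tape c.head r.2.1 }

end TuringDecider

/-- `L` is decided by a deterministic Turing machine that halts on every input and, on inputs of
length `n`, visits only the first `2 ^ p(n)` tape cells, for some polynomial `p`. -/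
def InExpSpace {A : Type} (L : Language A) : Prop :=
  ∃ (M : TuringDecider A) (p : Polynomial ℕ), ∀ x : List A,
    (∀ c, StateTransition.Reaches M.step (M.initial x) c → c.head < 2 ^ p.eval x.length) ∧
    ∃ c, StateTransition.Reaches M.step (M.initial x) c ∧ M.step c = none ∧
      (c.state ∈ M.accept ↔ x ∈ L)

/-! ## Logarithmic-space reductions -/

/-- Movements of a head. -/
inductive HeadMove : Type
  | left | stay | right

/-- Head movement on a tape with cells `0, 1, 2, …`; at cell `0`, a move to the left has
no effect. -/
def HeadMove.apply (i : ℕ) : HeadMove → ℕ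
  | .left => i - 1
  | .stay => i
  | .right => i + 1

/-- The contents of a cell of a read-only input tape. -/
inductive InCell (A : Type) : Type
  | leftEnd
  | sym (a : A)
  | rightEnd

/-- The cell `i` of the input tape for `x`: cell `0` holds the left end marker, cells
`1, …, |x|` hold `x`, and the next cell holds the right end marker. -/
def inputCell {A : Type} (x : List A) : ℕ → InCell A
  | 0 => .leftEnd
  | i + 1 => (x[i]?.map InCell.sym).getD .rightEnd

/-- Deterministic Turing machines with a two-way read-only input tape over `A`, finitely many
work tapes, and a one-way write-only output tape over `B`. In each step at most one symbol
is appended to the output. The machine halts when `trans` is undefined. -/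
structure Transducer (A B : Type) where
  tapes : ℕ
  Sym : Type
  [symFintype : Fintype Sym]
  blank : Sym
  State : Type
  [stateFintype : Fintype State]
  start : State
  trans : State → InCell A → (Fin tapes → Sym) →
    Option (State × HeadMove × (Fin tapes → Sym × HeadMove) × Option B)

namespace Transducer

variable {A B : Type}

/-- Configurations: the state, the position of the input head, the positions of the work heads,
the contents of the work tapes, and the output written so far. -/
structure Cfg (T : Transducer A B) where
  state : T.State
  inHead : ℕ
  head : Fin T.tapes → ℕ
  tape : Fin T.tapes → ℕ → T.Sym
  out : List B

/-- The initial configuration. -/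
def initial (T : Transducer A B) : T.Cfg where
  state := T.start
  inHead := 0
  head _ := 0
  tape _ _ := T.blank
  out := []

/-- One computation step on the input `x`. The input head stays between the end markers. -/
def step (T : Transducer A B) (x : List A) (c : T.Cfg) : Option T.Cfg :=
  (T.trans c.state (inputCell x c.inHead) fun t => c.tape t (c.head t)).map
    fun (q, d, w, o) =>
      { state := q
        inHead := min (d.apply c.inHead) (x.length + 1)
        head := fun t => (w t).2.apply (c.head t)
        tape := fun t => Function.update (c.tape t) (c.head t) (w t).1
        out := c.out ++ o.toList }

end Transducer

/-- `f` is computed by a transducer that halts on every input and, on inputs of length `n`, visits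
only `O(log n)` cells of each work tape. -/
def LogspaceComputable {A B : Type} (f : List A → List B) : Prop :=
  ∃ (T : Transducer A B) (C : ℕ), ∀ x : List A,
    (∀ c, StateTransition.Reaches (T.step x) T.initial c →
      ∀ t, c.head t < C * (Nat.log 2 x.length + 1)) ∧
    ∃ c, StateTransition.Reaches (T.step x) T.initial c ∧ T.step x c = none ∧ c.out = f x

/-- Logarithmic-space many-one reducibility. -/
def LogspaceReducible {A B : Type} (L : Language A) (P : Language B) : Prop :=
  ∃ f : List A → List B, LogspaceComputable f ∧ ∀ x, x ∈ L ↔ f x ∈ P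

/-- `P` is ExpSpace-hard: every language in ExpSpace, over any finite alphabet, is reducible
to `P` in logarithmic space. -/
def ExpSpaceHard {B : Type} (P : Language B) : Prop :=
  ∀ (A : Type) [Finite A] (L : Language A), InExpSpace L → LogspaceReducible L P

/-!
The infinite computation of a Turing machine on `2 ^ N` cells that never rejects is written as a
data `ω`-word, row after row. Each cell is followed by its address as `N` bits, so that addresses
can be checked to count modulo `2 ^ N` by comparing letters at distance `N + 1`. The data link
successive rows: cells with the same datum have the same address, and for every cell the datum
occurs again before the end of the next row. That occurrence is then at the same address in the next
row, where the required contents can be checked. That the datum occurs again is a safety condition,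
because of the bound on where it does. Both the sentence and the automaton have size polynomial in
`N` and in the length of the input.

Taking `N` to be a power of a fixed base `B` with exponent about `log n`, where `n` is the length of
the input, gives a polynomial bound that is as large as needed, and counters below `N` are words of
`O(log n)` digits over a fixed alphabet. A transducer can therefore write out the instances with
loops over such counters, one for each iterated conjunction or table.
-/

/-! ## Sweeping programs -/

/-- A program that operates on a word over `S` held on a work tape. In each round it passes over the
word from left to right with a Mealy machine, and then, depending on the state and on the current
input cell, moves the input head, possibly extends the word by one symbol, possibly produces an
output symbol, and either starts a new round or exits with a value in `E`. Such programs compose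
sequentially and can be iterated, which transducers do not do conveniently. -/
structure Sweep (A O S E : Type) where
  Q : Type
  [fintype : Fintype Q]
  start : Q
  mealy : Q → S → Q × S
  act : Q → InCell A → (Q ⊕ E) × HeadMove × Option S × Option O

attribute [instance] Sweep.fintype

/-- One pass of a Mealy machine over a word: the last state and the rewritten word. -/
def mealyRun {Q S : Type} (δ : Q → S → Q × S) : Q → List S → Q × List S
  | q, [] => (q, [])
  | q, s :: w => ((mealyRun δ (δ q s).1 w).1, (δ q s).2 :: (mealyRun δ (δ q s).1 w).2)

theorem length_mealyRun {Q S : Type} (δ : Q → S → Q × S) (q : Q) (w : List S) :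
    (mealyRun δ q w).2.length = w.length := by
  induction w generalizing q with
  | nil => rfl
  | cons s w ih => simp [mealyRun, ih]

theorem mealyRun_of_fixed {Q S : Type} {δ : Q → S → Q × S} {q : Q} (h : ∀ s, δ q s = (q, s))
    (w : List S) : mealyRun δ q w = (q, w) := by
  induction w with
  | nil => rfl
  | cons s w ih => simp [mealyRun, h, ih]

namespace Sweep

variable {A O S E E₂ : Type}

/-- One round from state `q`, word `w` and input head at `h`: the next state or the exit value, the
new word, the new position of the input head, and the output. -/
def round (F : Sweep A O S E) (x : List A) (q : F.Q) (w : List S) (h : ℕ) :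
    (F.Q ⊕ E) × List S × ℕ × List O :=
  let r := mealyRun F.mealy q w
  let a := F.act r.1 (inputCell x h)
  (a.1, r.2 ++ a.2.2.1.toList, min (a.2.1.apply h) (x.length + 1), a.2.2.2.toList)

/-- `F.Exec x bd q w h e w' h' o`: started in state `q` with word `w` and input head at `h`, the
program exits with value `e`, word `w'` and input head at `h'`, after producing the output `o`;
at the start of each round the word has length at most `bd`. -/
inductive Exec (F : Sweep A O S E) (x : List A) (bd : ℕ) :
    F.Q → List S → ℕ → E → List S → ℕ → List O → Prop
  | exit {q : F.Q} {w : List S} {h : ℕ} {e : E} {w' : List S} {h' : ℕ} {o : List O}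
      (hbd : w.length ≤ bd) (hround : F.round x q w h = (.inr e, w', h', o)) :
      Exec F x bd q w h e w' h' o
  | step {q q₁ : F.Q} {w w₁ w' : List S} {h h₁ h' : ℕ} {e : E} {o₁ o : List O}
      (hbd : w.length ≤ bd) (hround : F.round x q w h = (.inl q₁, w₁, h₁, o₁))
      (next : Exec F x bd q₁ w₁ h₁ e w' h' o) :
      Exec F x bd q w h e w' h' (o₁ ++ o)

/-- Executions from the start state. -/
abbrev Runs (F : Sweep A O S E) (x : List A) (bd : ℕ) (w : List S) (h : ℕ) (e : E)
    (w' : List S) (h' : ℕ) (o : List O) : Prop :=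
  F.Exec x bd F.start w h e w' h' o

theorem Exec.mono {F : Sweep A O S E} {x : List A} {bd bd' : ℕ} (hb : bd ≤ bd') {q : F.Q}
    {w w' : List S} {h h' : ℕ} {e : E} {o : List O} (hp : F.Exec x bd q w h e w' h' o) :
    F.Exec x bd' q w h e w' h' o := by
  induction hp with
  | exit hbd hround => exact .exit (hbd.trans hb) hround
  | step hbd hround _ ih => exact .step (hbd.trans hb) hround ih

/-! ### Single passes -/

/-- The program that makes a single pass with the given Mealy machine. -/
def pass {Q : Type} [Fintype Q] (start : Q) (mealy : Q → S → Q × S)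
    (fin : Q → InCell A → E × HeadMove × Option S × Option O) : Sweep A O S E where
  Q := Q
  start := start
  mealy := mealy
  act q a := (.inr (fin q a).1, (fin q a).2)

theorem pass_runs {Q : Type} [Fintype Q] {start q : Q} {mealy : Q → S → Q × S}
    {fin : Q → InCell A → E × HeadMove × Option S × Option O} {x : List A} {bd : ℕ}
    {w w' : List S} {h : ℕ} {e : E} {mv : HeadMove} {ap : Option S} {o : Option O}
    (hbd : w.length ≤ bd) (hw : mealyRun mealy start w = (q, w'))
    (hfin : fin q (inputCell x h) = (e, mv, ap, o)) :
    (pass start mealy fin).Runs x bd w h e (w' ++ ap.toList)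
      (min (mv.apply h) (x.length + 1)) o.toList :=
  .exit hbd (by simp [round, pass, hw, hfin])

/-- The program that leaves the word as it is, exits with a value that depends on the current input
cell, and moves the input head. -/
def inspect (fin : InCell A → E × HeadMove) : Sweep A O S E :=
  pass () (fun q s => (q, s)) fun _ a => ((fin a).1, (fin a).2, none, none)

theorem inspect_runs {fin : InCell A → E × HeadMove} {x : List A} {bd : ℕ} {w : List S}
    {h h' : ℕ} {e : E} (hbd : w.length ≤ bd) (he : (fin (inputCell x h)).1 = e)
    (hmv : min ((fin (inputCell x h)).2.apply h) (x.length + 1) = h') :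
    (inspect (O := O) fin).Runs x bd w h e w h' [] :=
  .exit hbd (by simp [round, inspect, pass, mealyRun_of_fixed (fun _ => rfl), he, hmv])

/-! ### Sequential composition -/

/-- Sequential composition; the second program may depend on the exit value of the first one. -/
def bind [Fintype E] (F : Sweep A O S E) (G : E → Sweep A O S E₂) : Sweep A O S E₂ where
  Q := F.Q ⊕ Σ e, (G e).Q
  start := .inl F.start
  mealy q s := match q with
    | .inl q => (.inl (F.mealy q s).1, (F.mealy q s).2)
    | .inr ⟨e, q⟩ => (.inr ⟨e, ((G e).mealy q s).1⟩, ((G e).mealy q s).2)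
  act q a := match q with
    | .inl q => ((match (F.act q a).1 with
        | .inl q' => .inl (.inl q')
        | .inr e => .inl (.inr ⟨e, (G e).start⟩)), (F.act q a).2)
    | .inr ⟨e, q⟩ => ((match ((G e).act q a).1 with
        | .inl q' => .inl (.inr ⟨e, q'⟩)
        | .inr e' => .inr e'), ((G e).act q a).2)

section Bind

variable [Fintype E] (F : Sweep A O S E) (G : E → Sweep A O S E₂)

theorem mealyRun_bind_inl (q : F.Q) (w : List S) : mealyRun (F.bind G).mealy (.inl q) w =
    (.inl (mealyRun F.mealy q w).1, (mealyRun F.mealy q w).2) := by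
  induction w generalizing q with
  | nil => rfl
  | cons s w ih => simp only [mealyRun, bind] at ih ⊢; simp only [ih]

theorem mealyRun_bind_inr (e : E) (q : (G e).Q) (w : List S) :
    mealyRun (F.bind G).mealy (.inr ⟨e, q⟩) w =
      (.inr ⟨e, (mealyRun (G e).mealy q w).1⟩, (mealyRun (G e).mealy q w).2) := by
  induction w generalizing q with
  | nil => rfl
  | cons s w ih => simp only [mealyRun, bind] at ih ⊢; simp only [ih]

theorem round_bind_inl (x : List A) (q : F.Q) (w : List S) (h : ℕ) :
    (F.bind G).round x (.inl q) w h =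
      (.inl ((F.round x q w h).1.elim .inl fun e => .inr ⟨e, (G e).start⟩),
        (F.round x q w h).2) := by
  simp only [round, mealyRun_bind_inl]
  simp only [bind]
  cases (F.act (mealyRun F.mealy q w).1 (inputCell x h)).1 <;> rfl

theorem round_bind_inr (x : List A) (e : E) (q : (G e).Q) (w : List S) (h : ℕ) :
    (F.bind G).round x (.inr ⟨e, q⟩) w h =
      (((G e).round x q w h).1.map (fun q' => .inr ⟨e, q'⟩) id, ((G e).round x q w h).2) := by
  simp only [round, mealyRun_bind_inr]
  simp only [bind]
  cases ((G e).act (mealyRun (G e).mealy q w).1 (inputCell x h)).1 <;> rfl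

variable {F G}

theorem Exec.bind_inr {x : List A} {bd : ℕ} {e : E} {q : (G e).Q} {w w' : List S} {h h' : ℕ}
    {e' : E₂} {o : List O} (hG : (G e).Exec x bd q w h e' w' h' o) :
    (F.bind G).Exec x bd (.inr ⟨e, q⟩) w h e' w' h' o := by
  induction hG with
  | exit hbd hround => exact .exit hbd (by simp only [round_bind_inr, hround]; rfl)
  | step hbd hround _ ih => exact .step hbd (by simp only [round_bind_inr, hround]; rfl) ih

theorem Exec.bind_inl {x : List A} {bd : ℕ} {q : F.Q} {w w₁ w₂ : List S} {h h₁ h₂ : ℕ} {e : E}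
    {e' : E₂} {o₁ o₂ : List O} (hF : F.Exec x bd q w h e w₁ h₁ o₁)
    (hG : (G e).Runs x bd w₁ h₁ e' w₂ h₂ o₂) :
    (F.bind G).Exec x bd (.inl q) w h e' w₂ h₂ (o₁ ++ o₂) := by
  induction hF with
  | exit hbd hround => exact .step hbd (by simp only [round_bind_inl, hround]; rfl) hG.bind_inr
  | step hbd hround _ ih =>
    rw [List.append_assoc]
    exact .step hbd (by simp only [round_bind_inl, hround]; rfl) (ih hG)

theorem bind_runs {x : List A} {bd : ℕ} {w w₁ w₂ : List S} {h h₁ h₂ : ℕ} {e : E} {e' : E₂}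
    {o₁ o₂ : List O} (hF : F.Runs x bd w h e w₁ h₁ o₁)
    (hG : (G e).Runs x bd w₁ h₁ e' w₂ h₂ o₂) :
    (F.bind G).Runs x bd w h e' w₂ h₂ (o₁ ++ o₂) :=
  hF.bind_inl hG

end Bind

/-! ### Iteration -/

/-- Repetition as long as the exit value is `true`. -/
def doWhile (F : Sweep A O S Bool) : Sweep A O S Unit where
  Q := F.Q
  start := F.start
  mealy := F.mealy
  act q a := ((match (F.act q a).1 with
    | .inl q' => .inl q'
    | .inr true => .inl F.start
    | .inr false => .inr ()), (F.act q a).2)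

section DoWhile

variable {F : Sweep A O S Bool} {x : List A} {bd : ℕ}

theorem round_doWhile (q : F.Q) (w : List S) (h : ℕ) :
    F.doWhile.round x q w h =
      ((F.round x q w h).1.elim .inl fun b => if b then .inl F.start else .inr (),
        (F.round x q w h).2) := by
  simp only [round, doWhile]
  rcases (F.act (mealyRun F.mealy q w).1 (inputCell x h)).1 with q' | _ | _ <;> rfl

theorem Exec.doWhile_exit {q : F.Q} {w w' : List S} {h h' : ℕ} {o : List O}
    (hF : F.Exec x bd q w h false w' h' o) : F.doWhile.Exec x bd q w h () w' h' o := by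
  generalize hb : false = b at hF
  induction hF with
  | exit hbd hround => subst hb; exact .exit hbd (by simp only [round_doWhile, hround]; rfl)
  | step hbd hround _ ih => exact .step hbd (by simp only [round_doWhile, hround]; rfl) (ih hb)

theorem Exec.doWhile_again {q : F.Q} {w w₁ w₂ : List S} {h h₁ h₂ : ℕ} {o₁ o₂ : List O}
    (hF : F.Exec x bd q w h true w₁ h₁ o₁) (hr : F.doWhile.Runs x bd w₁ h₁ () w₂ h₂ o₂) :
    F.doWhile.Exec x bd q w h () w₂ h₂ (o₁ ++ o₂) := by
  generalize hb : true = b at hF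
  induction hF with
  | exit hbd hround =>
    subst hb
    exact .step hbd (by simp only [round_doWhile, hround]; rfl) hr
  | step hbd hround _ ih =>
    rw [List.append_assoc]
    exact .step hbd (by simp only [round_doWhile, hround]; rfl) (ih hr hb)

theorem doWhile_runs {N : ℕ} (hN : 0 < N) (W : ℕ → List S) (H : ℕ → ℕ) (g : ℕ → List O)
    (hF : ∀ i < N, F.Runs x bd (W i) (H i) (decide (i + 1 < N)) (W (i + 1)) (H (i + 1)) (g i)) :
    F.doWhile.Runs x bd (W 0) (H 0) () (W N) (H N) ((List.range N).flatMap g) := by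
  obtain ⟨n, rfl⟩ := Nat.exists_eq_add_one.mpr hN
  suffices ∀ k ≤ n, F.doWhile.Runs x bd (W (n - k)) (H (n - k)) () (W (n + 1)) (H (n + 1))
      ((List.range' (n - k) (k + 1)).flatMap g) by
    simpa [List.range_eq_range'] using this n le_rfl
  intro k hk
  induction k with
  | zero =>
    have hlast := hF n (by omega)
    rw [decide_eq_false (by omega)] at hlast
    have hrun : F.doWhile.Runs x bd (W n) (H n) () (W (n + 1)) (H (n + 1)) (g n) :=
      hlast.doWhile_exit
    simpa using hrun
  | succ k ih =>
    have hagain := hF (n - (k + 1)) (by omega)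
    rw [decide_eq_true (by omega), show n - (k + 1) + 1 = n - k by omega] at hagain
    rw [List.range'_succ, List.flatMap_cons, show n - (k + 1) + 1 = n - k by omega]
    exact hagain.doWhile_again (ih (by omega))

end DoWhile

/-! ### Output -/

/-- The program that produces the output `l`. -/
def emit : List O → Sweep A O S Unit
  | [] => inspect fun _ => ((), .stay)
  | a :: l =>
    (pass () (fun q s => (q, s)) fun _ _ => ((), .stay, none, some a)).bind fun _ => emit l

theorem emit_runs (l : List O) {x : List A} {bd : ℕ} {w : List S} {h : ℕ}
    (hbd : w.length ≤ bd) (hh : h ≤ x.length + 1) : (emit l).Runs x bd w h () w h l := by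
  induction l with
  | nil => exact inspect_runs hbd rfl (min_eq_left hh)
  | cons a l ih =>
    have hpass := pass_runs (fin := fun _ _ => ((), .stay, none, some a)) (x := x) (h := h) hbd
      (mealyRun_of_fixed (fun _ => rfl) w : mealyRun (fun (q : Unit) s => (q, s)) () w = _) rfl
    rw [HeadMove.apply, min_eq_left hh, Option.toList_none, List.append_nil] at hpass
    exact bind_runs hpass ih

/-! ### Sweeping programs as transducers -/

/-- Control states of the transducer for a sweeping program. -/
inductive Ctl (Q : Type) : Type
  | init
  | halt
  | right (q : Q)
  | left (q : Q)
  deriving Fintype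

/-- The work tape that holds the word `w`: a marker followed by `w`. -/
def tapeOf (w : List S) : ℕ → Option (Option S)
  | 0 => some none
  | i + 1 => w[i]?.map some

theorem update_tapeOf_zero (w : List S) :
    Function.update (tapeOf w) 0 (some none) = tapeOf w :=
  Function.update_eq_self 0 (tapeOf w)

theorem update_blank_zero :
    Function.update (fun _ : ℕ => (none : Option (Option S))) 0 (some none) = tapeOf [] := by
  funext i
  rcases i with _ | i <;> simp [tapeOf]

theorem update_tapeOf_append_cons (u v : List S) (s s' : S) :
    Function.update (tapeOf (u ++ s :: v)) (u.length + 1) (some (some s')) =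
      tapeOf (u ++ s' :: v) := by
  funext i
  rcases i with _ | i
  · simp [tapeOf]
  · rcases lt_trichotomy i u.length with h | rfl | h
    · rw [Function.update_of_ne (by omega)]
      simp [tapeOf, List.getElem?_append_left h]
    · simp [tapeOf]
    · rw [Function.update_of_ne (by omega)]
      obtain ⟨d, rfl⟩ := Nat.exists_eq_add_of_lt h
      simp [tapeOf, List.getElem?_append_right h.le,
        show u.length + d + 1 - u.length = d + 1 by omega]

theorem update_tapeOf_length (w : List S) (ap : Option S) :
    Function.update (tapeOf w) (w.length + 1) (ap.map some) = tapeOf (w ++ ap.toList) := by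
  funext i
  rcases i with _ | i
  · simp [tapeOf]
  · rcases lt_trichotomy i w.length with h | rfl | h
    · rw [Function.update_of_ne (by omega)]
      simp [tapeOf, List.getElem?_append_left h]
    · cases ap <;> simp [tapeOf]
    · rw [Function.update_of_ne (by omega)]
      have hap : ap.toList.length ≤ i - w.length := by
        cases ap
        · simp
        · simp only [Option.toList_some, List.length_singleton]; omega
      simp [tapeOf, List.getElem?_append_right h.le, h.le, List.getElem?_eq_none hap]

section Transducer

variable [Fintype S]

/-- The transducer for a sweeping program: cell `0` of its work tape holds a marker, and the next
cells hold the word. -/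
def toTransducer (F : Sweep A O S E) : Transducer A O where
  tapes := 1
  Sym := Option (Option S)
  blank := none
  State := Ctl F.Q
  start := .init
  trans q a s := match q, s 0 with
    | .init, _ => some (.right F.start, .stay, fun _ => (some none, .right), none)
    | .halt, _ => none
    | .right q, some (some s) =>
        some (.right (F.mealy q s).1, .stay, fun _ => (some (some (F.mealy q s).2), .right), none)
    | .right q, none =>
        some ((F.act q a).1.elim .left fun _ => .halt, (F.act q a).2.1,
          fun _ => ((F.act q a).2.2.1.map some, .left), (F.act q a).2.2.2)
    | .right _, some none => none
    | .left q, some (some s) => some (.left q, .stay, fun _ => (some (some s), .left), none)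
    | .left q, some none => some (.right q, .stay, fun _ => (some none, .right), none)
    | .left _, none => none

/-- The configuration of the transducer with control state `q`, input head at `h`, work head at
`k`, word `w` and output `o`. -/
def cfgOf (F : Sweep A O S E) (q : Ctl F.Q) (h k : ℕ) (w : List S) (o : List O) :
    F.toTransducer.Cfg where
  state := q
  inHead := h
  head _ := k
  tape _ := tapeOf w
  out := o

/-- Steps of a transducer from configurations whose work heads are at most at `bd`. -/
def BoundedStep (T : Transducer A O) (x : List A) (bd : ℕ) (c c' : T.Cfg) : Prop :=
  T.step x c = some c' ∧ ∀ t, c.head t ≤ bd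

section Simulation

variable (F : Sweep A O S E) (x : List A) {bd h : ℕ}

theorem steps_mealyRun (o : List O) (hh : h ≤ x.length + 1) (u v : List S) (q : F.Q)
    (hbd : u.length + v.length ≤ bd) :
    Relation.ReflTransGen (BoundedStep F.toTransducer x (bd + 1))
      (F.cfgOf (.right q) h (u.length + 1) (u ++ v) o)
      (F.cfgOf (.right (mealyRun F.mealy q v).1) h (u.length + v.length + 1)
        (u ++ (mealyRun F.mealy q v).2) o) := by
  induction v generalizing u q with
  | nil => exact .refl
  | cons s v ih =>
    have hrest := ih (u ++ [(F.mealy q s).2]) (F.mealy q s).1 (by simp at hbd ⊢; omega)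
    simp only [List.append_assoc, List.singleton_append, List.length_append, List.length_cons,
      List.length_nil, Nat.zero_add] at hrest
    refine .head (b := F.cfgOf (.right (F.mealy q s).1) h (u.length + 1 + 1)
      (u ++ (F.mealy q s).2 :: v) o) ⟨?_, fun _ => by simp [cfgOf] at hbd ⊢; omega⟩ ?_
    · have hread : tapeOf (u ++ s :: v) (u.length + 1) = some (some s) := by simp [tapeOf]
      simp [Transducer.step, toTransducer, cfgOf, hread, HeadMove.apply, hh,
        update_tapeOf_append_cons]
    · simpa [mealyRun, Nat.add_assoc, Nat.add_comm 1] using hrest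

theorem steps_return (o : List O) (hh : h ≤ x.length + 1) (w : List S) (q : F.Q) {k : ℕ}
    (hk : k ≤ w.length) (hbd : k ≤ bd) :
    Relation.ReflTransGen (BoundedStep F.toTransducer x (bd + 1))
      (F.cfgOf (.left q) h k w o) (F.cfgOf (.right q) h 1 w o) := by
  induction k with
  | zero =>
    refine .single ⟨?_, fun _ => by simp [cfgOf]⟩
    have hread : tapeOf w 0 = some none := rfl
    simp [Transducer.step, toTransducer, cfgOf, hread, HeadMove.apply, hh, update_tapeOf_zero]
  | succ k ih =>
    refine .head (b := F.cfgOf (.left q) h k w o) ⟨?_, fun _ => by simp only [cfgOf]; omega⟩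
      (ih (by omega) (by omega))
    have hread : tapeOf w (k + 1) = some (some w[k]) := by simp [tapeOf, Nat.lt_of_succ_le hk]
    have hwrite : Function.update (tapeOf w) (k + 1) (some (some w[k])) = tapeOf w := by
      rw [← hread, Function.update_eq_self]
    simp [Transducer.step, toTransducer, cfgOf, hread, HeadMove.apply, hh, hwrite]

theorem steps_round {q : F.Q} {w w' : List S} {h' : ℕ} {r : F.Q ⊕ E} {os : List O}
    (hround : F.round x q w h = (r, w', h', os)) (o : List O) (hh : h ≤ x.length + 1)
    (hbd : w.length ≤ bd) :
    Relation.ReflTransGen (BoundedStep F.toTransducer x (bd + 1)) (F.cfgOf (.right q) h 1 w o)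
      (F.cfgOf (r.elim .left fun _ => .halt) h' w.length w' (o ++ os)) := by
  have hsweep := F.steps_mealyRun x o hh [] w q (bd := bd) (by simpa using hbd)
  refine hsweep.tail ⟨?_, fun _ => by simp [cfgOf]; omega⟩
  have hlen := length_mealyRun F.mealy q w
  have hread : tapeOf (mealyRun F.mealy q w).2 (w.length + 1) = none := by simp [tapeOf, hlen]
  have hwrite := update_tapeOf_length (mealyRun F.mealy q w).2
  rw [hlen] at hwrite
  simp only [round, Prod.mk.injEq] at hround
  obtain ⟨rfl, rfl, rfl, rfl⟩ := hround
  simp [Transducer.step, toTransducer, cfgOf, hread, HeadMove.apply, hwrite]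

theorem Exec.steps {F : Sweep A O S E} {x : List A} {q : F.Q} {w w' : List S} {h' : ℕ} {e : E}
    {os : List O} (hp : F.Exec x bd q w h e w' h' os) (o : List O) (hh : h ≤ x.length + 1) :
    ∃ k ≤ bd, Relation.ReflTransGen (BoundedStep F.toTransducer x (bd + 1))
      (F.cfgOf (.right q) h 1 w o) (F.cfgOf .halt h' k w' (o ++ os)) := by
  induction hp generalizing o with
  | exit hbd hround => exact ⟨_, hbd, F.steps_round x hround o hh hbd⟩
  | @step _ q₁ w w₁ _ h h₁ _ _ o₁ _ hbd hround _ ih =>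
    have hh₁ : h₁ ≤ x.length + 1 := by
      simp only [round, Prod.mk.injEq] at hround
      omega
    have hw₁ : w.length ≤ w₁.length := by
      simp only [round, Prod.mk.injEq] at hround
      simp [← hround.2.1, length_mealyRun]
    obtain ⟨k, hk, hrest⟩ := ih (o ++ o₁) hh₁
    rw [List.append_assoc] at hrest
    exact ⟨k, hk, (F.steps_round x hround o hh hbd).trans
      ((F.steps_return x _ hh₁ w₁ q₁ hw₁ hbd).trans hrest)⟩

end Simulation

end Transducer

theorem head_le_of_reaches {T : Transducer A O} {x : List A} {bd : ℕ} {c₀ c : T.Cfg}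
    (h : Relation.ReflTransGen (BoundedStep T x bd) c₀ c) (hc : T.step x c = none)
    (hb : ∀ t, c.head t ≤ bd) {d : T.Cfg} (hd : StateTransition.Reaches (T.step x) c₀ d)
    (t : Fin T.tapes) : d.head t ≤ bd := by
  induction h using Relation.ReflTransGen.head_induction_on with
  | refl =>
    rcases Relation.ReflTransGen.cases_head hd with rfl | ⟨c', hc', _⟩
    · exact hb t
    · rw [hc] at hc'; cases hc'
  | head hstep _ ih =>
    rcases Relation.ReflTransGen.cases_head hd with rfl | ⟨c', hc', hrest⟩
    · exact hstep.2 t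
    · rw [hstep.1] at hc'
      cases hc'
      exact ih hrest

theorem logspaceComputable [Finite S] (F : Sweep A O S E) {g : List A → List O} (C : ℕ)
    (hF : ∀ x, ∃ e w h, F.Runs x (C * (Nat.log 2 x.length + 1)) [] 0 e w h (g x)) :
    LogspaceComputable g := by
  have := Fintype.ofFinite S
  refine ⟨F.toTransducer, C + 2, fun x => ?_⟩
  obtain ⟨e, w, h, hrun⟩ := hF x
  obtain ⟨k, hk, hsteps⟩ := hrun.steps [] (by omega)
  have hinit : F.toTransducer.step x F.toTransducer.initial =
      some (F.cfgOf (.right F.start) 0 1 [] []) := by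
    simp [Transducer.step, Transducer.initial, toTransducer, cfgOf, HeadMove.apply,
      update_blank_zero]
  have hreach := hsteps.head ⟨hinit, fun _ => by simp [Transducer.initial]⟩
  have hhalt : F.toTransducer.step x (F.cfgOf .halt h k w ([] ++ g x)) = none := by
    simp [Transducer.step, toTransducer, cfgOf]
  refine ⟨fun d hd t => ?_, _, Relation.ReflTransGen.mono (fun _ _ h => h.1) _ _ hreach, hhalt,
    by simp [cfgOf]⟩
  have := head_le_of_reaches hreach hhalt (fun _ => by simp only [cfgOf]; omega) hd t
  rw [Nat.add_mul]
  omega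

end Sweep

/-! ## Counters -/

/-- The `L` lowest digits of `n` in base `B`, lowest digits first. -/
def digits (B : ℕ) [NeZero B] : ℕ → ℕ → List (Fin B)
  | 0, _ => []
  | L + 1, n => Fin.ofNat B n :: digits B L (n / B)

/-- Addition of a carry to a digit: the new carry and the new digit. -/
def carry {B : ℕ} [NeZero B] (c : Bool) (d : Fin B) : Bool × Fin B :=
  if c then (decide (d + 1 = 0), d + 1) else (false, d)

/-- A Mealy machine that acts on the first components of pairs. -/
def onFst {Q S S' : Type} (δ : Q → S → Q × S) (q : Q) (s : S × S') : Q × (S × S') :=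
  ((δ q s.1).1, ((δ q s.1).2, s.2))

/-- A Mealy machine that acts on the second components of pairs. -/
def onSnd {Q S S' : Type} (δ : Q → S' → Q × S') (q : Q) (s : S × S') : Q × (S × S') :=
  ((δ q s.2).1, (s.1, (δ q s.2).2))

theorem mealyRun_onFst_zip {Q S S' : Type} (δ : Q → S → Q × S) (q : Q) {u : List S}
    {v : List S'} (h : u.length = v.length) :
    mealyRun (onFst δ) q (u.zip v) = ((mealyRun δ q u).1, (mealyRun δ q u).2.zip v) := by
  induction u generalizing q v with
  | nil => rfl
  | cons s u ih =>
    obtain _ | ⟨s', v⟩ := v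
    · cases h
    · simp [mealyRun, onFst, ih _ (Nat.succ_injective h)]

theorem mealyRun_onSnd_zip {Q S S' : Type} (δ : Q → S' → Q × S') (q : Q) {u : List S}
    {v : List S'} (h : u.length = v.length) :
    mealyRun (onSnd δ) q (u.zip v) = ((mealyRun δ q v).1, u.zip (mealyRun δ q v).2) := by
  induction u generalizing q v with
  | nil => obtain rfl := List.length_eq_zero_iff.mp h.symm; rfl
  | cons s u ih =>
    obtain _ | ⟨s', v⟩ := v
    · cases h
    · simp [mealyRun, onSnd, ih _ (Nat.succ_injective h)]

/-- Comparison of two numbers, lowest digits first: whether the digits of the second components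
read so far, as a number, are less than those of the first components, or equal in case the
comparison started with `true`. -/
def ltStep {B : ℕ} (c : Bool) (s : Fin B × Fin B) : Bool × (Fin B × Fin B) :=
  (decide (s.2.val < s.1.val + c.toNat), s)

/-- The word that holds the values `j` and `i` of two counters with `L` digits in base `B`. -/
def counters (B : ℕ) [NeZero B] (L j i : ℕ) : List (Fin B × Fin B) :=
  (digits B L j).zip (digits B L i)

section Counters

variable (B : ℕ) [NeZero B]

theorem length_digits (L n : ℕ) : (digits B L n).length = L := by
  induction L generalizing n with
  | zero => rfl
  | succ L ih => simp [digits, ih]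

theorem length_counters (L j i : ℕ) : (counters B L j i).length = L := by
  simp [counters, length_digits]

theorem counters_zero (L : ℕ) : counters B L 0 0 = List.replicate L (0, 0) := by
  induction L with
  | zero => rfl
  | succ L ih => simpa [counters, digits, List.replicate_succ] using ih

theorem digits_pow (L : ℕ) : digits B L (B ^ L) = digits B L 0 := by
  induction L with
  | zero => rfl
  | succ L ih =>
    have hdiv : B ^ (L + 1) / B = B ^ L := by
      rw [pow_succ, Nat.mul_div_cancel _ (NeZero.pos B)]
    have hmod : Fin.ofNat B (B ^ (L + 1)) = Fin.ofNat B 0 := by ext; simp [pow_succ]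
    simp only [digits, hdiv, hmod, ih, Nat.zero_div]

variable {B}

theorem mealyRun_carry (c : Bool) {L n : ℕ} (hn : n < B ^ L) :
    mealyRun carry c (digits B L n) =
      (decide (n + c.toNat = B ^ L), digits B L (n + c.toNat)) := by
  induction L generalizing c n with
  | zero =>
    obtain rfl : n = 0 := by simpa using hn
    cases c <;> rfl
  | succ L ih =>
    have hdiv : n / B < B ^ L := by
      rwa [Nat.div_lt_iff_lt_mul (NeZero.pos B), ← pow_succ]
    cases c with
    | false => simp [digits, mealyRun, carry, ih _ hdiv, hn.ne, hdiv.ne]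
    | true =>
      have hdigit : Fin.ofNat B n + 1 = Fin.ofNat B (n + 1) := by ext; simp [Fin.val_add]
      have hzero : Fin.ofNat B (n + 1) = 0 ↔ B ∣ n + 1 := by
        simp [Fin.ext_iff, Nat.dvd_iff_mod_eq_zero]
      simp only [digits, mealyRun, carry, if_true, hdigit, hzero, ih _ hdiv, Bool.toNat_true]
      by_cases hB : B ∣ n + 1
      · have hpow : n / B + 1 = B ^ L ↔ n + 1 = B ^ (L + 1) := by
          rw [← Nat.succ_div_of_dvd hB, Nat.div_eq_iff_eq_mul_left (NeZero.pos B) hB, pow_succ]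
        simp [hB, hpow, Nat.succ_div_of_dvd]
      · have hpow : n + 1 ≠ B ^ (L + 1) := fun h => hB (h ▸ Dvd.intro_left _ (pow_succ B L).symm)
        simp [hB, hpow, hdiv.ne, Nat.succ_div_of_not_dvd]

theorem div_lt_div_add_iff {B : ℕ} (hB : 0 < B) {c : ℕ} (hc : c ≤ 1) {i j : ℕ} :
    i / B < j / B + (decide (i % B < j % B + c)).toNat ↔ i < j + c := by
  have hi := Nat.div_add_mod i B
  have hj := Nat.div_add_mod j B
  have him := Nat.mod_lt i hB
  have hjm := Nat.mod_lt j hB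
  have hcarry := Bool.toNat_le (decide (i % B < j % B + c))
  rcases lt_trichotomy (i / B) (j / B) with h | h | h
  · have := Nat.mul_le_mul_left B (Nat.succ_le_of_lt h)
    rw [Nat.mul_succ] at this
    omega
  · rw [h] at hi ⊢
    by_cases hlt : i % B < j % B + c
    · simp only [hlt, decide_true, Bool.toNat_true]; omega
    · simp only [hlt, decide_false, Bool.toNat_false]; omega
  · have := Nat.mul_le_mul_left B (Nat.succ_le_of_lt h)
    rw [Nat.mul_succ] at this
    omega

theorem mealyRun_ltStep (c : Bool) {L j i : ℕ} (hj : j < B ^ L) (hi : i < B ^ L) :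
    mealyRun ltStep c (counters B L j i) = (decide (i < j + c.toNat), counters B L j i) := by
  induction L generalizing c j i with
  | zero =>
    obtain rfl : j = 0 := by simpa using hj
    obtain rfl : i = 0 := by simpa using hi
    cases c <;> rfl
  | succ L ih =>
    have hB := NeZero.pos B
    rw [pow_succ, ← Nat.div_lt_iff_lt_mul hB] at hi hj
    have hlt : i / B < j / B + (decide (i % B < j % B + c.toNat)).toNat ↔ i < j + c.toNat := by
      exact div_lt_div_add_iff hB (Bool.toNat_le c)
    have hrest := ih (decide (i % B < j % B + c.toNat)) hj hi
    simp only [counters] at hrest ⊢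
    simp [digits, mealyRun, ltStep, hrest, hlt]

end Counters

namespace Sweep

variable {A O : Type} {B : ℕ} [NeZero B]

/-- Increment of the first counter; the value tells whether there was no overflow. -/
def incFst (B : ℕ) [NeZero B] (mv : HeadMove) : Sweep A O (Fin B × Fin B) Bool :=
  pass true (onFst carry) fun c _ => (!c, mv, none, none)

/-- Increment of the second counter; the value tells whether there was no overflow. -/
def incSnd (B : ℕ) [NeZero B] : Sweep A O (Fin B × Fin B) Bool :=
  pass true (onSnd carry) fun c _ => (!c, .stay, none, none)

/-- Whether the second counter is less than the first one. -/
def sndLtFst (B : ℕ) : Sweep A O (Fin B × Fin B) Bool :=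
  pass false ltStep fun c _ => (c, .stay, none, none)

theorem incFst_runs (mv : HeadMove) (x : List A) {L j i h : ℕ} (hj : j < B ^ L) :
    (incFst (O := O) B mv).Runs x L (counters B L j i) h (decide (j + 1 < B ^ L))
      (counters B L (j + 1) i) (min (mv.apply h) (x.length + 1)) [] := by
  have hw : mealyRun (onFst carry) true (counters B L j i) =
      (decide (j + 1 = B ^ L), counters B L (j + 1) i) := by
    rw [counters, mealyRun_onFst_zip _ _ (by simp [length_digits]), mealyRun_carry _ hj]; rfl
  have hlt : (!decide (j + 1 = B ^ L)) = decide (j + 1 < B ^ L) := by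
    rw [← decide_not, decide_eq_decide]; omega
  simpa [hlt, incFst] using pass_runs (fin := fun c _ => (!c, mv, none, none)) (x := x)
    (h := h) (length_counters ..).le hw rfl

theorem incSnd_runs (x : List A) {L j i h : ℕ} (hi : i < B ^ L) (hh : h ≤ x.length + 1) :
    (incSnd (O := O) B).Runs x L (counters B L j i) h (decide (i + 1 < B ^ L))
      (counters B L j (i + 1)) h [] := by
  have hw : mealyRun (onSnd carry) true (counters B L j i) =
      (decide (i + 1 = B ^ L), counters B L j (i + 1)) := by
    rw [counters, mealyRun_onSnd_zip _ _ (by simp [length_digits]), mealyRun_carry _ hi]; rfl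
  have hlt : (!decide (i + 1 = B ^ L)) = decide (i + 1 < B ^ L) := by
    rw [← decide_not, decide_eq_decide]; omega
  simpa [hlt, incSnd, HeadMove.apply, hh] using
    pass_runs (fin := fun c _ => (!c, .stay, none, none)) (x := x) (h := h)
      (length_counters ..).le hw rfl

theorem sndLtFst_runs (x : List A) {L j i h : ℕ} (hj : j < B ^ L) (hi : i < B ^ L)
    (hh : h ≤ x.length + 1) :
    (sndLtFst (O := O) B).Runs x L (counters B L j i) h (decide (i < j)) (counters B L j i) h
      [] := by
  simpa [sndLtFst, HeadMove.apply, hh] using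
    pass_runs (fin := fun c _ => (c, .stay, none, none)) (x := x) (h := h)
      (length_counters ..).le (mealyRun_ltStep false hj hi) rfl

/-- Repetition of `F` until the first counter overflows; the input head is moved after each
repetition. -/
def loopFst (mv : HeadMove) (F : Sweep A O (Fin B × Fin B) Unit) :
    Sweep A O (Fin B × Fin B) Unit :=
  (F.bind fun _ => incFst B mv).doWhile

/-- Repetition of `F` until the second counter overflows. -/
def loopSnd (F : Sweep A O (Fin B × Fin B) Unit) : Sweep A O (Fin B × Fin B) Unit :=
  (F.bind fun _ => incSnd B).doWhile

theorem loopFst_runs {F : Sweep A O (Fin B × Fin B) Unit} {x : List A} {L i : ℕ} {mv : HeadMove}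
    (H : ℕ → ℕ) (hH : ∀ j, min (mv.apply (H j)) (x.length + 1) = H (j + 1)) {g : ℕ → List O}
    (hF : ∀ j < B ^ L, F.Runs x L (counters B L j i) (H j) () (counters B L j i) (H j) (g j)) :
    (loopFst mv F).Runs x L (counters B L 0 i) (H 0) () (counters B L 0 i) (H (B ^ L))
      ((List.range (B ^ L)).flatMap g) := by
  have hwrap : counters B L (B ^ L) i = counters B L 0 i := by simp only [counters, digits_pow]
  rw [← hwrap]
  nth_rewrite 1 [hwrap]
  refine doWhile_runs (Nat.pow_pos (NeZero.pos B)) (fun j => counters B L j i) H g fun j hj => ?_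
  simpa [hH] using bind_runs (G := fun _ => incFst B mv) (hF j hj) (incFst_runs mv x hj)

theorem loopSnd_runs {F : Sweep A O (Fin B × Fin B) Unit} {x : List A} {L j h : ℕ}
    (hh : h ≤ x.length + 1) {g : ℕ → List O}
    (hF : ∀ i < B ^ L, F.Runs x L (counters B L j i) h () (counters B L j i) h (g i)) :
    (loopSnd F).Runs x L (counters B L j 0) h () (counters B L j 0) h
      ((List.range (B ^ L)).flatMap g) := by
  have hwrap : counters B L j (B ^ L) = counters B L j 0 := by simp only [counters, digits_pow]
  rw [← hwrap]
  nth_rewrite 1 [hwrap]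
  refine doWhile_runs (Nat.pow_pos (NeZero.pos B)) (counters B L j) (fun _ => h) g fun i hi => ?_
  simpa using bind_runs (G := fun _ => incSnd B) (hF i hi) (incSnd_runs x hi hh)

end Sweep

/-! ## Generable output -/

/-- The output `g N j` can be generated by a sweeping program when `N` is the range of the counters
and `j` the value of the first counter. -/
def Generable (A : Type) {O : Type} (B : ℕ) [NeZero B] (g : ℕ → ℕ → List O) : Prop :=
  ∃ F : Sweep A O (Fin B × Fin B) Unit, ∀ (x : List A) (L j h : ℕ), j < B ^ L →
    h ≤ x.length + 1 → F.Runs x L (counters B L j 0) h () (counters B L j 0) h (g (B ^ L) j)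

/-- The output `g x N` can be generated by a sweeping program on the input `x` when `N` is the range
of the counters. -/
def GenerableFrom {A O : Type} (B : ℕ) [NeZero B] (g : List A → ℕ → List O) : Prop :=
  ∃ F : Sweep A O (Fin B × Fin B) Unit, ∀ (x : List A) (L : ℕ), ∃ h ≤ x.length + 1,
    F.Runs x L (counters B L 0 0) 0 () (counters B L 0 0) h (g x (B ^ L))

section Generable

open Sweep

variable {A O : Type} {B : ℕ} [NeZero B]

theorem Generable.const (l : List O) : Generable A B fun _ _ => l :=
  ⟨emit l, fun _ _ _ _ _ hh => emit_runs l (length_counters ..).le hh⟩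

theorem Generable.append {g g' : ℕ → ℕ → List O} (hg : Generable A B g)
    (hg' : Generable A B g') : Generable A B fun N j => g N j ++ g' N j := by
  obtain ⟨F, hF⟩ := hg
  obtain ⟨G, hG⟩ := hg'
  exact ⟨F.bind fun _ => G, fun x L j h hj hh => bind_runs (hF x L j h hj hh) (hG x L j h hj hh)⟩

theorem Generable.cons {g : ℕ → ℕ → List O} (o : O) (hg : Generable A B g) :
    Generable A B fun N j => o :: g N j :=
  (Generable.const [o]).append hg

theorem Generable.congr {g g' : ℕ → ℕ → List O} (hg : Generable A B g)
    (h : ∀ N, ∀ j < N, g N j = g' N j) : Generable A B g' := by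
  obtain ⟨F, hF⟩ := hg
  exact ⟨F, fun x L j k hj hk => h _ j hj ▸ hF x L j k hj hk⟩

theorem Generable.flatMap {X : Type} {g : X → ℕ → ℕ → List O} (l : List X)
    (hg : ∀ a ∈ l, Generable A B (g a)) : Generable A B fun N j => l.flatMap fun a => g a N j := by
  induction l with
  | nil => exact Generable.const []
  | cons a l ih =>
    exact (hg a List.mem_cons_self).append (ih fun a ha => hg a (List.mem_cons_of_mem _ ha))

theorem flatMap_range_const (N : ℕ) (l : List O) :
    ((List.range N).flatMap fun _ => l) = (List.replicate N l).flatten := by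
  rw [List.flatMap, List.map_const', List.length_range]

theorem flatMap_range_ite_lt {N j : ℕ} (hj : j ≤ N) (l : List O) :
    ((List.range N).flatMap fun i => if i < j then l else []) = (List.replicate j l).flatten := by
  induction N, hj using Nat.le_induction with
  | base =>
    rw [← flatMap_range_const]
    exact List.flatMap_congr fun i hi => if_pos (List.mem_range.mp hi)
  | succ N hj ih =>
    rw [List.range_succ, List.flatMap_append, ih]
    simp [hj.not_gt]

theorem Generable.replicate_range (l : List O) :
    Generable A B fun N _ => (List.replicate N l).flatten := by
  refine ⟨loopSnd (emit l), fun x L j h _ hh => ?_⟩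
  simpa only [flatMap_range_const] using
    loopSnd_runs hh fun i _ => emit_runs l (length_counters B L j i).le hh

theorem Generable.replicate_counter (l : List O) :
    Generable A B fun _ j => (List.replicate j l).flatten := by
  refine ⟨loopSnd ((sndLtFst B).bind fun c => emit (if c then l else [])),
    fun x L j h hj hh => ?_⟩
  simp only [← flatMap_range_ite_lt hj.le]
  refine loopSnd_runs hh fun i hi => ?_
  have hemit := emit_runs (if decide (i < j) then l else []) (length_counters B L j i).le hh
  simpa using bind_runs (G := fun c => emit (if c then l else [])) (sndLtFst_runs x hj hi hh) hemit

theorem GenerableFrom.append_generable {g : List A → ℕ → List O} {g' : ℕ → ℕ → List O}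
    (hg : GenerableFrom B g) (hg' : Generable A B g') :
    GenerableFrom B fun x N => g x N ++ g' N 0 := by
  obtain ⟨F, hF⟩ := hg
  obtain ⟨G, hG⟩ := hg'
  refine ⟨F.bind fun _ => G, fun x L => ?_⟩
  obtain ⟨h, hh, hrun⟩ := hF x L
  exact ⟨h, hh, bind_runs hrun (hG x L 0 h (Nat.pow_pos (NeZero.pos B)) hh)⟩

theorem GenerableFrom.generable_append {g : List A → ℕ → List O} {g' : ℕ → ℕ → List O}
    (hg' : Generable A B g') (hg : GenerableFrom B g) :
    GenerableFrom B fun x N => g' N 0 ++ g x N := by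
  obtain ⟨F, hF⟩ := hg
  obtain ⟨G, hG⟩ := hg'
  refine ⟨G.bind fun _ => F, fun x L => ?_⟩
  obtain ⟨h, hh, hrun⟩ := hF x L
  exact ⟨h, hh, bind_runs (hG x L 0 0 (Nat.pow_pos (NeZero.pos B)) (Nat.zero_le _)) hrun⟩

theorem GenerableFrom.append_range {g : List A → ℕ → List O} {g' : ℕ → ℕ → List O}
    (hg : GenerableFrom B g) (hg' : Generable A B g') :
    GenerableFrom B fun x N => g x N ++ (List.range N).flatMap (g' N) := by
  obtain ⟨F, hF⟩ := hg
  obtain ⟨G, hG⟩ := hg'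
  refine ⟨F.bind fun _ => loopFst .stay G, fun x L => ?_⟩
  obtain ⟨h, hh, hrun⟩ := hF x L
  refine ⟨h, hh, bind_runs hrun ?_⟩
  exact loopFst_runs (fun _ => h) (by simp [HeadMove.apply, hh]) fun j hj => hG x L j h hj hh

theorem GenerableFrom.range_append {g : List A → ℕ → List O} {g' : ℕ → ℕ → List O}
    (hg' : Generable A B g') (hg : GenerableFrom B g) :
    GenerableFrom B fun x N => (List.range N).flatMap (g' N) ++ g x N := by
  obtain ⟨F, hF⟩ := hg
  obtain ⟨G, hG⟩ := hg'
  refine ⟨(loopFst .stay G).bind fun _ => F, fun x L => ?_⟩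
  obtain ⟨h, hh, hrun⟩ := hF x L
  exact ⟨h, hh, bind_runs (loopFst_runs (fun _ => 0) (by simp [HeadMove.apply]) fun j hj =>
    hG x L j 0 hj (Nat.zero_le _)) hrun⟩

/-- The symbol of an input cell. -/
def InCell.toOption : InCell A → Option A
  | .sym a => some a
  | _ => none

theorem toOption_inputCell (x : List A) (j : ℕ) :
    (inputCell x (min (j + 1) (x.length + 1))).toOption = x[j]? := by
  rw [Nat.add_min_add_right]
  rcases lt_or_ge j x.length with h | h
  · simp [inputCell, min_eq_left h.le, h, InCell.toOption]
  · simp [inputCell, h, InCell.toOption]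

theorem GenerableFrom.input_range [Finite A] {g : Option A → ℕ → ℕ → List O}
    (hg : ∀ o, Generable A B (g o)) :
    GenerableFrom (A := A) B fun x N => (List.range N).flatMap fun j => g x[j]? N j := by
  have := Fintype.ofFinite A
  choose F hF using hg
  let enter : InCell A → Unit × HeadMove := fun _ => ((), .right)
  let read : InCell A → Option A × HeadMove := fun a => (a.toOption, .stay)
  refine ⟨(inspect enter).bind fun _ => loopFst .right ((inspect read).bind F), fun x L =>
    ⟨min (B ^ L + 1) (x.length + 1), min_le_right _ _, ?_⟩⟩
  have henter : (inspect (O := O) enter).Runs x L (counters B L 0 0) 0 () (counters B L 0 0)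
      (min (0 + 1) (x.length + 1)) [] :=
    inspect_runs (length_counters ..).le rfl rfl
  have hread (j : ℕ) : (inspect (O := O) read).Runs x L (counters B L j 0)
      (min (j + 1) (x.length + 1)) x[j]? (counters B L j 0) (min (j + 1) (x.length + 1)) [] :=
    inspect_runs (length_counters ..).le (toOption_inputCell x j) (min_eq_left (min_le_right _ _))
  refine bind_runs henter (loopFst_runs (fun j => min (j + 1) (x.length + 1))
    (fun j => by simp only [HeadMove.apply]; omega) fun j hj => ?_)
  exact bind_runs (hread j) (hF _ x L j _ hj (min_le_right _ _))

/-! ### Initialization of the counters -/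

/-- The increment of a binary number written with the digits `0` and `1` of base `B`. -/
def bitCarry (c : Bool) (d : Fin B) : Bool × Fin B :=
  if c then (if d = 0 then (false, 1) else (true, 0)) else (false, d)

/-- The binary representation of `n`, lowest bits first, as a word of pairs of digits. -/
def bitWord (B : ℕ) [NeZero B] (n : ℕ) : List (Fin B × Fin B) :=
  n.bits.map fun c => (if c then 1 else 0, 0)

theorem length_bitWord (n : ℕ) : (bitWord B n).length = n.size := by
  simp [bitWord, Nat.size_eq_bits_len]

theorem mealyRun_bitCarry (hB : 1 < B) (n : ℕ) :
    (mealyRun (onFst bitCarry) true (bitWord B n)).2 ++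
      (if (mealyRun (onFst bitCarry) true (bitWord B n)).1 then some (1, 0) else none).toList =
        bitWord B (n + 1) := by
  have hone : (1 : Fin B) ≠ 0 := by simp [Fin.ext_iff, Nat.mod_eq_of_lt hB]
  induction n using Nat.binaryRec' with
  | zero => simp [bitWord, mealyRun]
  | bit c n hc ih =>
    cases c with
    | false =>
      have hn : n ≠ 0 := fun h => by simpa using hc h
      have hfalse : mealyRun (onFst bitCarry) false (bitWord B n) = (false, bitWord B n) :=
        mealyRun_of_fixed (δ := onFst bitCarry) (fun _ => rfl) _
      have hcons (c : Bool) : bitWord B (n.bit c) = (if c then 1 else 0, 0) :: bitWord B n := by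
        simp only [bitWord, Nat.bits_append_bit n c fun h => absurd h hn, List.map_cons]
      change _ = bitWord B (n.bit true)
      rw [hcons, hcons]
      simp [mealyRun, onFst, bitCarry, hfalse]
    | true =>
      have hbit : bitWord B (n.bit true) = (1, 0) :: bitWord B n := by
        simp [bitWord]
      have hsucc : bitWord B (n.bit true + 1) = (0, 0) :: bitWord B (n + 1) := by
        rw [show n.bit true + 1 = (n + 1).bit false by simp [Nat.bit_val]; ring]
        simp only [bitWord, Nat.bits_append_bit (n + 1) false (fun h => absurd h n.succ_ne_zero)]
        rfl
      rw [hbit, hsucc, ← ih]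
      simp [mealyRun, onFst, bitCarry, hone]

/-- The body of the loop of `countInput`. -/
def countStep (A O : Type) (B : ℕ) [NeZero B] : Sweep A O (Fin B × Fin B) Bool :=
  (inspect fun a => (a.toOption.isSome, .stay)).bind fun c =>
    if c then
      pass true (onFst bitCarry) fun c _ => (true, .right, if c then some (1, 0) else none, none)
    else inspect fun _ => (false, .stay)

/-- The program that counts the input symbols in binary. -/
def countInput (A O : Type) (B : ℕ) [NeZero B] : Sweep A O (Fin B × Fin B) Unit :=
  (inspect fun _ => ((), .right)).bind fun _ => (countStep A O B).doWhile

theorem countStep_runs (hB : 1 < B) (x : List A) {i : ℕ} (hi : i < x.length + 1) :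
    (countStep A O B).Runs x (x.length.size + 1) (bitWord B (min i x.length))
      (min (i + 1) (x.length + 1)) (decide (i + 1 < x.length + 1))
      (bitWord B (min (i + 1) x.length)) (min (i + 1 + 1) (x.length + 1)) [] := by
  have hlen : (bitWord B (min i x.length)).length ≤ x.length.size + 1 := by
    rw [length_bitWord]
    exact (Nat.size_le_size (min_le_right _ _)).trans (Nat.le_succ _)
  have hread : (inspect (O := O) fun a => (a.toOption.isSome, .stay)).Runs x
      (x.length.size + 1) (bitWord B (min i x.length)) (min (i + 1) (x.length + 1))
      (decide (i < x.length)) (bitWord B (min i x.length)) (min (i + 1) (x.length + 1)) [] := by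
    refine inspect_runs hlen ?_ (min_eq_left (min_le_right _ _))
    simpa only [toOption_inputCell] using Bool.eq_iff_iff.mpr (by simp)
  refine bind_runs hread ?_
  rcases (Nat.lt_succ_iff.mp hi).lt_or_eq with hlt | rfl
  · have hpass := pass_runs (start := true) (mealy := onFst (bitCarry (B := B)))
      (fin := fun c (_ : InCell A) => (true, HeadMove.right, if c then some (1, 0) else none,
        (none : Option O))) (x := x) (h := min (i + 1) (x.length + 1)) hlen rfl rfl
    rw [min_eq_left hlt.le, mealyRun_bitCarry hB] at hpass
    simpa [hlt, hlt.le, Nat.succ_le_of_lt hlt, HeadMove.apply] using hpass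
  · simpa [HeadMove.apply] using inspect_runs (fin := fun _ => (false, .stay)) (O := O) (x := x)
      hlen rfl (min_eq_left (min_le_right (x.length + 1) _))

theorem countInput_runs (hB : 1 < B) (x : List A) :
    (countInput A O B).Runs x (x.length.size + 1) [] 0 () (bitWord B x.length) (x.length + 1)
      [] := by
  have henter : (inspect (O := O) fun _ => ((), .right)).Runs x (x.length.size + 1)
      (bitWord B (min 0 x.length)) 0 () (bitWord B (min 0 x.length)) (min (0 + 1) (x.length + 1))
      [] :=
    inspect_runs (by simp [bitWord]) rfl rfl
  have hloop := doWhile_runs (Nat.succ_pos x.length) (fun i => bitWord B (min i x.length))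
    (fun i => min (i + 1) (x.length + 1)) (fun _ => [])
    fun i hi => countStep_runs (O := O) hB x hi
  simpa [countInput, bitWord, List.flatMap_eq_nil_iff.mpr] using
    bind_runs (G := fun _ => _) henter hloop

/-- The program that moves the input head to the left end. -/
def rewind (A O S : Type) : Sweep A O S Unit :=
  doWhile <| inspect fun a => match a with
    | .leftEnd => (false, .stay)
    | _ => (true, .left)

theorem rewind_runs {S : Type} (x : List A) {bd h : ℕ} (hh : h ≤ x.length + 1) {w : List S}
    (hw : w.length ≤ bd) : (rewind A O S).Runs x bd w h () w 0 [] := by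
  have hloop := doWhile_runs (F := inspect fun a : InCell A => match a with
      | .leftEnd => (false, .stay)
      | _ => (true, .left)) (O := O) (x := x) (bd := bd) (Nat.succ_pos h) (fun _ => w)
    (fun i => h - i) (fun _ => []) fun i hi => ?_
  · simpa [rewind, List.flatMap_eq_nil_iff.mpr] using hloop
  · obtain ⟨d, rfl⟩ := Nat.exists_eq_add_of_le (Nat.lt_succ_iff.mp hi)
    rw [Nat.add_sub_cancel_left, Nat.add_sub_add_left]
    cases d with
    | zero => exact inspect_runs hw (by simp [inputCell]) (by simp [inputCell, HeadMove.apply])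
    | succ d =>
      have hd : min d (x.length + 1) = d := min_eq_left (by omega)
      cases hx : x[d]? <;> exact inspect_runs hw (by simp [inputCell, hx])
        (by simp [inputCell, hx, HeadMove.apply, hd])

/-- The program that overwrites the word by zeros and extends it by one pair of digits. -/
def clearWord (A O : Type) (B : ℕ) [NeZero B] : Sweep A O (Fin B × Fin B) Unit :=
  pass () (fun q _ => (q, (0, 0))) fun _ _ => ((), .stay, some (0, 0), none)

theorem clearWord_runs (x : List A) {bd : ℕ} {w : List (Fin B × Fin B)} (hw : w.length ≤ bd) :
    (clearWord A O B).Runs x bd w 0 () (counters B (w.length + 1) 0 0) 0 [] := by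
  have hzero (w : List (Fin B × Fin B)) :
      mealyRun (fun (q : Unit) _ => (q, (0, 0))) () w =
        ((), List.replicate w.length ((0 : Fin B), (0 : Fin B))) := by
    induction w with
    | nil => rfl
    | cons s w ih => simp [mealyRun, ih, List.replicate_succ]
  rw [counters_zero, List.replicate_succ']
  have hpass := pass_runs (fin := fun _ _ => ((), .stay, some (0, 0), (none : Option O)))
    (x := x) (h := 0) hw (hzero w) rfl
  simpa [clearWord, HeadMove.apply] using hpass

/-- The range of the counters in base `B` for inputs of length `n`. -/
def counterRange (B n : ℕ) : ℕ := B ^ (n.size + 1)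

theorem GenerableFrom.logspaceComputable (hB : 1 < B) {g : List A → ℕ → List O}
    (hg : GenerableFrom B g) :
    LogspaceComputable fun x => g x (counterRange B x.length) := by
  obtain ⟨F, hF⟩ := hg
  refine Sweep.logspaceComputable ((countInput A O B).bind fun _ => (rewind A O _).bind
    fun _ => (clearWord A O B).bind fun _ => F) 2 fun x => ?_
  obtain ⟨h, -, hrun⟩ := hF x (x.length.size + 1)
  have hlen : (bitWord B x.length).length ≤ x.length.size + 1 :=
    (length_bitWord _).le.trans (Nat.le_succ _)
  have hclear := clearWord_runs (O := O) x hlen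
  rw [length_bitWord] at hclear
  have hall := bind_runs (G := fun _ => _) (countInput_runs hB x)
    (bind_runs (G := fun _ => _) (rewind_runs x le_rfl hlen)
      (bind_runs (G := fun _ => F) hclear hrun))
  have hsize : x.length.size ≤ Nat.log 2 x.length + 1 :=
    Nat.size_le.mpr (Nat.lt_pow_succ_log_self Nat.one_lt_two _)
  exact ⟨(), _, h, hall.mono (by omega)⟩

end Generable

/-! ## Cellular automata for Turing machines -/

/-- A one-dimensional cellular automaton with a set of forbidden cell contents. The cells are
numbered from `0`; outside of them, `first` appears on the left and `blank` on the right. -/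
structure CellRule (A : Type) where
  Γ : Type
  [fintype : Fintype Γ]
  first : Γ
  blank : Γ
  inp : A → Γ
  next : Γ → Γ → Γ → Γ
  bad : Γ → Prop

attribute [instance] CellRule.fintype

namespace CellRule

variable {A : Type}

/-- The contents of a cell for an optional input symbol, where `none` stands for the part of the
tape after the input. -/
def inpAt (R : CellRule A) (o : Option A) : R.Γ := (o.map R.inp).getD R.blank

/-- The initial contents of the cells for the input `x`. -/
def initial (R : CellRule A) (x : List A) : ℕ → R.Γ
  | 0 => R.first
  | k + 1 => R.inpAt x[k]?

/-- `row` is the space-time diagram of a computation on `K` cells that avoids forbidden contents. -/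
def IsRun (R : CellRule A) (x : List A) (K : ℕ) (row : ℕ → ℕ → R.Γ) : Prop :=
  (∀ k < K, row 0 k = R.initial x k) ∧ ∀ t, ∀ k < K, ¬R.bad (row t k) ∧
    row (t + 1) k = R.next (if k = 0 then R.first else row t (k - 1)) (row t k)
      (if k + 1 = K then R.blank else row t (k + 1))

end CellRule

namespace TuringDecider

variable {A : Type} (M : TuringDecider A)

attribute [local instance] TuringDecider.symFintype TuringDecider.stateFintype

/-- Cell contents: a tape symbol, with the state if the head is there; `inl true` is the left end
before the start of the computation, and `inl false` later. -/
abbrev CellSym : Type := Bool ⊕ (M.Sym × Option M.State)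

/-- The state with which the head leaves a cell in the direction `d`. The computation starts with a
move of the head from the left end to the right. -/
def leaving (d : Turing.Dir) : M.CellSym → Option M.State
  | .inl true => if d = .right then some M.start else none
  | .inr (s, some q) => (M.trans q s).bind fun r => if r.2.2 = d then some r.1 else none
  | _ => none

/-- The contents of a cell after a step, given the contents of the cell and its neighbours. -/
def cellNext (l c r : M.CellSym) : M.CellSym :=
  match c with
  | .inl _ => .inl false
  | .inr (s, none) => .inr (s, (M.leaving .right l).or (M.leaving .left r))
  | .inr (s, some q) => match M.trans q s with
    | none => .inr (s, some q)
    | some (q', s', d) => .inr (s', if d = .left ∧ l.isLeft then some q' else none)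

/-- The cellular automaton that simulates `M`; rejecting halting configurations are forbidden. -/
def cellRule : CellRule A where
  Γ := M.CellSym
  first := .inl true
  blank := .inr (M.blank, none)
  inp a := .inr (M.inSym a, none)
  next := M.cellNext
  bad c := ∃ s q, c = .inr (s, some q) ∧ M.trans q s = none ∧ q ∉ M.accept

/-- One computation step, where halting configurations are repeated. -/
def stepOrStay (c : M.Cfg) : M.Cfg := (M.step c).getD c

/-- The configuration after `t` steps. -/
def run (x : List A) (t : ℕ) : M.Cfg := M.stepOrStay^[t] (M.initial x)

theorem run_succ (x : List A) (t : ℕ) : M.run x (t + 1) = M.stepOrStay (M.run x t) :=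
  Function.iterate_succ_apply' _ _ _

theorem reaches_run (x : List A) (t : ℕ) :
    StateTransition.Reaches M.step (M.initial x) (M.run x t) := by
  induction t with
  | zero => exact .refl
  | succ t ih =>
    rw [run_succ, stepOrStay]
    cases h : M.step (M.run x t) with
    | none => exact ih
    | some c => exact ih.tail h

theorem exists_run_eq {x : List A} {c : M.Cfg}
    (h : StateTransition.Reaches M.step (M.initial x) c) : ∃ t, M.run x t = c := by
  induction h with
  | refl => exact ⟨0, rfl⟩
  | tail _ h ih =>
    obtain ⟨t, rfl⟩ := ih
    exact ⟨t + 1, by rw [run_succ, stepOrStay, Option.mem_def.mp h, Option.getD_some]⟩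

theorem run_add_of_halt {x : List A} {t : ℕ} (h : M.step (M.run x t) = none) (d : ℕ) :
    M.run x (t + d) = M.run x t := by
  induction d with
  | zero => rfl
  | succ d ih => rw [← Nat.add_assoc, run_succ, ih, stepOrStay, h, Option.getD_none]

theorem run_eq_of_halt {x : List A} {t t' : ℕ} (h : M.step (M.run x t) = none)
    (h' : M.step (M.run x t') = none) : M.run x t = M.run x t' := by
  rw [← M.run_add_of_halt h t', ← M.run_add_of_halt h' t, Nat.add_comm]

theorem step_eq_none {c : M.Cfg} : M.step c = none ↔ M.trans c.state (c.tape c.head) = none := by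
  simp [step]

/-! ### The space-time diagram -/

/-- The cell contents for a configuration. -/
def cfgRow (c : M.Cfg) : ℕ → M.CellSym
  | 0 => .inl false
  | k + 1 => .inr (c.tape k, if k = c.head then some c.state else none)

/-- The space-time diagram of the computation on `x`. -/
def diagram (x : List A) : ℕ → ℕ → M.CellSym
  | 0, k => M.cellRule.initial x k
  | t + 1, k => M.cfgRow (M.run x t) k

theorem leaving_cfgRow (d : Turing.Dir) (c : M.Cfg) (k : ℕ) :
    M.leaving d (M.cfgRow c k) = if k = c.head + 1 then
      (M.trans c.state (c.tape c.head)).bind fun r => if r.2.2 = d then some r.1 else none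
    else none := by
  rcases k with _ | k
  · rfl
  · by_cases h : k = c.head
    · subst h; simp [leaving, cfgRow]
    · simp [leaving, cfgRow, h]

theorem cfgRow_stepOrStay (c : M.Cfg) (k : ℕ) :
    M.cfgRow (M.stepOrStay c) (k + 1) =
      M.cellNext (M.cfgRow c k) (M.cfgRow c (k + 1)) (M.cfgRow c (k + 2)) := by
  obtain ⟨p, h, tape⟩ := c
  by_cases hk : k = h
  · subst hk
    rcases ht : M.trans p (tape k) with _ | ⟨q, s, d⟩
    · simp [stepOrStay, step, ht, cfgRow, cellNext]
    · rcases k with _ | k <;> cases d <;>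
        simp [stepOrStay, step, ht, cfgRow, cellNext, moveHead]
  · have hcell : M.cfgRow ⟨p, h, tape⟩ (k + 1) = .inr (tape k, none) := by simp [cfgRow, hk]
    rw [hcell, cellNext, leaving_cfgRow, leaving_cfgRow]
    rcases ht : M.trans p (tape h) with _ | ⟨q, s, d⟩
    · simp [stepOrStay, step, ht, cfgRow, hk]
    · have harrive : k + 2 = h + 1 ↔ k = h - 1 := by omega
      cases d <;> simp [stepOrStay, step, ht, cfgRow, moveHead, Function.update_of_ne hk, harrive]

theorem diagram_succ (x : List A) (t k : ℕ) :
    M.diagram x (t + 1) k =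
      M.cellNext (if k = 0 then .inl true else M.diagram x t (k - 1)) (M.diagram x t k)
        (M.diagram x t (k + 1)) := by
  rcases k with _ | k
  · cases t <;> rfl
  rcases t with _ | t
  · have hcell (i : ℕ) : M.diagram x 0 (i + 1) = .inr ((M.initial x).tape i, none) := by
      simp only [diagram, CellRule.initial, CellRule.inpAt, cellRule, initial]
      cases x[i]? <;> rfl
    rw [hcell, hcell]
    rcases k with _ | k
    · rfl
    · rw [if_neg k.succ.succ_ne_zero, Nat.add_sub_cancel, hcell]
      rfl
  · rw [diagram, run_succ]
    exact M.cfgRow_stepOrStay _ _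

section Space

variable {M} {x : List A} {K : ℕ}
  (hhead : ∀ c, StateTransition.Reaches M.step (M.initial x) c → c.head + 1 < K)

include hhead

theorem tape_run (t : ℕ) {i : ℕ} (hi : K ≤ i + 1) :
    (M.run x t).tape i = (M.initial x).tape i := by
  induction t with
  | zero => rfl
  | succ t ih =>
    have hne : i ≠ (M.run x t).head := by
      have := hhead _ (M.reaches_run x t)
      omega
    rw [run_succ, ← ih, stepOrStay, step]
    cases M.trans (M.run x t).state ((M.run x t).tape (M.run x t).head) with
    | none => rfl
    | some r => exact Function.update_of_ne hne _ _

theorem diagram_eq_blank (hx : x.length < K) (t : ℕ) :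
    M.diagram x t K = .inr (M.blank, none) := by
  obtain ⟨k, rfl⟩ := Nat.exists_eq_add_one.mpr (Nat.zero_lt_of_lt hx)
  have hk : x[k]? = none := List.getElem?_eq_none (Nat.lt_succ_iff.mp hx)
  rcases t with _ | t
  · simp [diagram, CellRule.initial, CellRule.inpAt, cellRule, hk]
  · have hne : k ≠ (M.run x t).head := by
      have := hhead _ (M.reaches_run x t)
      omega
    simp [diagram, cfgRow, hne, tape_run hhead t le_rfl, initial, hk]

theorem eq_diagram_of_isRun (hx : x.length < K) {row : ℕ → ℕ → M.CellSym}
    (hrow : M.cellRule.IsRun x K row) (t : ℕ) : ∀ k < K, row t k = M.diagram x t k := by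
  induction t with
  | zero => exact hrow.1
  | succ t ih =>
    intro k hk
    have hleft : (if k = 0 then .inl true else row t (k - 1)) =
        if k = 0 then .inl true else M.diagram x t (k - 1) := by
      rw [ih _ (by omega)]
    have hright : (if k + 1 = K then .inr (M.blank, none) else row t (k + 1)) =
        M.diagram x t (k + 1) := by
      by_cases h : k + 1 = K
      · rw [if_pos h, h, diagram_eq_blank hhead hx]
      · rw [if_neg h, ih _ (by omega)]
    rw [diagram_succ, ← hleft, ← hright, ← ih k hk]
    exact (hrow.2 t k hk).2

theorem isRun_diagram (hx : x.length < K)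
    (hacc : ∀ t, M.step (M.run x t) = none → (M.run x t).state ∈ M.accept) :
    M.cellRule.IsRun x K (M.diagram x) := by
  refine ⟨fun _ _ => rfl, fun t k _ => ⟨?_, ?_⟩⟩
  · rintro ⟨s, q, hcell, hhalt, hrej⟩
    rcases t with _ | t <;> rcases k with _ | k
    · cases hcell
    · simp only [diagram, CellRule.initial, CellRule.inpAt, cellRule] at hcell
      cases hx : x[k]? <;> simp [hx] at hcell
    · cases hcell
    · simp only [diagram, cfgRow, Sum.inr.injEq, Prod.mk.injEq, ite_eq_iff, Option.some.injEq,
        reduceCtorEq, and_false, or_false] at hcell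
      obtain ⟨rfl, rfl, rfl⟩ := hcell
      exact hrej (hacc t (M.step_eq_none.mpr hhalt))
  · rw [M.diagram_succ x t k]
    change M.cellNext _ _ _ = M.cellNext _ _ (ite _ (.inr (M.blank, none)) _)
    by_cases h : k + 1 = K
    · rw [if_pos h, h, diagram_eq_blank hhead hx]; rfl
    · rw [if_neg h]; rfl

theorem mem_accept_of_isRun (hx : x.length < K) {row : ℕ → ℕ → M.CellSym}
    (hrow : M.cellRule.IsRun x K row) {t : ℕ} (hhalt : M.step (M.run x t) = none) :
    (M.run x t).state ∈ M.accept := by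
  by_contra hrej
  have hlt := hhead _ (M.reaches_run x t)
  refine (hrow.2 (t + 1) ((M.run x t).head + 1) hlt).1 ?_
  rw [eq_diagram_of_isRun hhead hx hrow _ _ hlt]
  exact ⟨_, _, by simp [diagram, cfgRow], M.step_eq_none.mp hhalt, hrej⟩

theorem exists_isRun_iff (hx : x.length < K) {c : M.Cfg}
    (hc : StateTransition.Reaches M.step (M.initial x) c) (hhalt : M.step c = none) :
    (∃ row, M.cellRule.IsRun x K row) ↔ c.state ∈ M.accept := by
  obtain ⟨t, rfl⟩ := M.exists_run_eq hc
  refine ⟨fun ⟨row, hrow⟩ => mem_accept_of_isRun hhead hx hrow hhalt, fun hacc =>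
    ⟨M.diagram x, isRun_diagram hhead hx fun t' hhalt' => ?_⟩⟩
  rwa [M.run_eq_of_halt hhalt' hhalt]

end Space

end TuringDecider

theorem InExpSpace.exists_cellRule {A : Type} {L : Language A} (h : InExpSpace L) :
    ∃ (R : CellRule A) (p : Polynomial ℕ), ∀ (x : List A) (N : ℕ), p.eval x.length ≤ N →
      (x ∈ L ↔ ∃ row, R.IsRun x (2 ^ N) row) := by
  obtain ⟨M, p, h⟩ := h
  refine ⟨M.cellRule, p + Polynomial.X + 1, fun x N hN => ?_⟩
  simp only [Polynomial.eval_add, Polynomial.eval_X, Polynomial.eval_one] at hN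
  obtain ⟨hhead, c, hc, hhalt, hacc⟩ := h x
  have hspace : 2 ^ p.eval x.length < 2 ^ N := Nat.pow_lt_pow_right (by omega) (by omega)
  have hx : x.length < 2 ^ N :=
    Nat.lt_two_pow_self.trans_le (Nat.pow_le_pow_right two_pos (by omega))
  rw [← hacc, TuringDecider.exists_isRun_iff (fun c hc => ?_) hx hc hhalt]
  exact (Nat.succ_le_of_lt (hhead c hc)).trans_lt hspace

/-! ## The sentence -/

/-- Letters of the words that represent computations on `2 ^ N` cells. A cell is represented by a
letter `inl (f, l, c, r)`, where `c` is the contents of the cell, `l` and `r` are those of its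
neighbours, and `f` tells whether the cell is the first one, followed by `N` letters
`inr (b, e)`, where the `b` are the bits of the address of the cell, lowest bit first, and `e` tells
whether all lower bits are `true`. -/
abbrev CellRule.Letter {A : Type} (R : CellRule A) : Type :=
  (Bool × R.Γ × R.Γ × R.Γ) ⊕ (Bool × Bool)

namespace CellRule

variable {A : Type} {R : CellRule A}

namespace Letter

/-- Letters for cells. -/
def IsCell : R.Letter → Prop
  | .inl _ => True
  | .inr _ => False

/-- Letters for bits of addresses. -/
def IsBit : R.Letter → Prop
  | .inl _ => False
  | .inr _ => True

/-- Letters for first cells. -/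
def IsFirst : R.Letter → Prop
  | .inl (f, _) => f = true
  | .inr _ => False

/-- Letters for cells other than the first one. -/
def IsLater : R.Letter → Prop
  | .inl (f, _) => f = false
  | .inr _ => False

/-- Letters for cells with contents `γ`. -/
def Holds (γ : R.Γ) : R.Letter → Prop
  | .inl (_, _, c, _) => c = γ
  | .inr _ => False

/-- Letters for bits with value `b`. -/
def HasBit (b : Bool) : R.Letter → Prop
  | .inl _ => False
  | .inr (c, _) => c = b

/-- Letters at the start of a word. -/
def IsStart : R.Letter → Prop
  | .inl (f, _, c, _) => f = true ∧ c = R.first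
  | .inr _ => False

/-- Allowed letters. -/
def Valid : R.Letter → Prop
  | .inl (f, l, c, _) => ¬R.bad c ∧ (f = true → l = R.first)
  | .inr _ => True

/-- Possible pairs of consecutive letters. -/
def Adj : R.Letter → R.Letter → Prop
  | .inl _, .inl _ => False
  | .inl _, .inr (_, e) => e = true
  | .inr (b, e), .inr (_, e') => e' = (e && b)
  | .inr (b, e), .inl (f, _) => f = (e && b)

/-- Possible pairs of letters with the same role in consecutive cells. -/
def Shift : R.Letter → R.Letter → Prop
  | .inl (_, _, c, r), .inl (f', l', c', _) =>
      (f' = true → r = R.blank) ∧ (f' = false → l' = c ∧ c' = r)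
  | .inr (b, e), .inr (b', _) => b' = xor b e
  | .inl _, .inr _ => False
  | .inr _, .inl _ => False

theorem isBit_iff_not_isCell (a : R.Letter) : IsBit a ↔ ¬IsCell a := by
  cases a <;> simp [IsBit, IsCell]

end Letter

end CellRule

namespace SafetyLTL

variable {A : Type}

/-- The disjunction over the letters `a` in a list of `a ∧ F a`. -/
def caseList (F : A → SafetyLTL A) (l : List A) : SafetyLTL A :=
  l.foldr (fun a φ => .or (.and (.letter a) (F a)) φ) .bot

theorem sat_caseList (F : A → SafetyLTL A) (l : List A) (σ : DataWord A) (i : ℕ) (D : σ.Datum) :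
    (caseList F l).Sat σ i D ↔ σ.letter i ∈ l ∧ (F (σ.letter i)).Sat σ i D := by
  induction l with
  | nil => simp [caseList, Sat]
  | cons a l ih =>
    change (σ.letter i = a ∧ (F a).Sat σ i D) ∨ (caseList F l).Sat σ i D ↔ _
    rw [ih, List.mem_cons, or_and_right]
    refine or_congr_left (and_congr_right ?_)
    rintro rfl
    rfl

/-- Case distinction on the current letter: `F a` holds for the current letter `a`. -/
noncomputable def caseLetter [Fintype A] (F : A → SafetyLTL A) : SafetyLTL A :=
  caseList F Finset.univ.toList

theorem sat_caseLetter [Fintype A] (F : A → SafetyLTL A) (σ : DataWord A) (i : ℕ) (D : σ.Datum) :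
    (caseLetter F).Sat σ i D ↔ (F (σ.letter i)).Sat σ i D := by
  simp [caseLetter, sat_caseList]

open Classical in
/-- The current letter is in `P`. -/
noncomputable def anyOf [Fintype A] (P : A → Prop) : SafetyLTL A :=
  caseLetter fun a => if P a then .top else .bot

theorem sat_anyOf [Fintype A] (P : A → Prop) (σ : DataWord A) (i : ℕ) (D : σ.Datum) :
    (anyOf P).Sat σ i D ↔ P (σ.letter i) := by
  rw [anyOf, sat_caseLetter]
  split_ifs with h <;> simp [Sat, h]

/-- `φ` holds from now on. -/
def always (φ : SafetyLTL A) : SafetyLTL A := .release .bot φ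

theorem sat_always (φ : SafetyLTL A) (σ : DataWord A) (i : ℕ) (D : σ.Datum) :
    (always φ).Sat σ i D ↔ ∀ k, i ≤ k → φ.Sat σ k D := by
  simp [always, Sat]

/-- `φ` holds `n` positions later. -/
def nexts : ℕ → SafetyLTL A → SafetyLTL A
  | 0, φ => φ
  | n + 1, φ => .next (nexts n φ)

theorem sat_nexts (n : ℕ) (φ : SafetyLTL A) (σ : DataWord A) (i : ℕ) (D : σ.Datum) :
    (nexts n φ).Sat σ i D ↔ φ.Sat σ (i + n) D := by
  induction n generalizing i with
  | zero => rfl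
  | succ n ih => rw [nexts, Sat, ih, Nat.add_assoc, Nat.add_comm 1]

/-- The conjunction of `F j` for all `j < n`. -/
def andRange (n : ℕ) (F : ℕ → SafetyLTL A) : SafetyLTL A :=
  (List.range n).foldr (fun j φ => .and (F j) φ) .top

theorem sat_andRange (n : ℕ) (F : ℕ → SafetyLTL A) (σ : DataWord A) (i : ℕ) (D : σ.Datum) :
    (andRange n F).Sat σ i D ↔ ∀ j < n, (F j).Sat σ i D := by
  have sat_foldr (l : List ℕ) : (l.foldr (fun j φ => SafetyLTL.and (F j) φ) .top).Sat σ i D ↔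
      ∀ j ∈ l, (F j).Sat σ i D := by
    induction l with
    | nil => simp [Sat]
    | cons a l ih => rw [List.foldr_cons, Sat, ih, List.forall_mem_cons]
  simp only [andRange, sat_foldr, List.mem_range]

theorem sat_release_iff (φ ψ : SafetyLTL A) (σ : DataWord A) (i : ℕ) (D : σ.Datum) :
    (release φ ψ).Sat σ i D ↔
      ψ.Sat σ i D ∧ (φ.Sat σ i D ∨ (release φ ψ).Sat σ (i + 1) D) := by
  simp only [Sat]
  constructor
  · rintro (h | ⟨j, hj, h, h'⟩)
    · exact ⟨h i le_rfl, .inr (.inl fun k hk => h k (by omega))⟩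
    · refine ⟨h' i le_rfl hj, ?_⟩
      rcases hj.eq_or_lt with rfl | hj
      · exact .inl h
      · exact .inr (.inr ⟨j, hj, h, fun k hk hk' => h' k (by omega) hk'⟩)
  · rintro ⟨h, h' | h' | ⟨j, hj, h₁, h₂⟩⟩
    · exact .inr ⟨i, le_rfl, h', fun k hk hk' => by rwa [le_antisymm hk' hk]⟩
    · refine .inl fun k hk => ?_
      rcases hk.eq_or_lt with rfl | hk
      · exact h
      · exact h' k hk
    · refine .inr ⟨j, by omega, h₁, fun k hk hk' => ?_⟩
      rcases hk.eq_or_lt with rfl | hk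
      · exact h
      · exact h₂ k hk hk'

theorem isSentence_caseLetter [Fintype A] {F : A → SafetyLTL A} (h : ∀ a, (F a).IsSentence) :
    (caseLetter F).IsSentence := by
  rw [caseLetter]
  induction (Finset.univ : Finset A).toList with
  | nil => trivial
  | cons a l ih => exact ⟨⟨trivial, h a⟩, ih⟩

theorem isSentence_anyOf [Fintype A] (P : A → Prop) : (anyOf P).IsSentence :=
  isSentence_caseLetter fun a => by split_ifs <;> trivial

theorem isSentence_nexts (n : ℕ) {φ : SafetyLTL A} (h : φ.IsSentence) :
    (nexts n φ).IsSentence := by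
  induction n with
  | zero => exact h
  | succ _ ih => exact ih

theorem isSentence_andRange (n : ℕ) {F : ℕ → SafetyLTL A} (h : ∀ j, (F j).IsSentence) :
    (andRange n F).IsSentence := by
  rw [andRange]
  induction List.range n with
  | nil => trivial
  | cons j l ih => exact ⟨h j, ih⟩

end SafetyLTL

namespace CellRule

open SafetyLTL Letter

variable {A : Type} (R : CellRule A)

/-- The current letter is for a cell with contents `γ` and its datum is in the register. -/
noncomputable def here (γ : R.Γ) : SafetyLTL R.Letter := .and (anyOf (Holds γ)) .up

/-- The datum in the register occurs at a cell before the next first cell, and the contents of that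
cell is `γ`. -/
noncomputable def waitLate (γ : R.Γ) : SafetyLTL R.Letter :=
  .release (R.here γ)
    (.or (anyOf IsBit) (.and (anyOf IsLater) (.or .notUp (R.here γ))))

/-- The datum in the register occurs at a cell before the next but one first cell, and the contents
of that cell is `γ`. -/
noncomputable def wait (γ : R.Γ) : SafetyLTL R.Letter :=
  .release (R.here γ)
    (.or (anyOf IsBit) (.or (R.here γ) (.and .notUp
      (.or (anyOf IsLater) (.and (anyOf IsFirst) (.next (R.waitLate γ)))))))

/-- The next cell is a first one, or has contents `γ` and `φ` holds after it. -/
noncomputable def readInput (γ : R.Γ) (φ : SafetyLTL R.Letter) : SafetyLTL R.Letter :=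
  .release (anyOf IsCell)
    (.or (anyOf IsBit) (.or (anyOf IsFirst) (.and (anyOf (Holds γ)) (.next φ))))

/-- All cells before the next first cell are blank. -/
noncomputable def readBlanks : SafetyLTL R.Letter :=
  .release (anyOf IsFirst) (.or (anyOf IsBit) (.or (anyOf IsFirst) (anyOf (Holds R.blank))))

/-- The next `n` cells hold the input from position `j` on, and the later cells are blank. -/
noncomputable def readInputs (x : List A) (j n : ℕ) : SafetyLTL R.Letter :=
  (List.range' j n).foldr (fun j φ => R.readInput (R.inpAt x[j]?) φ) R.readBlanks

open Classical in
/-- Conditions at a letter that do not depend on the input. -/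
noncomputable def letterCondition (N : ℕ) (a : R.Letter) : SafetyLTL R.Letter :=
  .and (if Valid a then .top else .bot) (.and (.next (anyOf (Adj a)))
    (.and (.next (nexts N (anyOf (Shift a)))) (match a with
      | .inl (_, l, c, r) => .freeze (.next (R.wait (R.next l c r)))
      | .inr _ => .top)))

/-- Cells with the same datum have the same bit `j` of the address, if it is `b` in the first of
them. -/
noncomputable def sameBit (j : ℕ) (b : Bool) : SafetyLTL R.Letter :=
  always (.or (anyOf IsBit) (.or (.next (nexts j (anyOf fun a => ¬HasBit b a)))
    (.freeze (.next (always (.or (anyOf IsBit)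
      (.or .notUp (.next (nexts j (anyOf (HasBit b)))))))))))

/-- Cells with the same datum have the same address. -/
noncomputable def sameAddress (N : ℕ) : SafetyLTL R.Letter :=
  andRange N fun j => .and (R.sameBit j true) (R.sameBit j false)

/-- The next `N` letters are for bits `false`. -/
noncomputable def zeroBits (N : ℕ) : SafetyLTL R.Letter :=
  andRange N fun j => nexts j (anyOf (HasBit false))

/-- The sentence for the input `x` and `2 ^ N` cells. -/
noncomputable def sentence (x : List A) (N : ℕ) : SafetyLTL R.Letter :=
  .and (anyOf IsStart) (.and (.next (R.zeroBits N)) (.and (.next (R.readInputs x 0 N))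
    (.and (R.sameAddress N) (always (caseLetter (R.letterCondition N))))))

theorem sat_zeroBits (N : ℕ) (σ : DataWord R.Letter) (i : ℕ) (D : σ.Datum) :
    (R.zeroBits N).Sat σ i D ↔ ∀ j < N, HasBit false (σ.letter (i + j)) := by
  simp only [zeroBits, sat_andRange, sat_nexts, sat_anyOf]

theorem sat_sameBit (j : ℕ) (b : Bool) (σ : DataWord R.Letter) (D : σ.Datum) :
    (R.sameBit j b).Sat σ 0 D ↔ ∀ p p', p < p' → IsCell (σ.letter p) → IsCell (σ.letter p') →
      σ.cls p' = σ.cls p → HasBit b (σ.letter (p + 1 + j)) → HasBit b (σ.letter (p' + 1 + j)) := by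
  simp only [sameBit, sat_always, Sat, sat_anyOf, sat_nexts, isBit_iff_not_isCell]
  constructor
  · intro h p p' hp h₁ h₂ h₃ h₄
    rcases h p (by omega) with h | h | h
    · exact absurd h₁ h
    · exact absurd h₄ h
    · rcases h p' (by omega) with h | h | h
      · exact absurd h₂ h
      · exact absurd h₃ h
      · exact h
  · intro h p _
    by_cases h₁ : IsCell (σ.letter p)
    · by_cases h₄ : HasBit b (σ.letter (p + 1 + j))
      · refine .inr (.inr fun p' hp => ?_)
        by_cases h₂ : IsCell (σ.letter p')
        · by_cases h₃ : σ.cls p' = σ.cls p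
          · exact .inr (.inr (h p p' (by omega) h₁ h₂ h₃ h₄))
          · exact .inr (.inl h₃)
        · exact .inl h₂
      · exact .inr (.inl h₄)
    · exact .inl h₁

theorem sat_sameAddress (N : ℕ) (σ : DataWord R.Letter) (i : ℕ) (D : σ.Datum) :
    (R.sameAddress N).Sat σ i D ↔ ∀ j < N, ∀ b, (R.sameBit j b).Sat σ i D := by
  simp only [sameAddress, sat_andRange, Sat, Bool.forall_bool, and_comm]

theorem isSentence_zeroBits (N : ℕ) : (R.zeroBits N).IsSentence :=
  isSentence_andRange N fun j => isSentence_nexts j (isSentence_anyOf _)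

theorem isSentence_readInputs (x : List A) (j n : ℕ) : (R.readInputs x j n).IsSentence := by
  rw [readInputs]
  induction List.range' j n with
  | nil => exact ⟨isSentence_anyOf _, isSentence_anyOf _, isSentence_anyOf _, isSentence_anyOf _⟩
  | cons a l ih =>
    exact ⟨isSentence_anyOf _, isSentence_anyOf _, isSentence_anyOf _, isSentence_anyOf _, ih⟩

theorem isSentence_sameBit (j : ℕ) (b : Bool) : (R.sameBit j b).IsSentence :=
  ⟨trivial, isSentence_anyOf _, isSentence_nexts j (isSentence_anyOf _), trivial⟩

theorem isSentence_letterCondition (N : ℕ) (a : R.Letter) : (R.letterCondition N a).IsSentence := by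
  refine ⟨by split_ifs <;> trivial, isSentence_anyOf _, isSentence_nexts N (isSentence_anyOf _), ?_⟩
  rcases a with _ | _ <;> trivial

theorem isSentence_sentence (x : List A) (N : ℕ) : (R.sentence x N).IsSentence :=
  ⟨isSentence_anyOf _, R.isSentence_zeroBits N, R.isSentence_readInputs x 0 N,
    isSentence_andRange N fun j => ⟨R.isSentence_sameBit j true, R.isSentence_sameBit j false⟩,
    trivial, isSentence_caseLetter (R.isSentence_letterCondition N)⟩

end CellRule

/-! ## The automaton -/

namespace PosBool

variable {Q Q₂ : Type}

/-- Renaming of states. -/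
def map (g : Q → Q₂) : PosBool Q → PosBool Q₂
  | .keep q => .keep (g q)
  | .down q => .down (g q)
  | .top => .top
  | .bot => .bot
  | .and φ ψ => .and (φ.map g) (ψ.map g)
  | .or φ ψ => .or (φ.map g) (ψ.map g)

theorem sat_map (g : Q → Q₂) (S T : Set Q₂) (φ : PosBool Q) :
    (φ.map g).Sat S T ↔ φ.Sat (g ⁻¹' S) (g ⁻¹' T) := by
  induction φ with
  | keep q => rfl
  | down q => rfl
  | top => rfl
  | bot => rfl
  | and φ ψ h₁ h₂ => exact and_congr h₁ h₂
  | or φ ψ h₁ h₂ => exact or_congr h₁ h₂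

theorem Sat.mono {S S' T T' : Set Q} (hS : S ⊆ S') (hT : T ⊆ T') {φ : PosBool Q}
    (h : φ.Sat S T) : φ.Sat S' T' := by
  induction φ with
  | keep q => exact hS h
  | down q => exact hT h
  | top => trivial
  | bot => exact h
  | and φ ψ h₁ h₂ => exact ⟨h₁ h.1, h₂ h.2⟩
  | or φ ψ h₁ h₂ => exact h.imp h₁ h₂

open Classical in
/-- The truth value of a proposition, as a formula. -/
noncomputable def ofProp (p : Prop) : PosBool Q := if p then .top else .bot

theorem sat_ofProp (p : Prop) (S T : Set Q) : (ofProp p).Sat S T ↔ p := by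
  unfold ofProp
  split_ifs with h <;> simp [Sat, h]

end PosBool

theorem SafetyARA.accepts_iff_exists_predicate {A Q : Type} (M : SafetyARA A Q) (σ : DataWord A) :
    M.Accepts σ ↔ ∃ V : Q → ℕ → σ.Datum → Prop, V M.start 0 (σ.cls 0) ∧
      ∀ q i D, V q i D → (M.rule σ i (q, D)).Sat {q' | V q' (i + 1) D}
        {q' | V q' (i + 1) (σ.cls i)} := by
  constructor
  · rintro ⟨F, h0, h⟩
    refine ⟨fun q i D => (q, D) ∈ F i, by simp [h0], fun q i D hq => ?_⟩
    obtain ⟨S, T, hST, hF⟩ := h i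
    refine (hST _ hq).mono (fun q' hq' => ?_) fun q' hq' => ?_
    · change _ ∈ F (i + 1)
      rw [hF]
      exact .inl ⟨_, hq, hq', rfl⟩
    · change _ ∈ F (i + 1)
      rw [hF]
      exact .inr ⟨_, hq, hq', rfl⟩
  · rintro ⟨V, h0, h⟩
    let S : ℕ → Config Q σ → Set Q := fun i c => {q' | V q' (i + 1) c.2}
    let T : ℕ → Config Q σ → Set Q := fun i _ => {q' | V q' (i + 1) (σ.cls i)}
    let F : ℕ → Set (Config Q σ) := fun i => Nat.rec {(M.start, σ.cls 0)} (fun i F =>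
      {d | ∃ c ∈ F, d.1 ∈ S i c ∧ d.2 = c.2} ∪ {d | ∃ c ∈ F, d.1 ∈ T i c ∧ d.2 = σ.cls i}) i
    have hF : ∀ i, ∀ c ∈ F i, V c.1 i c.2 := by
      rintro (_ | i)
      · rintro c rfl
        exact h0
      · rintro ⟨q, D⟩ (⟨c, -, hc, rfl⟩ | ⟨c, -, hc, rfl⟩) <;> exact hc
    exact ⟨F, rfl, fun i => ⟨S i, T i, fun c hc => h c.1 i c.2 (hF i c hc), rfl⟩⟩

namespace CellRule

/-- The control states of the automaton, which are combined with a counter. They check the following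
conditions.
* `start`: the letter is `IsStart`; then `zero`, `init` and `main` take over.
* `main`: every letter is `Valid` and spawns the checks `adj` and `dist`; letters for cells also
  spawn `addr` and `wait`.
* `zero`: the address of the first cell is `0`.
* `init`: the first row holds the input.
* `addr`: for every bit `b` of the address of a cell, spawn `watch b`.
* `watch b`: all later cells with the datum in the register have the bit `b`; it spawns `check b`,
  which counts down to that bit.
* `dist a`: count down to the letter with the same role in the next cell, which is a `Shift` of `a`.
* `adj a`: the letter is adjacent to `a`.
* `wait γ`, `waitLate γ`: the conditions of the formulae of the same names. -/
inductive Ctrl (X Y : Type) : Type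
  | start
  | main
  | zero
  | init
  | addr
  | watch (b : Bool)
  | check (b : Bool)
  | dist (a : X)
  | adj (a : X)
  | wait (γ : Y)
  | waitLate (γ : Y)
  deriving Fintype

/-- References to values of the counter of a state, relative to the current value. -/
inductive Ref : Type
  | zero | one | max | pred | same | succ

/-- The value for a reference, where the counter ranges from `0` to `N + 1`. -/
def Ref.val (N J : ℕ) : Ref → ℕ
  | .zero => 0
  | .one => 1
  | .max => N
  | .pred => J - 1
  | .same => J
  | .succ => min (J + 1) (N + 1)

theorem Ref.val_le {N J : ℕ} (hJ : J ≤ N + 1) (r : Ref) : r.val N J ≤ N + 1 := by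
  cases r <;> simp only [Ref.val] <;> omega

/-- Kinds of values of the counter: `0`, between `1` and `N`, and `N + 1`. Values between
`1` and `N` come with the initial contents of the corresponding cell. -/
inductive CounterKind (Y : Type) : Type
  | low
  | mid (γ : Y)
  | high

open Letter
open PosBool (ofProp sat_ofProp)

variable {A : Type} (R : CellRule A)

/-- The kind of a value of the counter, for the input `x`. -/
def kind (x : List A) (N : ℕ) : ℕ → CounterKind R.Γ
  | 0 => .low
  | J + 1 => if J < N then .mid (R.inpAt x[J]?) else .high

/-- The transition formula for the state `main`. -/
noncomputable def mainRule (a : R.Letter) : PosBool (Ref × Ctrl R.Letter R.Γ) :=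
  .and (ofProp (Valid a)) (.and (.keep (.zero, .main)) (.and (.keep (.zero, .adj a))
    (.and (.keep (.max, .dist a)) (match a with
      | .inl (_, l, c, r) =>
        .and (.down (.zero, .addr)) (.down (.zero, .wait (R.next l c r)))
      | .inr _ => .top))))

open Classical in
/-- The transition formulae. -/
noncomputable def rule (k : CounterKind R.Γ) (q : Ctrl R.Letter R.Γ) (a : R.Letter) (up : Bool) :
    PosBool (Ref × Ctrl R.Letter R.Γ) :=
  match q with
  | .start => .and (ofProp (IsStart a)) (.and (.keep (.max, .zero)) (.and (.keep (.one, .init))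
      (R.mainRule a)))
  | .main => R.mainRule a
  | .zero => match k with
    | .mid _ => .and (ofProp (HasBit false a)) (.keep (.pred, .zero))
    | _ => .top
  | .init => match k, a with
    | .low, _ => .top
    | _, .inr _ => .keep (.same, .init)
    | .mid γ, .inl (f, _, c, _) => if f then .top else .and (ofProp (c = γ)) (.keep (.succ, .init))
    | .high, .inl (f, _, c, _) =>
        if f then .top else .and (ofProp (c = R.blank)) (.keep (.same, .init))
  | .addr => match k, a with
    | .high, _ => .top
    | _, .inl _ => .top
    | _, .inr (b, _) => .and (.keep (.same, .watch b)) (.keep (.succ, .addr))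
  | .watch b => .and (.keep (.same, .watch b))
      (if IsCell a ∧ up = true then .keep (.same, .check b) else .top)
  | .check b => match k with
    | .low => ofProp (HasBit b a)
    | .mid _ => .keep (.pred, .check b)
    | .high => .top
  | .dist a' => match k with
    | .low => ofProp (Shift a' a)
    | .mid _ => .keep (.pred, .dist a')
    | .high => .top
  | .adj a' => ofProp (Adj a' a)
  | .wait γ => match a with
    | .inr _ => .keep (.zero, .wait γ)
    | .inl (f, _, c, _) => if up then ofProp (c = γ)
        else if f then .keep (.zero, .waitLate γ) else .keep (.zero, .wait γ)
  | .waitLate γ => match a with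
    | .inr _ => .keep (.zero, .waitLate γ)
    | .inl (f, _, c, _) => if f then .bot else if up then ofProp (c = γ)
        else .keep (.zero, .waitLate γ)

/-- States of the automaton: a counter and a control state. -/
abbrev AState (N : ℕ) : Type := Fin (N + 2) × Ctrl R.Letter R.Γ

/-- The state for a reference. -/
def resolve (N : ℕ) (J : Fin (N + 2)) (r : Ref × Ctrl R.Letter R.Γ) : R.AState N :=
  (⟨r.1.val N J, Nat.lt_succ_of_le (Ref.val_le (Nat.le_of_lt_succ J.2) r.1)⟩, r.2)

/-- The automaton for the input `x` and `2 ^ N` cells. -/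
noncomputable def automaton (x : List A) (N : ℕ) : SafetyARA R.Letter (R.AState N) where
  start := (0, .start)
  trans q a up := (R.rule (R.kind x N q.1) q.2 a up).map (R.resolve N q.1)

open Classical in
/-- Compatibility of a predicate with the transition formulae. -/
def Compatible (x : List A) (N : ℕ) (σ : DataWord R.Letter)
    (V : ℕ → Ctrl R.Letter R.Γ → ℕ → σ.Datum → Prop) : Prop :=
  ∀ J ≤ N + 1, ∀ q i D, V J q i D →
    (R.rule (R.kind x N J) q (σ.letter i) (decide (D = σ.cls i))).Sat
      {r | V (r.1.val N J) r.2 (i + 1) D} {r | V (r.1.val N J) r.2 (i + 1) (σ.cls i)}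

theorem automaton_accepts_iff (x : List A) (N : ℕ) (σ : DataWord R.Letter) :
    (R.automaton x N).Accepts σ ↔ ∃ V : ℕ → Ctrl R.Letter R.Γ → ℕ → σ.Datum → Prop,
      V 0 .start 0 (σ.cls 0) ∧ R.Compatible x N σ V := by
  rw [SafetyARA.accepts_iff_exists_predicate]
  constructor
  · rintro ⟨V, h0, h⟩
    refine ⟨fun J q i D => ∃ hJ : J < N + 2, V (⟨J, hJ⟩, q) i D, ⟨by omega, h0⟩,
      fun J _ q i D ⟨_, hV⟩ => ?_⟩
    have := h _ _ _ hV
    rw [SafetyARA.rule, automaton, PosBool.sat_map] at this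
    refine this.mono (fun r hr => ?_) fun r hr => ?_
    · exact ⟨_, (show V _ _ _ from hr)⟩
    · exact ⟨_, (show V _ _ _ from hr)⟩
  · rintro ⟨V, h0, h⟩
    refine ⟨fun q => V q.1 q.2, h0, fun q i D hV => ?_⟩
    rw [SafetyARA.rule, automaton, PosBool.sat_map]
    exact h q.1 (Nat.le_of_lt_succ q.1.2) _ _ _ hV

variable {R}

theorem kind_of_pos {x : List A} {J N : ℕ} (h : 0 < J) (h' : J ≤ N) :
    R.kind x N J = .mid (R.inpAt x[J - 1]?) := by
  obtain ⟨j, rfl⟩ : ∃ j, J = j + 1 := ⟨J - 1, by omega⟩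
  exact if_pos h'

theorem kind_add_one (x : List A) (N : ℕ) : R.kind x N (N + 1) = .high := if_neg (lt_irrefl N)

theorem kind_cases (R : CellRule A) (x : List A) {J N : ℕ} (hJ : J ≤ N + 1) :
    (J = 0 ∧ R.kind x N J = .low) ∨ (0 < J ∧ J ≤ N ∧ R.kind x N J = .mid (R.inpAt x[J - 1]?)) ∨
      (J = N + 1 ∧ R.kind x N J = .high) := by
  rcases Nat.eq_zero_or_pos J with rfl | h
  · exact .inl ⟨rfl, rfl⟩
  · rcases hJ.eq_or_lt with rfl | h'
    · exact .inr (.inr ⟨rfl, kind_add_one x N⟩)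
    · exact .inr (.inl ⟨h, Nat.le_of_lt_succ h', kind_of_pos h (Nat.le_of_lt_succ h')⟩)

end CellRule

/-! ## Words as sequences of cells -/

/-- Whether the lowest `j` bits of `q` are all `true`. -/
def lowOnes (q : ℕ) : ℕ → Bool
  | 0 => true
  | j + 1 => lowOnes q j && q.testBit j

theorem lowOnes_succ' (q j : ℕ) : lowOnes q (j + 1) = (q.testBit 0 && lowOnes (q / 2) j) := by
  induction j with
  | zero => simp [lowOnes]
  | succ j ih => rw [lowOnes, ih, lowOnes, Nat.testBit_succ, Bool.and_assoc]

theorem testBit_add_one_eq_xor_lowOnes (q j : ℕ) :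
    (q + 1).testBit j = xor (q.testBit j) (lowOnes q j) := by
  induction j generalizing q with
  | zero =>
    simp only [Nat.testBit_zero, lowOnes]
    rcases Nat.mod_two_eq_zero_or_one q with h | h <;> simp [Nat.add_mod, h]
  | succ j ih =>
    rw [lowOnes_succ', Nat.testBit_succ, Nat.testBit_succ]
    rcases Nat.mod_two_eq_zero_or_one q with h | h
    · have hdiv : (q + 1) / 2 = q / 2 := by omega
      simp [hdiv, h, Nat.testBit_zero]
    · have hdiv : (q + 1) / 2 = q / 2 + 1 := by omega
      simp [hdiv, h, ih, Nat.testBit_zero]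

theorem lowOnes_iff_two_pow_dvd (q j : ℕ) : lowOnes q j = true ↔ 2 ^ j ∣ q + 1 := by
  induction j generalizing q with
  | zero => simp [lowOnes]
  | succ j ih =>
    rw [lowOnes_succ', Bool.and_eq_true, ih, Nat.testBit_zero, decide_eq_true_eq, pow_succ']
    constructor
    · rintro ⟨h, c, hc⟩
      exact ⟨c, by rw [Nat.mul_assoc, ← hc]; omega⟩
    · rintro ⟨c, hc⟩
      rw [Nat.mul_assoc] at hc
      exact ⟨by omega, c, by omega⟩

theorem lowOnes_eq_decide (q j : ℕ) : lowOnes q j = decide (2 ^ j ∣ q + 1) := by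
  rw [Bool.eq_iff_iff, lowOnes_iff_two_pow_dvd, decide_eq_true_eq]

theorem mod_two_pow_eq_of_testBit {N q q' : ℕ} (h : ∀ j < N, q.testBit j = q'.testBit j) :
    q % 2 ^ N = q' % 2 ^ N := by
  refine Nat.eq_of_testBit_eq fun j => ?_
  rw [Nat.testBit_mod_two_pow, Nat.testBit_mod_two_pow]
  by_cases hj : j < N
  · rw [h j hj]
  · simp [hj]

namespace CellRule

open Letter

variable {A : Type} {R : CellRule A} {N : ℕ} {a : ℕ → R.Letter}

/-- The conditions on a word that concern letters at a bounded number of positions, or at a distance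
of `N + 1`. -/
structure IsLocallyConsistent (N : ℕ) (a : ℕ → R.Letter) : Prop where
  isStart : IsStart (a 0)
  zero : ∀ j < N, HasBit false (a (1 + j))
  valid : ∀ i, Valid (a i)
  adj : ∀ i, Adj (a i) (a (i + 1))
  shift : ∀ i, Shift (a i) (a (i + 1 + N))

/-- The word `a` is a sequence of cells, numbered from `0`, where the cell `q` has contents `c q`,
claims that its neighbours have contents `l q` and `r q`, and is followed by its address, the number
`q` modulo `2 ^ N`. -/
structure IsCellSequence (N : ℕ) (a : ℕ → R.Letter) (l c r : ℕ → R.Γ) : Prop where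
  cell : ∀ q, a (q * (N + 1)) = .inl (decide (2 ^ N ∣ q), l q, c q, r q)
  bit : ∀ q, ∀ j < N, a (q * (N + 1) + 1 + j) = .inr (q.testBit j, lowOnes q j)

namespace Letter

theorem eq_inr_of_adj_cell {u v : R.Letter} {b : Bool} (hu : IsCell u) (h : Adj u v)
    (hv : HasBit b v) : v = .inr (b, true) := by
  rcases u with u | u <;> rcases v with v | ⟨b', e⟩
  · exact h.elim
  · rw [show b' = b from hv, show e = true from h]
  · exact hu.elim
  · exact hu.elim

theorem eq_inr_of_adj_bit {b b' e : Bool} {v : R.Letter} (h : Adj (.inr (b, e)) v)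
    (hv : HasBit b' v) : v = .inr (b', e && b) := by
  rcases v with v | ⟨b'', e'⟩
  · exact hv.elim
  · rw [show b'' = b' from hv, show e' = (e && b) from h]

theorem exists_eq_inl_of_shift_of_adj {u : Bool × R.Γ × R.Γ × R.Γ} {b e : Bool} {v : R.Letter}
    (h : Shift (.inl u) v) (h' : Adj (.inr (b, e)) v) : ∃ l c r, v = .inl (e && b, l, c, r) := by
  rcases v with ⟨f, l, c, r⟩ | v
  · exact ⟨l, c, r, by rw [show f = (e && b) from h']⟩
  · exact h.elim

theorem hasBit_of_shift {b e : Bool} {v : R.Letter} (h : Shift (.inr (b, e)) v) :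
    HasBit (xor b e) v := by
  rcases v with v | v
  · exact h.elim
  · exact h

theorem exists_eq_inl_of_isStart {u : R.Letter} (h : IsStart u) :
    ∃ l c r, u = .inl (true, l, c, r) := by
  rcases u with ⟨f, l, c, r⟩ | u
  · exact ⟨l, c, r, by rw [h.1]⟩
  · exact h.elim

end Letter

namespace IsLocallyConsistent

theorem eq_inr_of_hasBit (h : IsLocallyConsistent N a) {q : ℕ} (hcell : IsCell (a (q * (N + 1))))
    (hbit : ∀ j < N, HasBit (q.testBit j) (a (q * (N + 1) + 1 + j))) {j : ℕ} (hj : j < N) :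
    a (q * (N + 1) + 1 + j) = .inr (q.testBit j, lowOnes q j) := by
  induction j with
  | zero => exact eq_inr_of_adj_cell hcell (h.adj _) (hbit 0 hj)
  | succ j ih =>
    have hadj := h.adj (q * (N + 1) + 1 + j)
    rw [ih (by omega)] at hadj
    exact eq_inr_of_adj_bit hadj (hbit (j + 1) hj)

theorem next_cell (h : IsLocallyConsistent N a) (hN : 0 < N) {q : ℕ} {u}
    (hcell : a (q * (N + 1)) = .inl u)
    (hbit : ∀ j < N, a (q * (N + 1) + 1 + j) = .inr (q.testBit j, lowOnes q j)) :
    ∃ l c r, a ((q + 1) * (N + 1)) = .inl (decide (2 ^ N ∣ q + 1), l, c, r) := by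
  obtain ⟨n, rfl⟩ : ∃ n, N = n + 1 := ⟨N - 1, by omega⟩
  have hshift := h.shift (q * (n + 1 + 1))
  have hadj := h.adj (q * (n + 1 + 1) + 1 + n)
  rw [hbit n (by omega)] at hadj
  rw [show q * (n + 1 + 1) + 1 + (n + 1) = (q + 1) * (n + 1 + 1) by ring, hcell] at hshift
  rw [show q * (n + 1 + 1) + 1 + n + 1 = (q + 1) * (n + 1 + 1) by ring] at hadj
  rw [← lowOnes_eq_decide]
  exact exists_eq_inl_of_shift_of_adj hshift hadj

theorem next_bit (h : IsLocallyConsistent N a) {q j : ℕ}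
    (hbit : a (q * (N + 1) + 1 + j) = .inr (q.testBit j, lowOnes q j)) :
    HasBit ((q + 1).testBit j) (a ((q + 1) * (N + 1) + 1 + j)) := by
  have hshift := h.shift (q * (N + 1) + 1 + j)
  rw [hbit, show q * (N + 1) + 1 + j + 1 + N = (q + 1) * (N + 1) + 1 + j by ring] at hshift
  rw [testBit_add_one_eq_xor_lowOnes]
  exact hasBit_of_shift hshift

theorem exists_isCellSequence (h : IsLocallyConsistent N a) (hN : 0 < N) :
    ∃ l c r, IsCellSequence N a l c r := by
  have hcells (q : ℕ) : (∃ l c r, a (q * (N + 1)) = .inl (decide (2 ^ N ∣ q), l, c, r)) ∧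
      ∀ j < N, a (q * (N + 1) + 1 + j) = .inr (q.testBit j, lowOnes q j) := by
    induction q with
    | zero =>
      obtain ⟨l, c, r, hcell⟩ := exists_eq_inl_of_isStart h.isStart
      refine ⟨⟨l, c, r, by simpa using hcell⟩, fun j hj => h.eq_inr_of_hasBit ?_ ?_ hj⟩
      · simp [hcell, IsCell]
      · simpa using h.zero
    | succ q ih =>
      obtain ⟨⟨l, c, r, hcell⟩, hbit⟩ := ih
      have hnext := h.next_cell hN hcell hbit
      refine ⟨hnext, fun j hj => h.eq_inr_of_hasBit ?_ (fun j hj => h.next_bit (hbit j hj)) hj⟩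
      obtain ⟨l, c, r, hcell⟩ := hnext
      simp [hcell, IsCell]
  choose l c r hcell using fun q => (hcells q).1
  exact ⟨l, c, r, hcell, fun q => (hcells q).2⟩

variable {l c r : ℕ → R.Γ}

theorem shift_cell (h : IsLocallyConsistent N a) (ha : IsCellSequence N a l c r) (q : ℕ) :
    (2 ^ N ∣ q + 1 → r q = R.blank) ∧ (¬2 ^ N ∣ q + 1 → l (q + 1) = c q ∧ c (q + 1) = r q) := by
  have hshift := h.shift (q * (N + 1))
  rw [show q * (N + 1) + 1 + N = (q + 1) * (N + 1) by ring, ha.cell, ha.cell] at hshift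
  exact ⟨fun hq => hshift.1 (decide_eq_true hq), fun hq => hshift.2 (decide_eq_false hq)⟩

theorem valid_cell (h : IsLocallyConsistent N a) (ha : IsCellSequence N a l c r) (q : ℕ) :
    ¬R.bad (c q) ∧ (2 ^ N ∣ q → l q = R.first) := by
  have hvalid := h.valid (q * (N + 1))
  rw [ha.cell] at hvalid
  exact ⟨hvalid.1, fun hq => hvalid.2 (decide_eq_true hq)⟩

theorem isRun (h : IsLocallyConsistent N a) (ha : IsCellSequence N a l c r) {x : List A}
    (hinput : ∀ k, k + 1 < 2 ^ N → c (k + 1) = R.inpAt x[k]?)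
    (hnext : ∀ q, c (q + 2 ^ N) = R.next (l q) (c q) (r q)) :
    R.IsRun x (2 ^ N) fun t k => c (t * 2 ^ N + k) := by
  have hdvd (t k : ℕ) : 2 ^ N ∣ t * 2 ^ N + k ↔ 2 ^ N ∣ k :=
    Nat.dvd_add_right (Dvd.intro_left t rfl)
  have hleft (t k : ℕ) (hk : k < 2 ^ N) :
      l (t * 2 ^ N + k) = if k = 0 then R.first else c (t * 2 ^ N + (k - 1)) := by
    rcases k with _ | k
    · exact (h.valid_cell ha _).2 ((hdvd t 0).2 (dvd_zero _))
    · refine ((h.shift_cell ha (t * 2 ^ N + k)).2 ?_).1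
      rw [Nat.add_assoc, hdvd]
      exact Nat.not_dvd_of_pos_of_lt k.succ_pos hk
  have hright (t k : ℕ) (hk : k < 2 ^ N) :
      r (t * 2 ^ N + k) = if k + 1 = 2 ^ N then R.blank else c (t * 2 ^ N + (k + 1)) := by
    split_ifs with hlast
    · exact (h.shift_cell ha _).1 (by rw [Nat.add_assoc, hdvd, hlast])
    · refine ((h.shift_cell ha (t * 2 ^ N + k)).2 ?_).2.symm
      rw [Nat.add_assoc, hdvd]
      exact Nat.not_dvd_of_pos_of_lt k.succ_pos (by omega)
  refine ⟨fun k hk => ?_, fun t k hk => ⟨(h.valid_cell ha _).1, ?_⟩⟩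
  · simp only [Nat.zero_mul, Nat.zero_add]
    rcases k with _ | k
    · have hstart := h.isStart
      have hcell := ha.cell 0
      rw [Nat.zero_mul] at hcell
      rw [hcell] at hstart
      exact hstart.2
    · exact hinput k hk
  · change c ((t + 1) * 2 ^ N + k) =
      R.next (if k = 0 then R.first else c (t * 2 ^ N + (k - 1))) (c (t * 2 ^ N + k))
        (if k + 1 = 2 ^ N then R.blank else c (t * 2 ^ N + (k + 1)))
    rw [show (t + 1) * 2 ^ N + k = t * 2 ^ N + k + 2 ^ N by ring, hnext, hleft t k hk,
      hright t k hk]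

end IsLocallyConsistent

end CellRule

/-! ## Words accepted by the automaton -/

theorem eq_add_of_mod_eq {K q q' : ℕ} (hmod : q % K = q' % K) (hlt : q < q')
    (hlt' : q' < q + 2 * K) : q' = q + K := by
  obtain ⟨m, hm⟩ := (Nat.modEq_iff_dvd' hlt.le).1 hmod
  rcases m with _ | _ | m
  · omega
  · omega
  · have : K * (m + 1 + 1) = K * m + 2 * K := by ring
    omega

/-- A walk from `q + 1` that switches from `W` to `L` at a multiple of `K`, and cannot pass another
multiple of `K`, stops before `q + 2 * K`. -/
theorem false_of_walk {K q : ℕ} (hK : 0 < K) {W L : ℕ → Prop} (hq : W (q + 1))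
    (hW : ∀ p, q < p → p < q + 2 * K → W p → if K ∣ p then L (p + 1) else W (p + 1))
    (hL : ∀ p, q < p → p < q + 2 * K → L p → L (p + 1)) (hdvd : ∀ p, K ∣ p → ¬L p) : False := by
  set m := K * (q / K + 1) with hm
  have hmod := Nat.div_add_mod q K
  have hlt := Nat.mod_lt q hK
  rw [Nat.mul_add_one] at hm
  have hfirst : ∀ p, q + 1 ≤ p → p ≤ m → W p := by
    refine fun p hp => Nat.le_induction (fun _ => hq) (fun p hp ih hpm => ?_) p hp
    have hstep := hW p hp (by omega) (ih (by omega))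
    rwa [if_neg] at hstep
    rintro ⟨d, rfl⟩
    have := Nat.lt_of_mul_lt_mul_left (show K * (q / K) < K * d by omega)
    have := Nat.mul_le_mul_left K (show q / K + 1 ≤ d from this)
    omega
  have hsecond : ∀ p, m + 1 ≤ p → p ≤ m + K → L p := by
    refine fun p hp => Nat.le_induction (fun _ => ?_) (fun p hp ih hpm => ?_) p hp
    · have hstep := hW m (by omega) (by omega) (hfirst m (by omega) le_rfl)
      rwa [if_pos ⟨_, rfl⟩] at hstep
    · exact hL p (by omega) (by omega) (ih (by omega))
  exact hdvd (m + K) (Nat.dvd_add ⟨_, rfl⟩ dvd_rfl) (hsecond _ (by omega) le_rfl)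

namespace CellRule

open Letter
open PosBool (ofProp sat_ofProp)

variable {A : Type} {R : CellRule A} {x : List A} {N : ℕ} {σ : DataWord R.Letter}
  {V : ℕ → Ctrl R.Letter R.Γ → ℕ → σ.Datum → Prop} {l c r : ℕ → R.Γ} {D : σ.Datum}

theorem IsCellSequence.keep_bits {a : ℕ → R.Letter} (ha : IsCellSequence N a l c r) {q : ℕ}
    {P : ℕ → Prop} (hP : ∀ i u, a i = .inr u → P i → P (i + 1)) (h : P (q * (N + 1) + 1)) :
    P ((q + 1) * (N + 1)) := by
  have hkeep : ∀ j ≤ N, P (q * (N + 1) + 1 + j) := by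
    intro j hj
    induction j with
    | zero => exact h
    | succ j ih => exact hP _ _ (ha.bit q j hj) (ih (by omega))
  have hlast := hkeep N le_rfl
  rwa [show q * (N + 1) + 1 + N = (q + 1) * (N + 1) by ring] at hlast

namespace Compatible

theorem zero (hV : R.Compatible x N σ V) {J i : ℕ} (hJ : J ≤ N) (h : V J .zero i D) :
    ∀ j < J, HasBit false (σ.letter (i + j)) := by
  induction J generalizing i with
  | zero => intro j hj; omega
  | succ J ih =>
    have hstep := hV _ (by omega) _ _ _ h
    rw [kind_of_pos J.succ_pos hJ] at hstep
    rintro (_ | j) hj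
    · exact (sat_ofProp _ _ _).1 hstep.1
    · have hbit := ih (by omega) hstep.2 j (by omega)
      rwa [Nat.add_right_comm, Nat.add_assoc] at hbit

theorem check (hV : R.Compatible x N σ V) {J i : ℕ} {b : Bool} (hJ : J ≤ N)
    (h : V J (.check b) i D) : HasBit b (σ.letter (i + J)) := by
  induction J generalizing i with
  | zero => exact (sat_ofProp _ _ _).1 (hV _ (by omega) _ _ _ h)
  | succ J ih =>
    have hstep := hV _ (by omega) _ _ _ h
    rw [kind_of_pos J.succ_pos hJ] at hstep
    have hbit := ih (by omega) hstep
    rwa [Nat.add_right_comm, Nat.add_assoc] at hbit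

theorem dist (hV : R.Compatible x N σ V) {J i : ℕ} {a : R.Letter} (hJ : J ≤ N)
    (h : V J (.dist a) i D) : Shift a (σ.letter (i + J)) := by
  induction J generalizing i with
  | zero => exact (sat_ofProp _ _ _).1 (hV _ (by omega) _ _ _ h)
  | succ J ih =>
    have hstep := hV _ (by omega) _ _ _ h
    rw [kind_of_pos J.succ_pos hJ] at hstep
    have hshift := ih (by omega) hstep
    rwa [Nat.add_right_comm, Nat.add_assoc] at hshift

theorem sat_mainRule (hV : R.Compatible x N σ V) (h0 : V 0 .start 0 (σ.cls 0)) (i : ℕ) :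
    (R.mainRule (σ.letter i)).Sat {s | V (s.1.val N 0) s.2 (i + 1) (σ.cls 0)}
      {s | V (s.1.val N 0) s.2 (i + 1) (σ.cls i)} := by
  induction i with
  | zero => exact (hV _ (by omega) _ _ _ h0).2.2.2
  | succ i ih => exact hV 0 (by omega) .main _ _ ih.2.1

theorem isLocallyConsistent (hV : R.Compatible x N σ V) (h0 : V 0 .start 0 (σ.cls 0)) :
    IsLocallyConsistent N σ.letter where
  isStart := (sat_ofProp _ _ _).1 (hV 0 (by omega) _ _ _ h0).1
  zero := by simpa only [Nat.zero_add] using hV.zero le_rfl (hV 0 (by omega) _ _ _ h0).2.1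
  valid i := (sat_ofProp _ _ _).1 (hV.sat_mainRule h0 i).1
  adj i := (sat_ofProp _ _ _).1 (hV 0 (by omega) _ _ _ (hV.sat_mainRule h0 i).2.2.1)
  shift i := hV.dist le_rfl (hV.sat_mainRule h0 i).2.2.2.1

theorem cell (hV : R.Compatible x N σ V) (h0 : V 0 .start 0 (σ.cls 0))
    (ha : IsCellSequence N σ.letter l c r) (q : ℕ) :
    V 0 .addr (q * (N + 1) + 1) (σ.cls (q * (N + 1))) ∧
      V 0 (.wait (R.next (l q) (c q) (r q))) (q * (N + 1) + 1) (σ.cls (q * (N + 1))) := by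
  have hspawn := (hV.sat_mainRule h0 (q * (N + 1))).2.2.2.2
  rw [ha.cell] at hspawn
  exact hspawn

theorem watch (hV : R.Compatible x N σ V) {J i i' : ℕ} {b : Bool} (hJ : J ≤ N)
    (h : V J (.watch b) i D) (hi : i ≤ i') (hcell : IsCell (σ.letter i')) (hD : D = σ.cls i') :
    HasBit b (σ.letter (i' + 1 + J)) := by
  have hkeep : V J (.watch b) i' D :=
    Nat.le_induction h (fun k _ ih => (hV _ (by omega) _ _ _ ih).1) i' hi
  have hcheck := (hV _ (by omega) _ _ _ hkeep).2
  rw [if_pos ⟨hcell, by simpa using hD⟩] at hcheck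
  exact hV.check hJ hcheck

theorem addr (hV : R.Compatible x N σ V) (ha : IsCellSequence N σ.letter l c r) {q : ℕ}
    (h : V 0 .addr (q * (N + 1) + 1) D) {j : ℕ} (hj : j < N) :
    V j (.watch (q.testBit j)) (q * (N + 1) + 1 + j + 1) D := by
  have hstep (j : ℕ) (hj : j < N) (h : V j .addr (q * (N + 1) + 1 + j) D) :
      V j (.watch (q.testBit j)) (q * (N + 1) + 1 + j + 1) D ∧
        V (j + 1) .addr (q * (N + 1) + 1 + (j + 1)) D := by
    have hrule := hV j (by omega) _ _ _ h
    rw [ha.bit q j hj] at hrule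
    have hsucc : Ref.succ.val N j = j + 1 := min_eq_left (by omega)
    suffices V j (.watch (q.testBit j)) (q * (N + 1) + 1 + j + 1) D ∧
        V (Ref.succ.val N j) .addr (q * (N + 1) + 1 + j + 1) D by rwa [hsucc] at this
    rcases Nat.eq_zero_or_pos j with rfl | hpos
    · exact hrule
    · rw [kind_of_pos hpos hj.le] at hrule
      exact hrule
  have hall (j : ℕ) (hj : j ≤ N) : V j .addr (q * (N + 1) + 1 + j) D := by
    induction j with
    | zero => exact h
    | succ j ih => exact (hstep j hj (ih (by omega))).2
  exact (hstep j hj (hall j hj.le)).1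

theorem mod_eq_of_cls_eq (hV : R.Compatible x N σ V) (h0 : V 0 .start 0 (σ.cls 0))
    (ha : IsCellSequence N σ.letter l c r) {q q' : ℕ} (hq : q < q')
    (hD : σ.cls (q * (N + 1)) = σ.cls (q' * (N + 1))) : q % 2 ^ N = q' % 2 ^ N := by
  refine mod_two_pow_eq_of_testBit fun j hj => ?_
  have hwatch := hV.addr ha (hV.cell h0 ha q).1 hj
  have hle : (q + 1) * (N + 1) ≤ q' * (N + 1) := Nat.mul_le_mul_right _ hq
  have hlast : (q + 1) * (N + 1) = q * (N + 1) + 1 + N := by ring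
  have hbit := hV.watch hj.le hwatch (i' := q' * (N + 1)) (by omega) (by simp [ha.cell, IsCell]) hD
  rw [ha.bit q' j hj] at hbit
  exact hbit.symm

theorem wait_next_cell (hV : R.Compatible x N σ V) (ha : IsCellSequence N σ.letter l c r) {γ : R.Γ}
    {q : ℕ} (h : V 0 (.wait γ) (q * (N + 1) + 1) D) : V 0 (.wait γ) ((q + 1) * (N + 1)) D := by
  refine ha.keep_bits (P := fun i => V 0 (.wait γ) i D) (fun i u hu hi => ?_) h
  have hrule := hV 0 (by omega) _ _ _ hi
  rwa [hu] at hrule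

theorem waitLate_next_cell (hV : R.Compatible x N σ V) (ha : IsCellSequence N σ.letter l c r)
    {γ : R.Γ} {q : ℕ} (h : V 0 (.waitLate γ) (q * (N + 1) + 1) D) :
    V 0 (.waitLate γ) ((q + 1) * (N + 1)) D := by
  refine ha.keep_bits (P := fun i => V 0 (.waitLate γ) i D) (fun i u hu hi => ?_) h
  have hrule := hV 0 (by omega) _ _ _ hi
  rwa [hu] at hrule

theorem wait_cell (hV : R.Compatible x N σ V) (ha : IsCellSequence N σ.letter l c r) {γ : R.Γ}
    {q : ℕ} (hγ : D = σ.cls (q * (N + 1)) → c q ≠ γ) (h : V 0 (.wait γ) (q * (N + 1)) D) :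
    if 2 ^ N ∣ q then V 0 (.waitLate γ) ((q + 1) * (N + 1)) D
      else V 0 (.wait γ) ((q + 1) * (N + 1)) D := by
  have hrule := hV 0 (by omega) _ _ _ h
  rw [ha.cell] at hrule
  by_cases hD : D = σ.cls (q * (N + 1))
  · simp only [rule, hD, decide_true, if_true, sat_ofProp] at hrule
    exact absurd hrule (hγ hD)
  · simp only [rule, hD, decide_false, Bool.false_eq_true, if_false, decide_eq_true_eq] at hrule
    split_ifs at hrule ⊢
    · exact hV.waitLate_next_cell ha hrule
    · exact hV.wait_next_cell ha hrule

theorem not_dvd_of_waitLate (hV : R.Compatible x N σ V) (ha : IsCellSequence N σ.letter l c r)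
    {γ : R.Γ} {q : ℕ} (hq : 2 ^ N ∣ q) : ¬V 0 (.waitLate γ) (q * (N + 1)) D := by
  intro h
  have hrule := hV 0 (by omega) _ _ _ h
  rwa [ha.cell, decide_eq_true hq] at hrule

theorem waitLate_cell (hV : R.Compatible x N σ V) (ha : IsCellSequence N σ.letter l c r) {γ : R.Γ}
    {q : ℕ} (hγ : D = σ.cls (q * (N + 1)) → c q ≠ γ) (h : V 0 (.waitLate γ) (q * (N + 1)) D) :
    V 0 (.waitLate γ) ((q + 1) * (N + 1)) D := by
  have hdvd : ¬2 ^ N ∣ q := fun hq => hV.not_dvd_of_waitLate ha hq h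
  have hrule := hV 0 (by omega) _ _ _ h
  rw [ha.cell] at hrule
  by_cases hD : D = σ.cls (q * (N + 1))
  · simp only [rule, hD, decide_true, decide_eq_false hdvd, Bool.false_eq_true, if_false, if_true,
      sat_ofProp] at hrule
    exact absurd hrule (hγ hD)
  · simp only [rule, hD, decide_false, decide_eq_false hdvd, Bool.false_eq_true, if_false]
      at hrule
    exact hV.waitLate_next_cell ha hrule

theorem next_row (hV : R.Compatible x N σ V) (h0 : V 0 .start 0 (σ.cls 0))
    (ha : IsCellSequence N σ.letter l c r) (q : ℕ) :
    c (q + 2 ^ N) = R.next (l q) (c q) (r q) := by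
  set γ := R.next (l q) (c q) (r q)
  by_contra hne
  have hne' (p : ℕ) (hp : q < p) (hp' : p < q + 2 * 2 ^ N)
      (hD : σ.cls (q * (N + 1)) = σ.cls (p * (N + 1))) : c p ≠ γ := by
    rwa [eq_add_of_mod_eq (hV.mod_eq_of_cls_eq h0 ha hp hD) hp hp']
  exact false_of_walk (W := fun p => V 0 (.wait γ) (p * (N + 1)) (σ.cls (q * (N + 1))))
    (L := fun p => V 0 (.waitLate γ) (p * (N + 1)) (σ.cls (q * (N + 1)))) (K := 2 ^ N)
    (by positivity) (hV.wait_next_cell ha (hV.cell h0 ha q).2)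
    (fun p hp hp' => hV.wait_cell ha (hne' p hp hp'))
    (fun p hp hp' => hV.waitLate_cell ha (hne' p hp hp')) fun p => hV.not_dvd_of_waitLate ha

theorem init_next_cell (hV : R.Compatible x N σ V) (ha : IsCellSequence N σ.letter l c r) {J q : ℕ}
    (hJ : 0 < J) (hJ' : J ≤ N + 1) (h : V J .init (q * (N + 1) + 1) D) :
    V J .init ((q + 1) * (N + 1)) D := by
  refine ha.keep_bits (P := fun i => V J .init i D) (fun i u hu hi => ?_) h
  have hrule := hV J hJ' _ _ _ hi
  rw [hu] at hrule
  rcases kind_cases R x hJ' with ⟨rfl, -⟩ | ⟨-, -, hk⟩ | ⟨-, hk⟩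
  · omega
  · rwa [hk] at hrule
  · rwa [hk] at hrule

theorem init_cell (hV : R.Compatible x N σ V) (ha : IsCellSequence N σ.letter l c r)
    (hx : x.length ≤ N) {k : ℕ} (hk : k + 1 < 2 ^ N)
    (h : V (min (k + 1) (N + 1)) .init (k * (N + 1) + 1) D) :
    c (k + 1) = R.inpAt x[k]? ∧
      V (min (k + 1 + 1) (N + 1)) .init ((k + 1) * (N + 1) + 1) D := by
  have hrule := hV _ (min_le_right _ _) _ _ _
    (hV.init_next_cell ha (by omega) (min_le_right _ _) h)
  rw [ha.cell, decide_eq_false (Nat.not_dvd_of_pos_of_lt k.succ_pos hk)] at hrule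
  by_cases hkN : k < N
  · rw [min_eq_left (by omega), kind_of_pos k.succ_pos hkN] at hrule
    exact ⟨(sat_ofProp _ _ _).1 hrule.1, hrule.2⟩
  · rw [min_eq_right (by omega), kind_add_one] at hrule
    rw [min_eq_right (by omega), List.getElem?_eq_none (by omega)]
    exact ⟨(sat_ofProp _ _ _).1 hrule.1, hrule.2⟩

theorem first_row (hV : R.Compatible x N σ V) (h0 : V 0 .start 0 (σ.cls 0))
    (ha : IsCellSequence N σ.letter l c r) (hx : x.length ≤ N) (k : ℕ) (hk : k + 1 < 2 ^ N) :
    c (k + 1) = R.inpAt x[k]? := by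
  have hinit (k : ℕ) (hk : k < 2 ^ N) :
      V (min (k + 1) (N + 1)) .init (k * (N + 1) + 1) (σ.cls 0) := by
    induction k with
    | zero =>
      rw [min_eq_left (by omega), Nat.zero_mul]
      exact (hV 0 (by omega) _ _ _ h0).2.2.1
    | succ k ih => exact (hV.init_cell ha hx hk (ih (by omega))).2
  exact (hV.init_cell ha hx hk (hinit k (by omega))).1

end Compatible

theorem exists_isRun_of_accepts (hN : 0 < N) (hx : x.length ≤ N)
    (h : (R.automaton x N).Accepts σ) : ∃ row, R.IsRun x (2 ^ N) row := by
  obtain ⟨V, h0, hV⟩ := (R.automaton_accepts_iff x N σ).1 h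
  have hlocal := hV.isLocallyConsistent h0
  obtain ⟨l, c, r, ha⟩ := hlocal.exists_isCellSequence hN
  exact ⟨_, hlocal.isRun ha (hV.first_row h0 ha hx) (hV.next_row h0 ha)⟩

end CellRule

/-! ## Words that satisfy the sentence -/

namespace CellRule

open Letter SafetyLTL

variable {A : Type} {R : CellRule A} {x : List A} {N : ℕ} {σ : DataWord R.Letter}

/-- Cells with the same datum have the same address. -/
def AddressesAgree (N : ℕ) (σ : DataWord R.Letter) : Prop :=
  ∀ j < N, ∀ b p p', p < p' → IsCell (σ.letter p) → IsCell (σ.letter p') →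
    σ.cls p' = σ.cls p → HasBit b (σ.letter (p + 1 + j)) → HasBit b (σ.letter (p' + 1 + j))

/-- After every cell, `wait` holds with the datum of the cell in the register, for the contents of
the cell in the next row. -/
def IsTimeConsistent (σ : DataWord R.Letter) : Prop :=
  ∀ i f l c r, σ.letter i = .inl (f, l, c, r) →
    (R.wait (R.next l c r)).Sat σ (i + 1) (σ.cls i)

theorem sat_letterCondition (σ : DataWord R.Letter) (i : ℕ) (D : σ.Datum) :
    (R.letterCondition N (σ.letter i)).Sat σ i D ↔
      Valid (σ.letter i) ∧ Adj (σ.letter i) (σ.letter (i + 1)) ∧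
      Shift (σ.letter i) (σ.letter (i + 1 + N)) ∧
      ∀ f l c r, σ.letter i = .inl (f, l, c, r) →
        (R.wait (R.next l c r)).Sat σ (i + 1) (σ.cls i) := by
  refine and_congr ?_ (and_congr (sat_anyOf _ _ _ _)
    (and_congr ((sat_nexts _ _ _ _ _).trans (sat_anyOf _ _ _ _)) ?_))
  · split_ifs with h <;> simp only [Sat, h]
  · rcases σ.letter i with ⟨f, l, c, r⟩ | _
    · exact ⟨fun h _ _ _ _ heq => (by cases heq; exact h), fun h => h f l c r rfl⟩
    · exact ⟨fun _ _ _ _ _ heq => (nomatch heq), fun _ => trivial⟩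

theorem sat_sentence (x : List A) (N : ℕ) (σ : DataWord R.Letter) (D : σ.Datum) :
    (R.sentence x N).Sat σ 0 D ↔ IsLocallyConsistent N σ.letter ∧
      (R.readInputs x 0 N).Sat σ 1 D ∧ AddressesAgree N σ ∧ IsTimeConsistent σ := by
  have hzero := R.sat_zeroBits N σ 1 D
  have haddr : (R.sameAddress N).Sat σ 0 D ↔ AddressesAgree N σ := by
    simp only [sat_sameAddress, sat_sameBit, AddressesAgree]
  have hletters : (always (caseLetter (R.letterCondition N))).Sat σ 0 D ↔
      (∀ i, Valid (σ.letter i)) ∧ (∀ i, Adj (σ.letter i) (σ.letter (i + 1))) ∧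
      (∀ i, Shift (σ.letter i) (σ.letter (i + 1 + N))) ∧ IsTimeConsistent σ := by
    simp only [sat_always, sat_caseLetter, sat_letterCondition, Nat.zero_le, true_imp_iff,
      forall_and, IsTimeConsistent]
  rw [sentence, Sat, Sat, Sat, Sat, Sat, Sat, sat_anyOf, hzero, haddr, hletters]
  exact ⟨fun ⟨h₁, h₂, h₃, h₄, h₅, h₆, h₇, h₈⟩ => ⟨⟨h₁, h₂, h₅, h₆, h₇⟩, h₃, h₄, h₈⟩,
    fun ⟨⟨h₁, h₂, h₅, h₆, h₇⟩, h₃, h₄, h₈⟩ => ⟨h₁, h₂, h₃, h₄, h₅, h₆, h₇, h₈⟩⟩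

theorem exists_position (N i : ℕ) :
    ∃ q, i = q * (N + 1) ∨ ∃ j < N, i = q * (N + 1) + 1 + j := by
  have hdiv := Nat.div_add_mod' i (N + 1)
  have hmod : i % (N + 1) < N + 1 := Nat.mod_lt i N.succ_pos
  refine ⟨i / (N + 1), ?_⟩
  rcases h : i % (N + 1) with _ | j
  · exact .inl (by omega)
  · exact .inr ⟨j, by omega, by omega⟩

theorem mod_ne_of_lt {K q q' : ℕ} (h : q < q') (h' : q' < q + K) : q' % K ≠ q % K := by
  intro heq
  have := Nat.le_of_dvd (by omega) ((Nat.modEq_iff_dvd' h.le).1 heq.symm)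
  omega

/-- The data of cells are the addresses of the cells. -/
def DataAreAddresses (N : ℕ) (σ : DataWord R.Letter) : Prop :=
  ∀ q q', σ.cls (q * (N + 1)) = σ.cls (q' * (N + 1)) ↔ q % 2 ^ N = q' % 2 ^ N

namespace IsCellSequence

variable {l c r : ℕ → R.Γ} {D : σ.Datum}

theorem isLocallyConsistent {a : ℕ → R.Letter} (ha : IsCellSequence N a l c r) (hN : 0 < N)
    (hstart : c 0 = R.first) (hvalid : ∀ q, ¬R.bad (c q) ∧ (2 ^ N ∣ q → l q = R.first))
    (hshift : ∀ q, (2 ^ N ∣ q + 1 → r q = R.blank) ∧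
      (¬2 ^ N ∣ q + 1 → l (q + 1) = c q ∧ c (q + 1) = r q)) :
    IsLocallyConsistent N a where
  isStart := by
    have hcell := ha.cell 0
    rw [Nat.zero_mul] at hcell
    rw [hcell]
    exact ⟨decide_eq_true (dvd_zero _), hstart⟩
  zero j hj := by
    have hbit := ha.bit 0 j hj
    rw [Nat.zero_mul, Nat.zero_add] at hbit
    rw [hbit]
    exact Nat.zero_testBit j
  valid i := by
    obtain ⟨q, rfl | ⟨j, hj, rfl⟩⟩ := exists_position N i
    · rw [ha.cell]
      exact ⟨(hvalid q).1, fun hq => (hvalid q).2 (of_decide_eq_true hq)⟩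
    · rw [ha.bit q j hj]
      trivial
  adj i := by
    obtain ⟨q, rfl | ⟨j, hj, rfl⟩⟩ := exists_position N i
    · rw [ha.cell, ← Nat.add_zero (q * (N + 1) + 1), ha.bit q 0 hN]
      rfl
    · rw [ha.bit q j hj]
      rcases Nat.lt_or_ge (j + 1) N with hj' | hj'
      · rw [Nat.add_assoc _ j 1, ha.bit q (j + 1) hj']
        rfl
      · obtain rfl : N = j + 1 := by omega
        rw [show q * (j + 1 + 1) + 1 + j + 1 = (q + 1) * (j + 1 + 1) by ring, ha.cell]
        exact (lowOnes_eq_decide q (j + 1)).symm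
  shift i := by
    obtain ⟨q, rfl | ⟨j, hj, rfl⟩⟩ := exists_position N i
    · rw [show q * (N + 1) + 1 + N = (q + 1) * (N + 1) by ring, ha.cell, ha.cell]
      exact ⟨fun hq => (hshift q).1 (of_decide_eq_true hq),
        fun hq => (hshift q).2 (of_decide_eq_false hq)⟩
    · rw [show q * (N + 1) + 1 + j + 1 + N = (q + 1) * (N + 1) + 1 + j by ring, ha.bit q j hj,
        ha.bit (q + 1) j hj]
      exact testBit_add_one_eq_xor_lowOnes q j

theorem sat_release (ha : IsCellSequence N σ.letter l c r) {φ ψ : SafetyLTL R.Letter} {q q' : ℕ}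
    (hq : q < q') (hφ : φ.Sat σ (q' * (N + 1)) D)
    (hψ : ∀ p, q < p → p ≤ q' → ψ.Sat σ (p * (N + 1)) D) :
    (release φ (.or (anyOf IsBit) ψ)).Sat σ (q * (N + 1) + 1) D := by
  refine .inr ⟨q' * (N + 1), Nat.mul_lt_mul_of_pos_right hq N.succ_pos, hφ, fun k hk hk' => ?_⟩
  obtain ⟨p, rfl | ⟨j, hj, rfl⟩⟩ := exists_position N k
  · exact .inr (hψ p (Nat.lt_of_mul_lt_mul_right hk) (Nat.le_of_mul_le_mul_right hk' N.succ_pos))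
  · refine .inl ((sat_anyOf _ _ _ _).2 ?_)
    rw [ha.bit p j hj]
    trivial

theorem sat_here (ha : IsCellSequence N σ.letter l c r) (hσ : DataAreAddresses N σ) (q : ℕ) :
    (R.here (c (q + 2 ^ N))).Sat σ ((q + 2 ^ N) * (N + 1)) (σ.cls (q * (N + 1))) := by
  refine ⟨(sat_anyOf _ _ _ _).2 ?_, (hσ _ _).2 (Nat.add_mod_right q _)⟩
  rw [ha.cell]
  rfl

theorem sat_notUp (hσ : DataAreAddresses N σ) {p q : ℕ} (h : q < p) (h' : p < q + 2 ^ N) :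
    (notUp : SafetyLTL R.Letter).Sat σ (p * (N + 1)) (σ.cls (q * (N + 1))) :=
  fun heq => mod_ne_of_lt h h' ((hσ _ _).1 heq)

theorem isFirst_iff (ha : IsCellSequence N σ.letter l c r) (q : ℕ) :
    IsFirst (σ.letter (q * (N + 1))) ↔ 2 ^ N ∣ q := by
  rw [ha.cell]
  exact decide_eq_true_iff

theorem isLater_iff (ha : IsCellSequence N σ.letter l c r) (q : ℕ) :
    IsLater (σ.letter (q * (N + 1))) ↔ ¬2 ^ N ∣ q := by
  rw [ha.cell]
  exact decide_eq_false_iff_not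

theorem sat_waitLate (ha : IsCellSequence N σ.letter l c r) (hσ : DataAreAddresses N σ) {q q' : ℕ}
    (h : q < q') (h' : q' < q + 2 ^ N) (hq' : 2 ^ N ∣ q') :
    (R.waitLate (c (q + 2 ^ N))).Sat σ (q' * (N + 1) + 1) (σ.cls (q * (N + 1))) := by
  refine ha.sat_release h' (ha.sat_here hσ q) fun p hp hp' => ⟨(sat_anyOf _ _ _ _).2 ?_, ?_⟩
  · rw [ha.isLater_iff]
    intro hdvd
    have := Nat.le_of_dvd (by omega) (Nat.dvd_sub hdvd hq')
    omega
  · rcases hp'.eq_or_lt with rfl | hp'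
    · exact .inr (ha.sat_here hσ q)
    · exact .inl (sat_notUp hσ (by omega) hp')

theorem sat_wait (ha : IsCellSequence N σ.letter l c r) (hσ : DataAreAddresses N σ) (q : ℕ) :
    (R.wait (c (q + 2 ^ N))).Sat σ (q * (N + 1) + 1) (σ.cls (q * (N + 1))) := by
  refine ha.sat_release (Nat.lt_add_of_pos_right (by positivity)) (ha.sat_here hσ q)
    fun p hp hp' => ?_
  rcases hp'.eq_or_lt with rfl | hp'
  · exact .inl (ha.sat_here hσ q)
  · refine .inr ⟨sat_notUp hσ hp hp', ?_⟩
    by_cases hdvd : 2 ^ N ∣ p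
    · exact .inr ⟨(sat_anyOf _ _ _ _).2 ((ha.isFirst_iff p).2 hdvd),
        ha.sat_waitLate hσ hp hp' hdvd⟩
    · exact .inl ((sat_anyOf _ _ _ _).2 ((ha.isLater_iff p).2 hdvd))

theorem isTimeConsistent (ha : IsCellSequence N σ.letter l c r) (hσ : DataAreAddresses N σ)
    (hnext : ∀ q, c (q + 2 ^ N) = R.next (l q) (c q) (r q)) : IsTimeConsistent σ := by
  intro i f l' c' r' hi
  obtain ⟨q, rfl | ⟨j, hj, rfl⟩⟩ := exists_position N i
  · rw [ha.cell] at hi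
    cases hi
    rw [← hnext]
    exact ha.sat_wait hσ q
  · rw [ha.bit q j hj] at hi
    cases hi

theorem addressesAgree (ha : IsCellSequence N σ.letter l c r) (hσ : DataAreAddresses N σ) :
    AddressesAgree N σ := by
  have exists_of_isCell {i : ℕ} (hi : IsCell (σ.letter i)) : ∃ q, i = q * (N + 1) := by
    obtain ⟨q, rfl | ⟨j, hj, rfl⟩⟩ := exists_position N i
    · exact ⟨q, rfl⟩
    · rw [ha.bit q j hj] at hi
      exact hi.elim
  rintro j hj b p p' - hp hp' hcls hbit
  obtain ⟨q, rfl⟩ := exists_of_isCell hp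
  obtain ⟨q', rfl⟩ := exists_of_isCell hp'
  rw [ha.bit q j hj] at hbit
  rw [ha.bit q' j hj]
  have hmod := congrArg (Nat.testBit · j) ((hσ _ _).1 hcls)
  simp only [Nat.testBit_mod_two_pow, hj, decide_true, Bool.true_and] at hmod
  exact hmod.trans hbit

theorem sat_readBlanks (ha : IsCellSequence N σ.letter l c r) {q : ℕ} (hq : q < 2 ^ N)
    (hblank : ∀ p, q < p → p < 2 ^ N → c p = R.blank) :
    R.readBlanks.Sat σ (q * (N + 1) + 1) D := by
  have hfirst : (anyOf IsFirst).Sat σ (2 ^ N * (N + 1)) D :=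
    (sat_anyOf _ _ _ _).2 ((ha.isFirst_iff _).2 dvd_rfl)
  refine ha.sat_release hq hfirst fun p hp hp' => ?_
  rcases hp'.eq_or_lt with rfl | hp'
  · exact .inl hfirst
  · refine .inr ((sat_anyOf _ _ _ _).2 ?_)
    rw [ha.cell]
    exact hblank p hp hp'

theorem sat_readInput (ha : IsCellSequence N σ.letter l c r) {φ : SafetyLTL R.Letter} {q : ℕ}
    (hφ : φ.Sat σ ((q + 1) * (N + 1) + 1) D) :
    (R.readInput (c (q + 1)) φ).Sat σ (q * (N + 1) + 1) D := by
  refine ha.sat_release q.lt_succ_self ((sat_anyOf _ _ _ _).2 ?_) fun p hp hp' => ?_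
  · rw [ha.cell]
    trivial
  · obtain rfl : p = q + 1 := by omega
    refine .inr ⟨(sat_anyOf _ _ _ _).2 ?_, hφ⟩
    rw [ha.cell]
    rfl

theorem sat_readInputs (ha : IsCellSequence N σ.letter l c r) (hx : x.length ≤ N)
    (hinput : ∀ k, k + 1 < 2 ^ N → c (k + 1) = R.inpAt x[k]?) {j n : ℕ} (hj : j + n = N) :
    (R.readInputs x j n).Sat σ (j * (N + 1) + 1) D := by
  have hN : N < 2 ^ N := Nat.lt_two_pow_self
  induction n generalizing j with
  | zero =>
    refine ha.sat_readBlanks (by omega) fun p hp hp' => ?_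
    obtain ⟨k, rfl⟩ : ∃ k, p = k + 1 := ⟨p - 1, by omega⟩
    rw [hinput k hp', List.getElem?_eq_none (by omega)]
    rfl
  | succ n ih =>
    rw [readInputs, List.range'_succ, List.foldr_cons, ← hinput j (by omega)]
    exact ha.sat_readInput (ih (by omega))

theorem mem_lang_sentence (ha : IsCellSequence N σ.letter l c r) (hσ : DataAreAddresses N σ)
    (hx : x.length ≤ N) (hlocal : IsLocallyConsistent N σ.letter)
    (hinput : ∀ k, k + 1 < 2 ^ N → c (k + 1) = R.inpAt x[k]?)
    (hnext : ∀ q, c (q + 2 ^ N) = R.next (l q) (c q) (r q)) : σ ∈ (R.sentence x N).lang := by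
  intro D
  have hread := ha.sat_readInputs (D := D) hx hinput (Nat.zero_add N)
  rw [Nat.zero_mul] at hread
  exact (sat_sentence x N σ D).2
    ⟨hlocal, hread, ha.addressesAgree hσ, ha.isTimeConsistent hσ hnext⟩

end IsCellSequence

/-- The contents of the cell `q`, where the cells of the rows with indices `0, 1, …`, which have
length `K`, are numbered consecutively. -/
def contents (row : ℕ → ℕ → R.Γ) (K q : ℕ) : R.Γ := row (q / K) (q % K)

/-- The contents of the left neighbour of the cell `q`, or `first` at the start of a row. -/
def leftContents (row : ℕ → ℕ → R.Γ) (K q : ℕ) : R.Γ :=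
  if K ∣ q then R.first else row (q / K) (q % K - 1)

/-- The contents of the right neighbour of the cell `q`, or `blank` at the end of a row. -/
def rightContents (row : ℕ → ℕ → R.Γ) (K q : ℕ) : R.Γ :=
  if K ∣ q + 1 then R.blank else row (q / K) (q % K + 1)

/-- The data word for a space-time diagram on `2 ^ N` cells. The datum of a cell is its index in its
row. -/
def wordOf (row : ℕ → ℕ → R.Γ) (N : ℕ) : DataWord R.Letter where
  letter i :=
    let q := i / (N + 1)
    match i % (N + 1) with
    | 0 => .inl (decide (2 ^ N ∣ q), leftContents row (2 ^ N) q, contents row (2 ^ N) q,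
        rightContents row (2 ^ N) q)
    | j + 1 => .inr (q.testBit j, lowOnes q j)
  sim := Setoid.ker fun i => i % (2 ^ N * (N + 1))

section Rows

variable {row : ℕ → ℕ → R.Γ}

theorem isCellSequence_wordOf (row : ℕ → ℕ → R.Γ) (N : ℕ) :
    IsCellSequence N (wordOf row N).letter (leftContents row (2 ^ N)) (contents row (2 ^ N))
      (rightContents row (2 ^ N)) where
  cell q := by simp only [wordOf, Nat.mul_mod_left, Nat.mul_div_cancel q N.succ_pos]
  bit q j hj := by
    have hmod : (q * (N + 1) + 1 + j) % (N + 1) = j + 1 := by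
      rw [Nat.add_assoc, Nat.mul_add_mod', Nat.mod_eq_of_lt (by omega), Nat.add_comm]
    have hdiv : (q * (N + 1) + 1 + j) / (N + 1) = q := by
      rw [Nat.add_assoc, Nat.mul_comm, Nat.mul_add_div (by omega), Nat.div_eq_of_lt (by omega),
        Nat.add_zero]
    simp only [wordOf, hmod, hdiv]

theorem dataAreAddresses_wordOf (row : ℕ → ℕ → R.Γ) (N : ℕ) :
    DataAreAddresses N (wordOf row N) := by
  intro q q'
  rw [DataWord.cls, DataWord.cls, Quotient.eq]
  change q * (N + 1) % (2 ^ N * (N + 1)) = q' * (N + 1) % (2 ^ N * (N + 1)) ↔ _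
  rw [Nat.mul_mod_mul_right, Nat.mul_mod_mul_right]
  exact Nat.mul_left_inj N.succ_ne_zero

theorem dvd_add_one_iff_mod {K q : ℕ} (hK : 0 < K) : K ∣ q + 1 ↔ q % K + 1 = K := by
  have hlt := Nat.mod_lt q hK
  rw [Nat.dvd_iff_mod_eq_zero, ← Nat.mod_add_mod]
  constructor
  · intro h
    by_contra hne
    rw [Nat.mod_eq_of_lt (by omega)] at h
    omega
  · intro h
    rw [h, Nat.mod_self]

theorem contents_add_one {K q : ℕ} (hK : 0 < K) (h : ¬K ∣ q + 1) :
    leftContents row K (q + 1) = contents row K q ∧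
      contents row K (q + 1) = rightContents row K q := by
  have hlt := Nat.mod_lt q hK
  have hmod : (q + 1) % K = q % K + 1 := by
    rw [← Nat.mod_add_mod, Nat.mod_eq_of_lt]
    rw [dvd_add_one_iff_mod hK] at h
    omega
  simp only [leftContents, contents, rightContents, if_neg h, Nat.succ_div_of_not_dvd h, hmod,
    Nat.add_sub_cancel, and_self]

theorem IsRun.contents_add {K : ℕ} (hK : 0 < K) (hrow : R.IsRun x K row) (q : ℕ) :
    contents row K (q + K) =
      R.next (leftContents row K q) (contents row K q) (rightContents row K q) := by
  rw [contents, Nat.add_mod_right, Nat.add_div_right q hK,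
    (hrow.2 _ _ (Nat.mod_lt q hK)).2]
  simp only [leftContents, contents, rightContents, Nat.dvd_iff_mod_eq_zero (n := q),
    dvd_add_one_iff_mod hK]

theorem IsRun.contents_eq_initial {K k : ℕ} (hrow : R.IsRun x K row) (hk : k < K) :
    contents row K k = R.initial x k := by
  rw [contents, Nat.div_eq_of_lt hk, Nat.mod_eq_of_lt hk, hrow.1 k hk]

theorem wordOf_mem_lang_sentence (hN : 0 < N) (hx : x.length ≤ N) (hrow : R.IsRun x (2 ^ N) row) :
    wordOf row N ∈ (R.sentence x N).lang := by
  have hK : 0 < 2 ^ N := by positivity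
  have ha := isCellSequence_wordOf row N
  have hlocal : IsLocallyConsistent N (wordOf row N).letter :=
    ha.isLocallyConsistent hN (hrow.contents_eq_initial hK)
      (fun q => ⟨(hrow.2 _ _ (Nat.mod_lt q hK)).1, fun hq => if_pos hq⟩)
      fun q => ⟨fun hq => if_pos hq, contents_add_one hK⟩
  exact ha.mem_lang_sentence (dataAreAddresses_wordOf row N) hx hlocal
    (fun _ hk => hrow.contents_eq_initial hk) (hrow.contents_add hK)

end Rows

end CellRule

/-! ## The automaton accepts the words that satisfy the sentence -/

namespace CellRule

open Letter SafetyLTL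
open PosBool (ofProp sat_ofProp)

variable {A : Type} {R : CellRule A} {x : List A} {N J i : ℕ} {σ : DataWord R.Letter}
  {D : σ.Datum}

/-- The condition that is checked from the state with control state `q` and value `J` of the
counter, at position `i` with `D` in the register. The guards `J ≤ N` are there since the automaton
accepts from `zero`, `check b` and `dist a` with the value `N + 1`, which do not occur in runs. -/
def Intended (x : List A) (N : ℕ) (σ : DataWord R.Letter) (J : ℕ) :
    Ctrl R.Letter R.Γ → ℕ → σ.Datum → Prop
  | .start, i, D => J = 0 ∧ i = 0 ∧ D = σ.cls 0
  | .main, _, _ => True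
  | .zero, i, _ => J ≤ N → ∀ j < J, HasBit false (σ.letter (i + j))
  | .init, i, D => 0 < J ∧ (R.readInputs x (J - 1) (N + 1 - J)).Sat σ i D
  | .addr, i, D => ∃ p, IsCell (σ.letter p) ∧ D = σ.cls p ∧ i = p + 1 + J
  | .watch b, i, D => J < N ∧ ∃ p, IsCell (σ.letter p) ∧ D = σ.cls p ∧ p < i ∧
      HasBit b (σ.letter (p + 1 + J))
  | .check b, i, _ => J ≤ N → HasBit b (σ.letter (i + J))
  | .dist a, i, _ => J ≤ N → Shift a (σ.letter (i + J))
  | .adj a, i, _ => Adj a (σ.letter i)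
  | .wait γ, i, D => (R.wait γ).Sat σ i D
  | .waitLate γ, i, D => (R.waitLate γ).Sat σ i D

open Classical in
/-- The transition formula of a state holds if its atoms stand for the intended conditions. -/
def IntendedStep (x : List A) (N : ℕ) (σ : DataWord R.Letter) (J : ℕ) (q : Ctrl R.Letter R.Γ)
    (i : ℕ) (D : σ.Datum) : Prop :=
  (R.rule (R.kind x N J) q (σ.letter i) (decide (D = σ.cls i))).Sat
    {s | Intended x N σ (s.1.val N J) s.2 (i + 1) D}
    {s | Intended x N σ (s.1.val N J) s.2 (i + 1) (σ.cls i)}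

theorem sat_of_sat_release_at_cell {φ ψ : SafetyLTL R.Letter}
    (h : (release φ (.or (anyOf IsBit) ψ)).Sat σ i D) (hcell : IsCell (σ.letter i)) :
    ψ.Sat σ i D :=
  ((sat_release_iff _ _ _ _ _).1 h).1.resolve_left fun hbit =>
    (isBit_iff_not_isCell _).1 ((sat_anyOf _ _ _ _).1 hbit) hcell

theorem sat_release_succ {φ ψ : SafetyLTL R.Letter} (h : (release φ ψ).Sat σ i D)
    (hφ : ¬φ.Sat σ i D) : (release φ ψ).Sat σ (i + 1) D :=
  ((sat_release_iff _ _ _ _ _).1 h).2.resolve_left hφ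

theorem readInputs_succ (R : CellRule A) (x : List A) (j n : ℕ) :
    R.readInputs x j (n + 1) = R.readInput (R.inpAt x[j]?) (R.readInputs x (j + 1) n) := by
  rw [readInputs, List.range'_succ, List.foldr_cons, readInputs]

theorem sat_mainRule_intended (hlocal : IsLocallyConsistent N σ.letter) (htime : IsTimeConsistent σ)
    (J i : ℕ) (D : σ.Datum) :
    (R.mainRule (σ.letter i)).Sat {s | Intended x N σ (s.1.val N J) s.2 (i + 1) D}
      {s | Intended x N σ (s.1.val N J) s.2 (i + 1) (σ.cls i)} := by
  refine ⟨(sat_ofProp _ _ _).2 (hlocal.valid i), trivial, hlocal.adj i, fun _ => hlocal.shift i, ?_⟩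
  rcases hl : σ.letter i with ⟨f, l, c, r⟩ | _
  · exact ⟨⟨i, by rw [hl]; trivial, rfl, rfl⟩, htime i f l c r hl⟩
  · trivial

theorem intendedStep_start (hlocal : IsLocallyConsistent N σ.letter) (htime : IsTimeConsistent σ)
    (hread : (R.readInputs x 0 N).Sat σ 1 (σ.cls 0)) (h : Intended x N σ J .start i D) :
    IntendedStep x N σ J .start i D := by
  obtain ⟨rfl, rfl, rfl⟩ := h
  exact ⟨(sat_ofProp _ _ _).2 hlocal.isStart, fun _ => hlocal.zero, ⟨Nat.one_pos, hread⟩,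
    sat_mainRule_intended hlocal htime _ _ _⟩

theorem intendedStep_zero (hJ : J ≤ N + 1) (h : Intended x N σ J .zero i D) :
    IntendedStep x N σ J .zero i D := by
  rw [IntendedStep]
  rcases kind_cases R x hJ with ⟨-, hk⟩ | ⟨hpos, hJN, hk⟩ | ⟨-, hk⟩ <;> rw [hk]
  · trivial
  · refine ⟨(sat_ofProp _ _ _).2 (h hJN 0 hpos), fun _ j hj => ?_⟩
    rw [Nat.add_assoc, Nat.add_comm 1]
    exact h hJN (j + 1) (Nat.add_lt_of_lt_sub hj)
  · trivial

theorem intendedStep_init_of_le (hpos : 0 < J) (hJ : J ≤ N) (h : Intended x N σ J .init i D) :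
    IntendedStep x N σ J .init i D := by
  have hread := h.2
  rw [show N + 1 - J = N - J + 1 by omega, readInputs_succ, Nat.sub_add_cancel hpos] at hread
  rw [IntendedStep, kind_of_pos hpos hJ]
  rcases hl : σ.letter i with ⟨_ | _, l, c, r⟩ | _
  · rcases sat_of_sat_release_at_cell hread (by rw [hl]; trivial) with hfirst | ⟨hholds, hnext⟩
    · rw [sat_anyOf, hl] at hfirst
      cases hfirst
    · rw [sat_anyOf, hl] at hholds
      have hsucc : Ref.succ.val N J = J + 1 := min_eq_left (by omega)
      refine ⟨(sat_ofProp _ _ _).2 hholds, ?_⟩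
      suffices Intended x N σ (Ref.succ.val N J) .init (i + 1) D from this
      rw [hsucc]
      refine ⟨J.succ_pos, ?_⟩
      rwa [Nat.add_sub_cancel, Nat.add_sub_add_right]
  · trivial
  · refine ⟨hpos, ?_⟩
    suffices (R.readInputs x (J - 1) (N + 1 - J)).Sat σ (i + 1) D from this
    rw [show N + 1 - J = N - J + 1 by omega, readInputs_succ, Nat.sub_add_cancel hpos]
    exact sat_release_succ hread (by rw [sat_anyOf, hl]; exact id)

theorem intendedStep_init_add_one (h : Intended x N σ (N + 1) .init i D) :
    IntendedStep x N σ (N + 1) .init i D := by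
  have hread : R.readBlanks.Sat σ i D := by simpa [readInputs] using h.2
  have intended_succ (hfirst : ¬IsFirst (σ.letter i)) :
      Intended x N σ (N + 1) .init (i + 1) D := by
    refine ⟨N.succ_pos, ?_⟩
    rw [Nat.sub_self]
    exact sat_release_succ hread (by rwa [sat_anyOf])
  rw [IntendedStep, kind_add_one]
  rcases hl : σ.letter i with ⟨_ | _, l, c, r⟩ | _ <;> rw [hl] at intended_succ
  · have hcell := sat_of_sat_release_at_cell hread (by rw [hl]; trivial)
    simp only [Sat, sat_anyOf, hl, IsFirst, Holds, Bool.false_eq_true, false_or] at hcell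
    exact ⟨(sat_ofProp _ _ _).2 hcell, intended_succ Bool.false_ne_true⟩
  · trivial
  · exact intended_succ id

theorem intendedStep_init (hJ : J ≤ N + 1) (h : Intended x N σ J .init i D) :
    IntendedStep x N σ J .init i D := by
  rcases hJ.eq_or_lt with rfl | hJ
  · exact intendedStep_init_add_one h
  · exact intendedStep_init_of_le h.1 (Nat.le_of_lt_succ hJ) h

theorem intended_watch_of_addr (hlocal : IsLocallyConsistent N σ.letter) {b e : Bool} (hJ : J ≤ N)
    (h : Intended x N σ J .addr i D) (hl : σ.letter i = .inr (b, e)) :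
    Intended x N σ J (.watch b) (i + 1) D ∧
      Intended x N σ (min (J + 1) (N + 1)) .addr (i + 1) D := by
  obtain ⟨p, hcell, rfl, rfl⟩ := h
  have hlt : J < N := by
    refine hJ.lt_of_ne fun hJN => ?_
    have hshift := hlocal.shift p
    rw [← hJN, hl] at hshift
    rcases hp : σ.letter p with _ | _ <;> rw [hp] at hshift hcell
    · exact hshift
    · exact hcell
  exact ⟨⟨hlt, p, hcell, rfl, by omega, by rw [hl]; rfl⟩, p, hcell, rfl, by omega⟩

theorem intendedStep_addr (hlocal : IsLocallyConsistent N σ.letter) (hJ : J ≤ N + 1)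
    (h : Intended x N σ J .addr i D) : IntendedStep x N σ J .addr i D := by
  rw [IntendedStep]
  rcases hl : σ.letter i with _ | ⟨b, e⟩
  · rcases kind_cases R x hJ with ⟨-, hk⟩ | ⟨-, -, hk⟩ | ⟨-, hk⟩ <;> rw [hk] <;> trivial
  · rcases kind_cases R x hJ with ⟨hzero, hk⟩ | ⟨-, hJN, hk⟩ | ⟨-, hk⟩ <;> rw [hk]
    · have hJN : J ≤ N := by omega
      exact intended_watch_of_addr hlocal hJN h hl
    · exact intended_watch_of_addr hlocal hJN h hl
    · trivial

theorem intendedStep_watch (hagree : AddressesAgree N σ) {b : Bool}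
    (h : Intended x N σ J (.watch b) i D) : IntendedStep x N σ J (.watch b) i D := by
  obtain ⟨hJ, p, hcell, rfl, hpi, hbit⟩ := h
  refine ⟨⟨hJ, p, hcell, rfl, by omega, hbit⟩, ?_⟩
  split_ifs with hi
  · have hcls : σ.cls p = σ.cls i := by simpa only [decide_eq_true_eq] using hi.2
    exact fun _ => hagree J hJ b p i hpi hcell hi.1 hcls.symm hbit
  · trivial

theorem intendedStep_check {b : Bool} (hJ : J ≤ N + 1) (h : Intended x N σ J (.check b) i D) :
    IntendedStep x N σ J (.check b) i D := by
  rw [IntendedStep]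
  rcases kind_cases R x hJ with ⟨rfl, hk⟩ | ⟨hpos, hJN, hk⟩ | ⟨-, hk⟩ <;> rw [hk]
  · exact (sat_ofProp _ _ _).2 (h N.zero_le)
  · intro _
    have hbit := h hJN
    rwa [show i + J = i + 1 + (J - 1) by omega] at hbit
  · trivial

theorem intendedStep_dist {a : R.Letter} (hJ : J ≤ N + 1) (h : Intended x N σ J (.dist a) i D) :
    IntendedStep x N σ J (.dist a) i D := by
  rw [IntendedStep]
  rcases kind_cases R x hJ with ⟨rfl, hk⟩ | ⟨hpos, hJN, hk⟩ | ⟨-, hk⟩ <;> rw [hk]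
  · exact (sat_ofProp _ _ _).2 (h N.zero_le)
  · intro _
    have hshift := h hJN
    rwa [show i + J = i + 1 + (J - 1) by omega] at hshift
  · trivial

theorem sat_here_iff (γ : R.Γ) (σ : DataWord R.Letter) (i : ℕ) (D : σ.Datum) :
    (R.here γ).Sat σ i D ↔ Holds γ (σ.letter i) ∧ σ.cls i = D :=
  and_congr (sat_anyOf _ _ _ _) Iff.rfl

theorem intendedStep_wait {γ : R.Γ} (h : Intended x N σ J (.wait γ) i D) :
    IntendedStep x N σ J (.wait γ) i D := by
  have hwait : (R.wait γ).Sat σ i D := h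
  have wait_succ (hhere : ¬(R.here γ).Sat σ i D) : (R.wait γ).Sat σ (i + 1) D :=
    sat_release_succ hwait hhere
  rw [sat_here_iff] at wait_succ
  rw [IntendedStep]
  rcases hl : σ.letter i with ⟨f, l, c, r⟩ | _ <;> rw [hl] at wait_succ
  · have hcell := sat_of_sat_release_at_cell hwait (by rw [hl]; trivial)
    simp only [Sat, sat_here_iff, sat_anyOf, hl, Holds, IsLater, IsFirst] at hcell
    by_cases hD : D = σ.cls i
    · simp only [hD, ne_eq, not_true_eq_false, and_true, false_and, or_false] at hcell
      simpa only [rule, hD, decide_true, if_true, sat_ofProp] using hcell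
    · simp only [Ne.symm hD, and_false, ne_eq, not_false_eq_true, true_and, false_or] at hcell
      simp only [rule, hD, decide_false, Bool.false_eq_true, if_false]
      cases f with
      | true => exact (hcell.resolve_left Bool.noConfusion).2
      | false => exact wait_succ fun hhere => hD hhere.2.symm
  · exact wait_succ And.left

theorem intendedStep_waitLate {γ : R.Γ} (h : Intended x N σ J (.waitLate γ) i D) :
    IntendedStep x N σ J (.waitLate γ) i D := by
  have hwait : (R.waitLate γ).Sat σ i D := h
  have waitLate_succ (hhere : ¬(R.here γ).Sat σ i D) : (R.waitLate γ).Sat σ (i + 1) D :=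
    sat_release_succ hwait hhere
  rw [sat_here_iff] at waitLate_succ
  rw [IntendedStep]
  rcases hl : σ.letter i with ⟨f, l, c, r⟩ | _ <;> rw [hl] at waitLate_succ
  · have hcell := sat_of_sat_release_at_cell hwait (by rw [hl]; trivial)
    simp only [Sat, sat_here_iff, sat_anyOf, hl, Holds, IsLater] at hcell
    obtain ⟨rfl, hcell⟩ := hcell
    by_cases hD : D = σ.cls i
    · simp only [hD, ne_eq, not_true_eq_false, and_true, false_or] at hcell
      simpa only [rule, hD, decide_true, Bool.false_eq_true, if_false, if_true, sat_ofProp]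
        using hcell
    · simp only [rule, hD, decide_false, Bool.false_eq_true, if_false]
      exact waitLate_succ fun hhere => hD hhere.2.symm
  · exact waitLate_succ And.left

theorem compatible_intended (hlocal : IsLocallyConsistent N σ.letter) (htime : IsTimeConsistent σ)
    (hread : (R.readInputs x 0 N).Sat σ 1 (σ.cls 0)) (hagree : AddressesAgree N σ) :
    R.Compatible x N σ (Intended x N σ) := by
  intro J hJ q i D h
  cases q with
  | start => exact intendedStep_start hlocal htime hread h
  | main => exact sat_mainRule_intended hlocal htime J i D
  | zero => exact intendedStep_zero hJ h
  | init => exact intendedStep_init hJ h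
  | addr => exact intendedStep_addr hlocal hJ h
  | watch b => exact intendedStep_watch hagree h
  | check b => exact intendedStep_check hJ h
  | dist a => exact intendedStep_dist hJ h
  | adj a => exact (sat_ofProp _ _ _).2 h
  | wait γ => exact intendedStep_wait h
  | waitLate γ => exact intendedStep_waitLate h

theorem automaton_accepts_of_mem_lang_sentence (h : σ ∈ (R.sentence x N).lang) :
    (R.automaton x N).Accepts σ := by
  obtain ⟨hlocal, hread, hagree, htime⟩ := (sat_sentence x N σ _).1 (h (σ.cls 0))
  exact (R.automaton_accepts_iff x N σ).2
    ⟨Intended x N σ, ⟨rfl, rfl, rfl⟩, compatible_intended hlocal htime hread hagree⟩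

end CellRule

/-! ## Generation of the sentences -/

namespace SafetyLTL

variable {X Y : Type}

/-- Renaming of letters. -/
def map (e : X → Y) : SafetyLTL X → SafetyLTL Y
  | .letter a => .letter (e a)
  | .top => .top
  | .bot => .bot
  | .and φ ψ => .and (φ.map e) (ψ.map e)
  | .or φ ψ => .or (φ.map e) (ψ.map e)
  | .next φ => .next (φ.map e)
  | .release φ ψ => .release (φ.map e) (ψ.map e)
  | .freeze φ => .freeze (φ.map e)
  | .up => .up
  | .notUp => .notUp

theorem isSentence_map (e : X → Y) (φ : SafetyLTL X) : (φ.map e).IsSentence ↔ φ.IsSentence := by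
  induction φ <;> simp_all [map, IsSentence]

end SafetyLTL

/-- Renaming of the letters of a data word. -/
def DataWord.map {X Y : Type} (e : X → Y) (σ : DataWord X) : DataWord Y where
  letter i := e (σ.letter i)
  sim := σ.sim

theorem DataWord.map_map_symm {X Y : Type} (e : X ≃ Y) (σ : DataWord X) :
    (σ.map e).map e.symm = σ := by
  simp only [DataWord.map, Equiv.symm_apply_apply]

namespace SafetyLTL

section Map

variable {X Y : Type}

theorem sat_map (e : X ≃ Y) (φ : SafetyLTL X) (σ : DataWord Y) (i : ℕ) (D : σ.Datum) :
    (φ.map e).Sat σ i D ↔ φ.Sat (σ.map e.symm) i D := by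
  induction φ generalizing i D with
  | letter a => simp only [map, Sat, DataWord.map, Equiv.symm_apply_eq]
  | top => rfl
  | bot => rfl
  | and φ ψ h₁ h₂ => exact and_congr (h₁ i D) (h₂ i D)
  | or φ ψ h₁ h₂ => exact or_congr (h₁ i D) (h₂ i D)
  | next _ h => exact h (i + 1) D
  | release φ ψ h₁ h₂ => simp only [map, Sat, h₁, h₂]
  | freeze _ h => exact h i _
  | up => rfl
  | notUp => rfl

theorem lang_map_nonempty (e : X ≃ Y) (φ : SafetyLTL X) :
    (φ.map e).lang.Nonempty ↔ φ.lang.Nonempty := by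
  constructor
  · rintro ⟨σ, hσ⟩
    exact ⟨σ.map e.symm, fun D => (sat_map e φ σ 0 D).1 (hσ D)⟩
  · rintro ⟨σ, hσ⟩
    rw [← σ.map_map_symm e] at hσ
    exact ⟨σ.map e, fun D => (sat_map e φ _ 0 D).2 (hσ D)⟩

end Map

section Encode

variable {X : Type} {m : ℕ} (e : X → Fin m)

/-- The string for a formula whose letters are numbered by `e`. -/
def encodeWith (φ : SafetyLTL X) : List LTLSym := (φ.map e).encodeFormula

theorem encodeWith_foldr {Y : Type} (F : Y → SafetyLTL X → SafetyLTL X) (pre : Y → List LTLSym)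
    (h : ∀ a φ, (F a φ).encodeWith e = pre a ++ φ.encodeWith e) (l : List Y) (φ : SafetyLTL X) :
    (l.foldr F φ).encodeWith e = l.flatMap pre ++ φ.encodeWith e := by
  induction l with
  | nil => rfl
  | cons a l ih => rw [List.foldr_cons, h, ih, List.flatMap_cons, List.append_assoc]

theorem encodeWith_caseList (F : X → SafetyLTL X) (l : List X) :
    (caseList F l).encodeWith e = l.flatMap (fun a =>
      .or :: .and :: ((SafetyLTL.letter a).encodeWith e ++ (F a).encodeWith e)) ++ [.bot] :=
  encodeWith_foldr e _ _ (fun a φ => by simp [encodeWith, map, encodeFormula]) l .bot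

theorem encodeWith_andRange (n : ℕ) (F : ℕ → SafetyLTL X) :
    (andRange n F).encodeWith e =
      (List.range n).flatMap (fun j => .and :: (F j).encodeWith e) ++ [.top] :=
  encodeWith_foldr e _ _ (fun _ _ => rfl) _ .top

theorem encodeWith_nexts (n : ℕ) (φ : SafetyLTL X) :
    (nexts n φ).encodeWith e = (List.replicate n [.next]).flatten ++ φ.encodeWith e := by
  induction n with
  | zero => rfl
  | succ n ih =>
    rw [List.replicate_succ, List.flatten_cons, List.append_assoc, ← ih]
    rfl

end Encode

end SafetyLTL

/-- The strings of the formulae `φ N j`, with letters numbered by `e`, can be generated. -/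
def GenerableFormula (A : Type) {X : Type} (B : ℕ) [NeZero B] {m : ℕ} (e : X → Fin m)
    (φ : ℕ → ℕ → SafetyLTL X) : Prop :=
  Generable A B fun N j => (φ N j).encodeWith e

namespace GenerableFormula

variable {A X : Type} {B m : ℕ} [NeZero B] {e : X → Fin m} {φ ψ : ℕ → ℕ → SafetyLTL X}

theorem const (φ : SafetyLTL X) : GenerableFormula A B e fun _ _ => φ := Generable.const _

theorem and (hφ : GenerableFormula A B e φ) (hψ : GenerableFormula A B e ψ) :
    GenerableFormula A B e fun N j => .and (φ N j) (ψ N j) :=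
  (hφ.append hψ).cons LTLSym.and

theorem or (hφ : GenerableFormula A B e φ) (hψ : GenerableFormula A B e ψ) :
    GenerableFormula A B e fun N j => .or (φ N j) (ψ N j) :=
  (hφ.append hψ).cons LTLSym.or

theorem next (hφ : GenerableFormula A B e φ) : GenerableFormula A B e fun N j => .next (φ N j) :=
  hφ.cons LTLSym.next

theorem freeze (hφ : GenerableFormula A B e φ) :
    GenerableFormula A B e fun N j => .freeze (φ N j) :=
  hφ.cons LTLSym.freeze

theorem always (hφ : GenerableFormula A B e φ) :
    GenerableFormula A B e fun N j => .always (φ N j) :=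
  (hφ.cons LTLSym.bot).cons LTLSym.release

theorem nexts_range (hφ : GenerableFormula A B e φ) :
    GenerableFormula A B e fun N j => .nexts N (φ N j) :=
  ((Generable.replicate_range _).append hφ).congr fun _ _ _ =>
    (SafetyLTL.encodeWith_nexts e _ _).symm

theorem nexts_counter (hφ : GenerableFormula A B e φ) :
    GenerableFormula A B e fun N j => .nexts j (φ N j) :=
  ((Generable.replicate_counter _).append hφ).congr fun _ _ _ =>
    (SafetyLTL.encodeWith_nexts e _ _).symm

theorem caseLetter [Fintype X] {F : X → ℕ → ℕ → SafetyLTL X}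
    (hF : ∀ a, GenerableFormula A B e (F a)) :
    GenerableFormula A B e fun N j => .caseLetter fun a => F a N j :=
  ((Generable.flatMap _ fun a _ => (((const (.letter a)).append (hF a)).cons _).cons _).append
    (Generable.const _)).congr fun _ _ _ => (SafetyLTL.encodeWith_caseList e _ _).symm

end GenerableFormula

namespace CellRule

open SafetyLTL Letter

variable {A : Type} (R : CellRule A) {B m : ℕ} [NeZero B] (e : R.Letter → Fin m)

theorem generableFormula_sameBit (b : Bool) :
    GenerableFormula A B e fun _ j => R.sameBit j b :=
  ((GenerableFormula.const _).or ((GenerableFormula.const _).nexts_counter.next.or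
    ((GenerableFormula.const _).or ((GenerableFormula.const .notUp).or
      (GenerableFormula.const _).nexts_counter.next)).always.next.freeze)).always

theorem generableFormula_letterCondition (a : R.Letter) :
    GenerableFormula A B e fun N _ => R.letterCondition N a :=
  (GenerableFormula.const _).and ((GenerableFormula.const _).next.and
    ((GenerableFormula.const _).nexts_range.next.and (GenerableFormula.const _)))

/-- The string for `readInput γ φ` up to the string for `φ`. -/
noncomputable def encodeReadInput (γ : R.Γ) : List LTLSym :=
  .release :: ((anyOf IsCell).encodeWith e ++ .or :: ((anyOf IsBit).encodeWith e ++
    .or :: ((anyOf IsFirst).encodeWith e ++ .and :: ((anyOf (Holds γ)).encodeWith e ++ [.next]))))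

theorem encodeWith_readInputs (x : List A) (N : ℕ) :
    (R.readInputs x 0 N).encodeWith e =
      (List.range N).flatMap (fun j => R.encodeReadInput e (R.inpAt x[j]?)) ++
        R.readBlanks.encodeWith e := by
  rw [List.range_eq_range']
  refine encodeWith_foldr e _ _ (fun j φ => ?_) _ _
  simp [encodeReadInput, readInput, encodeWith, SafetyLTL.map, encodeFormula]

theorem encode_map_sentence (x : List A) (N : ℕ) :
    ((R.sentence x N).map e).encode =
      (unary .tick .sep m ++ .and :: ((anyOf IsStart).encodeWith e ++ [.and, .next])) ++
      ((List.range N).flatMap (fun j => .and :: (nexts j (anyOf (HasBit false))).encodeWith e) ++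
      ([.top, .and, .next] ++
      ((List.range N).flatMap (fun j => R.encodeReadInput e (R.inpAt x[j]?)) ++
      (R.readBlanks.encodeWith e ++ [.and]) ++
      (List.range N).flatMap (fun j =>
        .and :: (SafetyLTL.and (R.sameBit j true) (R.sameBit j false)).encodeWith e) ++
      .top :: (always (caseLetter (R.letterCondition N))).encodeWith e))) := by
  have hsentence : ((R.sentence x N).map e).encode = unary .tick .sep m ++ (.and ::
      ((anyOf IsStart).encodeWith e ++ .and :: (.next :: (R.zeroBits N).encodeWith e ++
        .and :: (.next :: (R.readInputs x 0 N).encodeWith e ++ .and ::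
          ((R.sameAddress N).encodeWith e ++
            (always (caseLetter (R.letterCondition N))).encodeWith e))))) := rfl
  rw [hsentence, zeroBits, sameAddress, encodeWith_andRange, encodeWith_andRange,
    encodeWith_readInputs]
  simp only [List.append_assoc, List.cons_append, List.nil_append]

theorem generableFrom_sentence [Finite A] :
    GenerableFrom B fun x N => ((R.sentence x N).map e).encode := by
  have hinput : GenerableFrom (A := A) B fun x N =>
      (List.range N).flatMap fun j => R.encodeReadInput e (R.inpAt x[j]?) :=
    GenerableFrom.input_range (g := fun o _ _ => R.encodeReadInput e (R.inpAt o))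
      fun _ => .const _
  have hzero : GenerableFormula A B e fun _ j => nexts j (anyOf (HasBit false)) :=
    (GenerableFormula.const _).nexts_counter
  have hsame : GenerableFormula A B e fun _ j => .and (R.sameBit j true) (R.sameBit j false) :=
    (R.generableFormula_sameBit e true).and (R.generableFormula_sameBit e false)
  have hletter : GenerableFormula A B e fun N _ => always (caseLetter (R.letterCondition N)) :=
    (GenerableFormula.caseLetter (R.generableFormula_letterCondition e)).always
  simp only [encode_map_sentence]
  exact .generable_append (.const _) <| .range_append (hzero.cons _) <|
    .generable_append (.const _) <| ((hinput.append_generable (.const _)).append_range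
      (hsame.cons _)).append_generable (hletter.cons _)

end CellRule

/-! ## Generation of the automata -/

namespace SafetyARA

variable {X Y Q S : Type} (e : X ≃ Y) (g : Q ≃ S) (M : SafetyARA X Q)

/-- Renaming of letters and states. -/
def reindex : SafetyARA Y S where
  start := g M.start
  trans q a up := (M.trans (g.symm q) (e.symm a) up).map g

theorem reindex_accepts_iff (σ : DataWord Y) :
    (M.reindex e g).Accepts σ ↔ M.Accepts (σ.map e.symm) := by
  rw [accepts_iff_exists_predicate, accepts_iff_exists_predicate]
  constructor
  · rintro ⟨V, h0, h⟩
    refine ⟨fun q => V (g q), h0, fun q i D hV => ?_⟩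
    have hrule := h _ _ _ hV
    rw [rule, reindex, PosBool.sat_map, Equiv.symm_apply_apply] at hrule
    exact hrule
  · rintro ⟨V, h0, h⟩
    refine ⟨fun q => V (g.symm q), ?_, fun q i D hV => ?_⟩
    · change V (g.symm (g M.start)) _ _
      rwa [Equiv.symm_apply_apply]
    · rw [rule, reindex, PosBool.sat_map]
      simp only [Set.preimage_ofPred_eq, Equiv.symm_apply_apply]
      exact h _ _ _ hV

theorem lang_reindex_nonempty : (M.reindex e g).lang.Nonempty ↔ M.lang.Nonempty := by
  constructor
  · rintro ⟨σ, hσ⟩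
    exact ⟨σ.map e.symm, (reindex_accepts_iff e g M σ).1 hσ⟩
  · rintro ⟨σ, hσ⟩
    rw [← σ.map_map_symm e] at hσ
    exact ⟨σ.map e, (reindex_accepts_iff e g M _).2 hσ⟩

end SafetyARA

/-- A number `n N j` of copies of any given string can be generated. -/
def GenerableCount (A : Type) (B : ℕ) [NeZero B] (n : ℕ → ℕ → ℕ) : Prop :=
  ∀ ⦃O : Type⦄ (l : List O), Generable A B fun N j => (List.replicate (n N j) l).flatten

namespace GenerableCount

variable {A : Type} {B : ℕ} [NeZero B] {n n' : ℕ → ℕ → ℕ}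

theorem const (k : ℕ) : GenerableCount A B fun _ _ => k := fun _ _ => .const _

theorem range : GenerableCount A B fun N _ => N := fun _ => .replicate_range

theorem counter : GenerableCount A B fun _ j => j := fun _ => .replicate_counter

theorem congr (hn : GenerableCount A B n) (h : ∀ N, ∀ j < N, n N j = n' N j) :
    GenerableCount A B n' :=
  fun _ l => (hn l).congr fun N j hj => by rw [h N j hj]

theorem add (hn : GenerableCount A B n) (hn' : GenerableCount A B n') :
    GenerableCount A B fun N j => n N j + n' N j :=
  fun _ l => ((hn l).append (hn' l)).congr fun _ _ _ => by
    rw [List.replicate_add, List.flatten_append]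

theorem const_mul (k : ℕ) (hn : GenerableCount A B n) :
    GenerableCount A B fun N j => k * n N j := by
  induction k with
  | zero => exact (const 0).congr fun _ _ _ => (Nat.zero_mul _).symm
  | succ k ih => exact (ih.add hn).congr fun _ _ _ => (Nat.succ_mul _ _).symm

theorem unary {O : Type} (s t : O) (hn : GenerableCount A B n) :
    Generable A B fun N j => unary s t (n N j) :=
  ((hn [s]).append (.const [t])).congr fun _ _ _ => by
    rw [List.flatten_replicate_singleton, _root_.unary]

end GenerableCount

namespace CellRule.Ref

variable {A : Type} {B : ℕ} [NeZero B]

theorem generableCount_val_zero (r : Ref) : GenerableCount A B fun N _ => r.val N 0 := by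
  cases r with
  | max => exact .range
  | zero | pred | same => exact .const 0
  | one => exact .const 1
  | succ => exact (GenerableCount.const 1).congr fun N _ _ => (min_eq_left (by omega)).symm

theorem generableCount_val_counter_add_one (r : Ref) :
    GenerableCount A B fun N j => r.val N (j + 1) := by
  cases r with
  | max => exact .range
  | zero => exact .const 0
  | one => exact .const 1
  | pred => exact .counter
  | same => exact .add .counter (.const 1)
  | succ =>
    exact (GenerableCount.counter.add (.const 2)).congr fun N j hj => (min_eq_left (by omega)).symm

theorem generableCount_val_range_add_one (r : Ref) :
    GenerableCount A B fun N _ => r.val N (N + 1) := by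
  cases r with
  | max | pred => exact .range
  | zero => exact .const 0
  | one => exact .const 1
  | same => exact .add .range (.const 1)
  | succ =>
    exact (GenerableCount.range.add (.const 1)).congr fun N _ _ => (min_eq_right (by omega)).symm

end CellRule.Ref

theorem finRange_mul (n k : ℕ) : List.finRange (n * k) =
    (List.finRange n).flatMap fun i => (List.finRange k).map fun j => finProdFinEquiv (i, j) := by
  rw [← List.ofFn_id, List.ofFn_mul, List.flatMap, ← List.ofFn_eq_map]
  congr 2
  funext i
  rw [← List.ofFn_eq_map]
  congr 1
  funext j
  ext
  simp [Nat.add_comm, Nat.mul_comm]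

theorem flatMap_finRange_add_two {X : Type} (N : ℕ) (f : ℕ → List X) :
    (List.finRange (N + 2)).flatMap (fun J : Fin (N + 2) => f J) =
      f 0 ++ (List.range N).flatMap (fun j => f (j + 1)) ++ f (N + 1) := by
  have hrange : (List.finRange (N + 2)).flatMap (fun J : Fin (N + 2) => f J) =
      ((List.finRange (N + 2)).map Fin.val).flatMap f := by rw [List.flatMap_map]
  rw [hrange, List.map_coe_finRange_eq_range, List.range_succ, List.range_succ_eq_map]
  simp [List.flatMap_map]

namespace CellRule

variable {A : Type} (R : CellRule A) {m T : ℕ} (e : R.Letter ≃ Fin m)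
  (g : Ctrl R.Letter R.Γ ≃ Fin T)

/-- The string of a formula over references when the counter is `J`: the state with counter `J'`
and control state `q` has the number `g q + T * J'`. -/
def encodeRef (N J : ℕ) : PosBool (Ref × Ctrl R.Letter R.Γ) → List ARASym
  | .keep q => .keep :: unary .tick .sep (g q.2 + T * q.1.val N J)
  | .down q => .down :: unary .tick .sep (g q.2 + T * q.1.val N J)
  | .top => [.top]
  | .bot => [.bot]
  | .and φ ψ => .and :: (encodeRef N J φ ++ encodeRef N J ψ)
  | .or φ ψ => .or :: (encodeRef N J φ ++ encodeRef N J ψ)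

/-- The part of the transition table for the states with counter `J`, which is of the kind `k`. -/
noncomputable def encodeGroup (N J : ℕ) (k : CounterKind R.Γ) : List ARASym :=
  (List.finRange T).flatMap fun q => (List.finRange m).flatMap fun a =>
    R.encodeRef g N J (R.rule k (g.symm q) (e.symm a) true) ++
      R.encodeRef g N J (R.rule k (g.symm q) (e.symm a) false)

/-- Numbering of the states, grouped by the counter. -/
def stateEquiv (N : ℕ) : R.AState N ≃ Fin ((N + 2) * T) :=
  ((Equiv.refl _).prodCongr g).trans finProdFinEquiv

theorem encode_map_resolve (N : ℕ) (J : Fin (N + 2)) (φ : PosBool (Ref × Ctrl R.Letter R.Γ)) :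
    ((φ.map (R.resolve N J)).map (R.stateEquiv g N)).encode = R.encodeRef g N J φ := by
  induction φ with
  | keep q | down q => simp [PosBool.map, PosBool.encode, encodeRef, stateEquiv, resolve]
  | top | bot => rfl
  | and φ ψ h₁ h₂ | or φ ψ h₁ h₂ => simp [PosBool.map, PosBool.encode, encodeRef, h₁, h₂]

theorem encode_trans_reindex_automaton (x : List A) (N : ℕ) (J : Fin (N + 2)) (q : Fin T)
    (a : Fin m) (up : Bool) :
    (((R.automaton x N).reindex e (R.stateEquiv g N)).trans (finProdFinEquiv (J, q)) a up).encode =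
      R.encodeRef g N J (R.rule (R.kind x N J) (g.symm q) (e.symm a) up) := by
  have hstate : (R.stateEquiv g N).symm (finProdFinEquiv (J, q)) = (J, g.symm q) := by
    simp [stateEquiv]
  simp only [SafetyARA.reindex, hstate, automaton, encode_map_resolve]

theorem encode_reindex_automaton (x : List A) (N : ℕ) :
    ((R.automaton x N).reindex e (R.stateEquiv g N)).encode =
      (unary .tick .sep m ++ unary .tick .sep ((N + 2) * T) ++ unary .tick .sep (g .start) ++
        R.encodeGroup e g N 0 .low) ++
      (List.range N).flatMap (fun j => R.encodeGroup e g N (j + 1) (.mid (R.inpAt x[j]?))) ++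
      R.encodeGroup e g N (N + 1) .high := by
  have hstart : (((R.automaton x N).reindex e (R.stateEquiv g N)).start : ℕ) = g .start := by
    simp [SafetyARA.reindex, automaton, stateEquiv]
  have hmid : (List.range N).flatMap (fun j => R.encodeGroup e g N (j + 1) (R.kind x N (j + 1))) =
      (List.range N).flatMap fun j => R.encodeGroup e g N (j + 1) (.mid (R.inpAt x[j]?)) :=
    List.flatMap_congr fun j hj => by rw [kind, if_pos (List.mem_range.1 hj)]
  rw [SafetyARA.encode, finRange_mul, List.flatMap_assoc, hstart]
  simp only [List.flatMap_map, encode_trans_reindex_automaton]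
  have hgroups := flatMap_finRange_add_two N fun J => R.encodeGroup e g N J (R.kind x N J)
  rw [hmid, kind_add_one] at hgroups
  simp only [List.append_assoc, List.append_cancel_left_eq] at hgroups ⊢
  exact hgroups

variable {B : ℕ} [NeZero B]

theorem generable_encodeRef {J : ℕ → ℕ → ℕ}
    (hJ : ∀ r : Ref, GenerableCount A B fun N j => r.val N (J N j))
    (φ : PosBool (Ref × Ctrl R.Letter R.Γ)) :
    Generable A B fun N j => R.encodeRef g N (J N j) φ := by
  induction φ with
  | keep q | down q =>
    exact (((GenerableCount.const (g q.2)).add ((hJ q.1).const_mul T)).unary _ _).cons _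
  | top | bot => exact .const _
  | and φ ψ h₁ h₂ | or φ ψ h₁ h₂ => exact (h₁.append h₂).cons _

theorem generable_encodeGroup {J : ℕ → ℕ → ℕ}
    (hJ : ∀ r : Ref, GenerableCount A B fun N j => r.val N (J N j)) (k : CounterKind R.Γ) :
    Generable A B fun N j => R.encodeGroup e g N (J N j) k :=
  .flatMap _ fun _ _ => .flatMap _ fun _ _ =>
    (R.generable_encodeRef g hJ _).append (R.generable_encodeRef g hJ _)

theorem generableFrom_automaton [Finite A] :
    GenerableFrom B fun x N => ((R.automaton x N).reindex e (R.stateEquiv g N)).encode := by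
  have hlow : Generable A B fun N _ => R.encodeGroup e g N 0 .low :=
    R.generable_encodeGroup e g (J := fun _ _ => 0) Ref.generableCount_val_zero .low
  have hmid (γ : R.Γ) : Generable A B fun N j => R.encodeGroup e g N (j + 1) (.mid γ) :=
    R.generable_encodeGroup e g (J := fun _ j => j + 1) Ref.generableCount_val_counter_add_one _
  have hhigh : Generable A B fun N _ => R.encodeGroup e g N (N + 1) .high :=
    R.generable_encodeGroup e g (J := fun N _ => N + 1) Ref.generableCount_val_range_add_one .high
  have hstates : Generable A B fun N _ => unary ARASym.tick .sep (T * (N + 2)) :=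
    ((GenerableCount.range.add (.const 2)).const_mul T).unary _ _
  simp only [encode_reindex_automaton, Nat.mul_comm _ T]
  exact ((GenerableFrom.input_range fun o => hmid (R.inpAt o)).generable_append
    ((((Generable.const _).append hstates).append (.const _)).append hlow)).append_generable hhigh

end CellRule

/-! ## Hardness -/

theorem exists_eval_le_counterRange (p : Polynomial ℕ) :
    ∃ B, 1 < B ∧ ∀ n, p.eval n ≤ counterRange B n := by
  induction p using Polynomial.induction_on' with
  | add p q hp hq =>
    obtain ⟨B, hB, hp⟩ := hp
    obtain ⟨C, -, hq⟩ := hq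
    refine ⟨B + C, by omega, fun n => ?_⟩
    rw [Polynomial.eval_add]
    exact (Nat.add_le_add (hp n) (hq n)).trans
      (pow_add_pow_le B.zero_le C.zero_le (Nat.succ_ne_zero _))
  | monomial k a =>
    have hbase : 1 < (a + 2) * 2 ^ k := one_lt_mul_of_lt_of_le (by omega) Nat.one_le_two_pow
    refine ⟨(a + 2) * 2 ^ k, hbase, fun n => ?_⟩
    have hcoeff : a ≤ (a + 2) ^ (n.size + 1) :=
      (Nat.le_add_right a 2).trans (Nat.le_self_pow (Nat.succ_ne_zero _) _)
    have hpow : n ≤ 2 ^ (n.size + 1) :=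
      (Nat.lt_size_self n).le.trans (Nat.pow_le_pow_right Nat.two_pos (Nat.le_succ _))
    calc (Polynomial.monomial k a).eval n = a * n ^ k := Polynomial.eval_monomial
      _ ≤ (a + 2) ^ (n.size + 1) * (2 ^ (n.size + 1)) ^ k :=
        Nat.mul_le_mul hcoeff (Nat.pow_le_pow_left hpow k)
      _ = counterRange ((a + 2) * 2 ^ k) n := by rw [counterRange, mul_pow, pow_right_comm]

theorem CellRule.lang_nonempty_iff_exists_isRun {A : Type} (R : CellRule A) {x : List A} {N : ℕ}
    (hN : 0 < N) (hx : x.length ≤ N) :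
    ((R.sentence x N).lang.Nonempty ↔ ∃ row, R.IsRun x (2 ^ N) row) ∧
      ((R.automaton x N).lang.Nonempty ↔ ∃ row, R.IsRun x (2 ^ N) row) := by
  have sentence_of_run : (∃ row, R.IsRun x (2 ^ N) row) → (R.sentence x N).lang.Nonempty :=
    fun ⟨_, hrow⟩ => ⟨_, wordOf_mem_lang_sentence hN hx hrow⟩
  have automaton_of_sentence : (R.sentence x N).lang.Nonempty → (R.automaton x N).lang.Nonempty :=
    fun ⟨_, hσ⟩ => ⟨_, automaton_accepts_of_mem_lang_sentence hσ⟩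
  have run_of_automaton : (R.automaton x N).lang.Nonempty → ∃ row, R.IsRun x (2 ^ N) row :=
    fun ⟨_, hσ⟩ => exists_isRun_of_accepts hN hx hσ
  exact ⟨⟨run_of_automaton ∘ automaton_of_sentence, sentence_of_run⟩,
    ⟨run_of_automaton, automaton_of_sentence ∘ sentence_of_run⟩⟩

theorem InExpSpace.exists_instances {A : Type} {L : Language A} (h : InExpSpace L) :
    ∃ (R : CellRule A) (B : ℕ), 1 < B ∧ ∀ x : List A,
      (x ∈ L ↔ (R.sentence x (counterRange B x.length)).lang.Nonempty) ∧
      (x ∈ L ↔ (R.automaton x (counterRange B x.length)).lang.Nonempty) := by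
  obtain ⟨R, p, hp⟩ := h.exists_cellRule
  obtain ⟨B, hB, hrange⟩ := exists_eval_le_counterRange (p + Polynomial.X)
  refine ⟨R, B, hB, fun x => ?_⟩
  have hle := hrange x.length
  rw [Polynomial.eval_add, Polynomial.eval_X] at hle
  have hpos : 0 < counterRange B x.length := Nat.pow_pos (Nat.zero_lt_of_lt hB)
  have hrun := R.lang_nonempty_iff_exists_isRun hpos (Nat.le_of_add_left_le hle)
  rw [hp x _ (Nat.le_of_add_right_le hle)]
  exact ⟨hrun.1.symm, hrun.2.symm⟩

theorem SafetyARA.encode_mem_iff {m k : ℕ} (M : SafetyARA (Fin m) (Fin k)) :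
    M.encode ∈ safetyARANonemptiness ↔ M.lang.Nonempty := by
  constructor
  · rintro ⟨m', k', M', hM, h⟩
    obtain ⟨rfl, rfl, hM⟩ := SafetyARA.encode_inj hM
    rwa [eq_of_heq hM]
  · exact fun h => ⟨m, k, M, rfl, h⟩

theorem SafetyLTL.IsSentence.encode_mem_iff {m : ℕ} {φ : SafetyLTL (Fin m)} (hφ : φ.IsSentence) :
    φ.encode ∈ safetyLTLSatisfiability ↔ φ.lang.Nonempty := by
  constructor
  · rintro ⟨m', φ', hm, -, h⟩
    obtain ⟨rfl, hm⟩ := SafetyLTL.encode_inj hm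
    rwa [eq_of_heq hm]
  · exact fun h => ⟨m, φ, rfl, hφ, h⟩

theorem expSpaceHard_safetyARANonemptiness : ExpSpaceHard safetyARANonemptiness := by
  intro A _ L hL
  have := Fintype.ofFinite A
  obtain ⟨R, B, hB, hL⟩ := hL.exists_instances
  have : NeZero B := .of_gt hB
  have hgen := R.generableFrom_automaton (B := B) (Fintype.equivFin _) (Fintype.equivFin _)
  refine ⟨_, hgen.logspaceComputable hB, fun x => ?_⟩
  rw [SafetyARA.encode_mem_iff, SafetyARA.lang_reindex_nonempty]
  exact (hL x).2

theorem expSpaceHard_safetyLTLSatisfiability : ExpSpaceHard safetyLTLSatisfiability := by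
  intro A _ L hL
  have := Fintype.ofFinite A
  obtain ⟨R, B, hB, hL⟩ := hL.exists_instances
  have : NeZero B := .of_gt hB
  let e := Fintype.equivFin R.Letter
  refine ⟨_, (R.generableFrom_sentence e).logspaceComputable hB, fun x => ?_⟩
  have hsentence (N : ℕ) : ((R.sentence x N).map e).IsSentence :=
    (SafetyLTL.isSentence_map e _).2 (R.isSentence_sentence x N)
  rw [(hsentence _).encode_mem_iff, SafetyLTL.lang_map_nonempty]
  exact (hL x).1

theorem mainTheorem2 :
    ExpSpaceHard safetyARANonemptiness ∧ ExpSpaceHard safetyLTLSatisfiability :=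
  ⟨expSpaceHard_safetyARANonemptiness, expSpaceHard_safetyLTLSatisfiability⟩
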